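/- Let $s,t$ be formal variables and let $q\in\mathbb C[[s]][[t]]$ satisfy $q\equiv 1+s^2t \bmod s^3t$. Put $\hbar=\log q$ and $q^a=\exp(\hbar a)$. **The quantum algebra.** For a coefficient ring $K\in\{\mathbb C[[s]],\ \mathbb C((s))\}$ let $U_q(\mathfrak{sl}_3)$ be the $t$-adically complete $K[[t]]$-algebra topologically generated by $h_{12},h_{23}$ (commuting), $e_{12},e_{23},e_{21},e_{32}$, subject to $$[h_{ij},e_{kl}]=(\delta_{ik}+\delta_{jl}-\delta_{il}-\delta_{jk})e_{kl},\qquad [e_{12},e_{32}]=[e_{21},e_{23}]=0,$$ $$[e_{i,i+1},e_{i+1,i}]=\frac{q^{h_{i,i+1}}-q^{-h_{i,i+1}}}{q-q^{-1}}\quad(i=1,2),$$ $$e_{13}e_{12}=q^{-1}e_{12}e_{13},\quad e_{13}e_{23}=q\,e_{23}e_{13},\quad e_{21}e_{31}=q\,e_{31}e_{21},\quad e_{32}e_{31}=q^{-1}e_{31}e_{32},$$ where $e_{13}=e_{12}e_{23}-q^{-1}e_{23}e_{12}$ and $e_{31}=e_{32}e_{21}-q\,e_{21}e_{32}$. (Since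 $(q-q^{-1})/\hbar$ is a unit, the relation with denominator $q-q^{-1}$ is read as $\frac{q-q^{-1}}{\hbar}\,[e_{i,i+1},e_{i+1,i}]=\frac{q^{h}-q^{-h}}{\hbar}$ with $h=h_{i,i+1}$, the right side being the power series in $\hbar$ obtained by formal division.) The coproduct, with values in the $t$-adically completed tensor square $U_q(\mathfrak{sl}_3)\hat\otimes U_q(\mathfrak{sl}_3)$, is $$\Delta(h_{ij})=h_{ij}\otimes1+1\otimes h_{ij},\quad \Delta(e_{i,i+1})=q^{-h_{i,i+1}}\otimes e_{i,i+1}+e_{i,i+1}\otimes1,\quad \Delta(e_{i+1,i})=e_{i+1,i}\otimes q^{h_{i,i+1}}+1\otimes e_{i+1,i},$$ and the counit $\varepsilon$ vanishes on the generators. Put $h_{12}^\perp=\tfrac13(h_{12}+2h_{23})$, i.e. $\tfrac13(e_{11}+e_{22})-\tfrac23e_{33}$. **Terminology.** A twist of a (topological) bialgebra is an invertible $F$ in its (completed) tensor square with $F_{12}(\Delta\otimes\mathrm{id})(F)=F_{23}(\mathrm{id}\otimes\Delta)(F)$ and $(\varepsilon\otimes\mathrm{id})(F)=1=(\mathrm{id}\otimes\varepsilon)(F)$.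 Elements $F,G$ of the tensor square are equivalent if $F=(V\otimes V)\,G\,\Delta(V^{-1})$ for some invertible $V$ with $\varepsilon(V)=1$. For elements $F,G$ over $\mathbb C((s))[[t]]$, $F\equiv G \bmod st$ means that $F-G$ is $st$ times (the image of) an element of the completed tensor square over $\mathbb C[[s]][[t]]$. Such an $F$ has the limit $L\in (U(\mathfrak{sl}_3(\mathbb C))\otimes U(\mathfrak{sl}_3(\mathbb C)))[[t]]$ as $s\to0$ if $F$ is the image of an element over $\mathbb C[[s]][[t]]$ whose specialization at $s=0$ (where $q=1$ and $e_{kl},h_{kl}$ become the elements $E_{kl},H_{kl}=E_{kk}-E_{ll}$ of $\mathfrak{sl}_3(\mathbb C)$) is $L$. **Statement.** Over $\mathbb C((s))[[t]]$ put $$W=\exp_{q^2}(ts^{-1}e_{12}),\qquad \exp_Q(x)=\sum_{n\ge0}\frac{x^n}{(n)_Q!},\quad (n)_Q=\frac{Q^n-1}{Q-1},\quad (n)_Q!=(1)_Q(2)_Q\cdots(n)_Q .$$ Then $W$ is invertible. Put $$\mathcal J(s,t)=(W\otimes W)\Delta(W^{-1}),\qquad F_q=(W\otimes W)\,q^{s^{-1}h_{12}^\perp\otimes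 h_{12}}\,\Delta(W^{-1}),$$ where $q^{s^{-1}h_{12}^\perp\otimes h_{12}}=\exp(s^{-1}\hbar\,h_{12}^\perp\otimes h_{12})$. 1. The Abelian element $q^{s^{-1}h_{12}^\perp\otimes h_{12}}$ is a twist of $U_q(\mathfrak{sl}_3)$; $F_q$ is a twist of $U_q(\mathfrak{sl}_3)$ and is equivalent to this Abelian twist; and $F_q=\big(\mathrm{Ad}(W\otimes W)(q^{s^{-1}h_{12}^\perp\otimes h_{12}})\big)\,\mathcal J(s,t)$, where $\mathrm{Ad}(W\otimes W)(x)=(W\otimes W)\,x\,(W\otimes W)^{-1}$. 2. $F_q\equiv\exp(-2t^2\,h_{12}^\perp\otimes e_{12}) \bmod st$. 3. The limit of $F_q$ as $s\to0$ is $\exp(\xi\,H_{12}^\perp\otimes E_{12})$ with $\xi=-2t^2$ and $H_{12}^\perp=\tfrac13(E_{11}+E_{22})-\tfrac23E_{33}$. It is a twist of $U(\mathfrak{sl}_3(\mathbb C))[[t]]$ with the standard coproduct (the Reshetikhin twist $\exp(\xi H_\lambda^\perp\otimes E_\lambda)$ for the root $\lambda$ of $E_{12}$). -/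

import Mathlib

open TensorProduct PowerSeries

set_option linter.unusedSectionVars false

namespace QSl3

section NilpotentCalculus

variable {R A : Type} [CommRing R] [Ring A] [Algebra R A]

theorem isNilpotent_smul {ħ : R} (hħ : IsNilpotent ħ) (a : A) : IsNilpotent (ħ • a) := by
  obtain ⟨n, hn⟩ := hħ
  exact ⟨n, by rw [smul_pow, hn, zero_smul]⟩

variable [Algebra ℚ A]

/-- `q ^ a = exp (ħ a)` for `q = exp ħ`, where `ħ` is nilpotent. -/
noncomputable def qpow (ħ : R) (a : A) : A := IsNilpotent.exp (ħ • a)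

/-- `(exp (ħ a) - 1) / ħ = ∑ ħ ^ k a ^ (k + 1) / (k + 1)!`, where `ħ` is nilpotent (so that the sum
is finite). -/
noncomputable def expDiv (ħ : R) (a : A) : A :=
  ∑ k ∈ Finset.range (nilpotencyClass ħ), ((k + 1).factorial : ℚ)⁻¹ • (ħ ^ k • a ^ (k + 1))

/-- `(q ^ a - q ^ (-a)) / ħ` for `q = exp ħ`. -/
noncomputable def qnum (ħ : R) (a : A) : A := expDiv ħ a - expDiv ħ (-a)

theorem expDiv_eq_sum {ħ : R} {N : ℕ} (hN : ħ ^ N = 0) (a : A) :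
    expDiv ħ a =
      ∑ k ∈ Finset.range N, ((k + 1).factorial : ℚ)⁻¹ • (ħ ^ k • a ^ (k + 1)) := by
  have hle : nilpotencyClass ħ ≤ N := csInf_le' hN
  rw [expDiv]
  refine Finset.sum_subset (Finset.range_mono hle) fun k _ hk => ?_
  have : ħ ^ k = 0 :=
    pow_eq_zero_of_le (by simpa using hk) (pow_nilpotencyClass ⟨N, hN⟩)
  rw [this, zero_smul, smul_zero]

theorem smul_expDiv {ħ : R} (hħ : IsNilpotent ħ) (a : A) :
    ħ • expDiv ħ a = qpow ħ a - 1 := by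
  obtain ⟨N, hN⟩ := hħ
  have h1 : (ħ • a) ^ (N + 1) = 0 := by rw [smul_pow, pow_succ, hN, zero_mul, zero_smul]
  rw [qpow, IsNilpotent.exp_eq_sum h1, expDiv_eq_sum hN, Finset.sum_range_succ', Finset.smul_sum]
  simp only [Nat.factorial_zero, Nat.cast_one, inv_one, pow_zero, one_smul, add_sub_cancel_right]
  refine Finset.sum_congr rfl fun k _ => ?_
  rw [smul_comm ħ, smul_smul, smul_pow, ← pow_succ']

theorem qpow_add {ħ : R} (hħ : IsNilpotent ħ) {a b : A} (h : Commute a b) :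
    qpow ħ (a + b) = qpow ħ a * qpow ħ b := by
  rw [qpow, smul_add, IsNilpotent.exp_add_of_commute _ (isNilpotent_smul hħ a)
    (isNilpotent_smul hħ b)]
  · rfl
  · exact (h.smul_left ħ).smul_right ħ

theorem qpow_zero (ħ : R) : qpow ħ (0 : A) = 1 := by simp [qpow]

theorem qpow_mul_neg {ħ : R} (hħ : IsNilpotent ħ) (a : A) : qpow ħ a * qpow ħ (-a) = 1 := by
  rw [← qpow_add hħ (Commute.neg_right (Commute.refl a)), add_neg_cancel, qpow_zero]

theorem Commute.qpow {ħ : R} {a b : A} (h : Commute a b) : Commute a (QSl3.qpow ħ b) := by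
  rw [QSl3.qpow, IsNilpotent.exp]
  exact Commute.sum_right _ _ _ fun k _ => (((h.smul_right ħ).pow_right k).smul_right _)

theorem Commute.expDiv {ħ : R} {a b : A} (h : Commute a b) : Commute a (QSl3.expDiv ħ b) := by
  rw [QSl3.expDiv]
  exact Commute.sum_right _ _ _ fun k _ => (((h.pow_right (k + 1)).smul_right _).smul_right _)

theorem expDiv_add {ħ : R} (hħ : IsNilpotent ħ) {a b : A} (h : Commute a b) :
    expDiv ħ (a + b) = expDiv ħ a + qpow ħ a * expDiv ħ b := by
  obtain ⟨N, hN⟩ := hħ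
  have hN1 : (ħ • a) ^ N = 0 := by rw [smul_pow, hN, zero_smul]
  set T : ℕ → ℕ → A := fun i j =>
    ((i.factorial : ℚ)⁻¹ * ((j + 1).factorial : ℚ)⁻¹) • (ħ ^ (i + j) • (a ^ i * b ^ (j + 1))) with hT
  have hT0 : ∀ i j, N ≤ i + j → T i j = 0 := fun i j hij => by
    simp only [hT]
    rw [pow_eq_zero_of_le hij hN, zero_smul, smul_zero]
  have key : ∀ k, ((k + 1).factorial : ℚ)⁻¹ • (ħ ^ k • (a + b) ^ (k + 1)) =
      ((k + 1).factorial : ℚ)⁻¹ • (ħ ^ k • a ^ (k + 1)) +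
        ∑ i ∈ Finset.range (k + 1), T i (k - i) := by
    intro k
    rw [h.add_pow', Finset.Nat.antidiagonal_succ', Finset.sum_cons, smul_add, smul_add]
    congr 1
    · simp
    · rw [Finset.sum_map, Finset.smul_sum, Finset.smul_sum,
        ← Finset.Nat.sum_antidiagonal_eq_sum_range_succ T k]
      refine Finset.sum_congr rfl fun p hp => ?_
      obtain ⟨i, j⟩ := p
      have hij : i + j = k := by simpa using hp
      subst hij
      simp only [hT, Function.Embedding.prodMap, Function.Embedding.coeFn_mk, Prod.map,
        Function.Embedding.refl_apply]
      rw [← Nat.cast_smul_eq_nsmul ℚ, smul_comm (ħ ^ (i + j)), smul_smul]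
      congr 1
      have hc := Nat.add_choose_mul_factorial_mul_factorial i (j + 1)
      rw [← add_assoc, Nat.choose_symm_of_eq_add (show i + j + 1 = (j + 1) + i by ring)] at hc
      have hc' : (((i + j + 1).choose i : ℕ) : ℚ) * i.factorial * (j + 1).factorial =
          (i + j + 1).factorial := by exact_mod_cast hc
      have p1 : (i.factorial : ℚ) ≠ 0 := by positivity
      have p2 : ((j + 1).factorial : ℚ) ≠ 0 := by positivity
      have p3 : ((i + j + 1).factorial : ℚ) ≠ 0 := by positivity
      rw [← hc'] at p3 ⊢
      have p4 := left_ne_zero_of_mul (left_ne_zero_of_mul p3)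
      field_simp
  rw [expDiv_eq_sum hN, expDiv_eq_sum hN, expDiv_eq_sum hN, qpow, IsNilpotent.exp_eq_sum hN1,
    Finset.sum_congr rfl fun k _ => key k, Finset.sum_add_distrib, Finset.sum_range_diag_flip,
    Finset.sum_mul]
  congr 1
  refine Finset.sum_congr rfl fun i hi => ?_
  rw [Finset.mul_sum]
  have hsub : ∑ j ∈ Finset.range (N - i), T i j = ∑ j ∈ Finset.range N, T i j :=
    Finset.sum_subset (Finset.range_mono (Nat.sub_le _ _)) fun j _ hj => hT0 i j (by
      simp only [Finset.mem_range] at hj; omega)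
  rw [hsub]
  refine Finset.sum_congr rfl fun j _ => ?_
  simp only [hT]
  rw [smul_pow, smul_mul_smul_comm, smul_mul_smul_comm, pow_add]

/-- Semilinear ring homomorphisms preserve `qpow`. -/
theorem map_qpow {R' A' : Type} [CommRing R'] [Ring A'] [Algebra R' A'] [Algebra ℚ A']
    (φ : R →+* R') (f : A →+* A') (hf : ∀ (r : R) (a : A), f (r • a) = φ r • f a)
    {ħ : R} (hħ : IsNilpotent ħ) (a : A) : f (qpow ħ a) = qpow (φ ħ) (f a) := by
  rw [qpow, qpow, IsNilpotent.map_exp (isNilpotent_smul hħ a), hf]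

theorem map_expDiv {R' A' : Type} [CommRing R'] [Ring A'] [Algebra R' A'] [Algebra ℚ A']
    (φ : R →+* R') (f : A →+* A') (hf : ∀ (r : R) (a : A), f (r • a) = φ r • f a)
    {ħ : R} (hħ : IsNilpotent ħ) (a : A) : f (expDiv ħ a) = expDiv (φ ħ) (f a) := by
  obtain ⟨N, hN⟩ := hħ
  have hN' : (φ ħ) ^ N = 0 := by rw [← map_pow, hN, map_zero]
  simp only [expDiv_eq_sum hN, expDiv_eq_sum hN', map_sum, map_rat_smul, hf, map_pow]

theorem map_qnum {R' A' : Type} [CommRing R'] [Ring A'] [Algebra R' A'] [Algebra ℚ A']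
    (φ : R →+* R') (f : A →+* A') (hf : ∀ (r : R) (a : A), f (r • a) = φ r • f a)
    {ħ : R} (hħ : IsNilpotent ħ) (a : A) : f (qnum ħ a) = qnum (φ ħ) (f a) := by
  rw [qnum, qnum, map_sub, map_expDiv φ f hf hħ, map_expDiv φ f hf hħ, map_neg]

theorem qnum_add {ħ : R} (hħ : IsNilpotent ħ) {a b : A} (h : Commute a b) :
    qnum ħ (a + b) = qnum ħ a * qpow ħ b + qpow ħ (-a) * qnum ħ b := by
  have hna : Commute (-a) (-b) := h.neg_left.neg_right
  have e1 : expDiv ħ (a + b) = expDiv ħ b + qpow ħ b * expDiv ħ a := by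
    rw [add_comm, expDiv_add hħ h.symm]
  have e2 : expDiv ħ (-(a + b)) = expDiv ħ (-a) + qpow ħ (-a) * expDiv ħ (-b) := by
    rw [neg_add, expDiv_add hħ hna]
  have e3 : qpow ħ b = 1 + ħ • expDiv ħ b := by rw [smul_expDiv hħ]; abel
  have e4 : qpow ħ (-a) = 1 + ħ • expDiv ħ (-a) := by rw [smul_expDiv hħ]; abel
  have c1 : Commute (expDiv ħ a) (expDiv ħ b) := (Commute.expDiv (Commute.expDiv h.symm).symm)
  have c2 : Commute (expDiv ħ (-a)) (expDiv ħ b) :=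
    (Commute.expDiv (Commute.expDiv h.neg_left.symm).symm)
  rw [qnum, qnum, qnum, e1, e2, e3, e4]
  simp only [add_mul, mul_add, sub_mul, mul_sub, smul_mul_assoc, mul_smul_comm, one_mul, mul_one,
    c1.eq, smul_sub]
  abel

/-- If `[h, e] = c e` then `q ^ h e = q ^ c e q ^ h`. -/
theorem qpow_mul_of_bracket [Algebra ℚ R] {ħ : R} (hħ : IsNilpotent ħ) {h e : A} {c : R}
    (hc : h * e = e * h + c • e) :
    qpow ħ h * e = qpow ħ c • (e * qpow ħ h) := by
  obtain ⟨N, hN⟩ := id hħ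
  have h1 : SemiconjBy e (h + algebraMap R A c) h := by
    rw [SemiconjBy, hc, mul_add, ← Algebra.commutes, Algebra.smul_def]
  have h2 : SemiconjBy e (qpow ħ (h + algebraMap R A c)) (qpow ħ h) := by
    have n1 : (ħ • (h + algebraMap R A c)) ^ N = 0 := by rw [smul_pow, hN, zero_smul]
    have n2 : (ħ • h) ^ N = 0 := by rw [smul_pow, hN, zero_smul]
    rw [qpow, qpow, IsNilpotent.exp_eq_sum n1, IsNilpotent.exp_eq_sum n2, SemiconjBy,
      Finset.mul_sum, Finset.sum_mul]
    refine Finset.sum_congr rfl fun k _ => ?_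
    rw [smul_pow, smul_pow, mul_smul_comm, mul_smul_comm, smul_mul_assoc, smul_mul_assoc,
      (h1.pow_right k).eq]
  have h3 : algebraMap R A (qpow ħ c) = qpow ħ (algebraMap R A c) :=
    map_qpow (RingHom.id R) (algebraMap R A) (fun r x => by simp [Algebra.smul_def]) hħ c
  rw [← h2.eq, qpow_add hħ (Algebra.commutes c h).symm, ← h3, ← mul_assoc, ← Algebra.commutes,
    Algebra.smul_def]

end NilpotentCalculus

/-- Indices of the generators of `U_q(sl_3)`: `e 0, e 1` are the simple root vectors `e_12, e_23`,
`f 0, f 1` are the opposite root vectors `e_21, e_32`, and `h 0, h 1` are `h_12, h_23`. -/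
inductive Gen
  | e (i : Fin 2)
  | f (i : Fin 2)
  | h (i : Fin 2)

/-- The Cartan matrix of `sl_3`. -/
def cartan (i j : Fin 2) : ℤ := if i = j then 2 else -1


section Relations

variable {R A : Type} [CommRing R] [Algebra ℚ R] [Ring A] [Algebra R A] [Algebra ℚ A]

/-- The composite root vector `e_13 = e_12 e_23 - q⁻¹ e_23 e_12`. -/
noncomputable def e13 (ħ : R) (g : Gen → A) : A :=
  g (.e 0) * g (.e 1) - qpow ħ (-1 : R) • (g (.e 1) * g (.e 0))

/-- The composite root vector `e_31 = e_32 e_21 - q e_21 e_32`. -/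
noncomputable def e31 (ħ : R) (g : Gen → A) : A :=
  g (.f 1) * g (.f 0) - qpow ħ (1 : R) • (g (.f 0) * g (.f 1))

/-- The defining relations of `U_q(sl_3)`, `q = exp ħ`, as pairs (left side, right side), for a
family `g` of elements of an `R`-algebra. The relation
`[e_{i,i+1}, e_{i+1,i}] = (q ^ h - q ^ (-h)) / (q - q⁻¹)`, `h = h_{i,i+1}`, is written with the
denominator `(q - q⁻¹) / ħ` (a unit) moved to the left. -/
inductive QRel (ħ : R) (g : Gen → A) : A → A → Prop
  | h_h : QRel ħ g (g (.h 0) * g (.h 1)) (g (.h 1) * g (.h 0))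
  | h_e (i j : Fin 2) : QRel ħ g (g (.h i) * g (.e j) - g (.e j) * g (.h i))
      ((cartan i j : R) • g (.e j))
  | h_f (i j : Fin 2) : QRel ħ g (g (.h i) * g (.f j) - g (.f j) * g (.h i))
      ((-cartan i j : R) • g (.f j))
  | e_f_ne (i j : Fin 2) : i ≠ j → QRel ħ g (g (.e i) * g (.f j)) (g (.f j) * g (.e i))
  | e_f (i : Fin 2) : QRel ħ g (qnum ħ (1 : R) • (g (.e i) * g (.f i) - g (.f i) * g (.e i)))
      (qnum ħ (g (.h i)))
  | e13_e12 : QRel ħ g (e13 ħ g * g (.e 0)) (qpow ħ (-1 : R) • (g (.e 0) * e13 ħ g))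
  | e13_e23 : QRel ħ g (e13 ħ g * g (.e 1)) (qpow ħ (1 : R) • (g (.e 1) * e13 ħ g))
  | e21_e31 : QRel ħ g (g (.f 0) * e31 ħ g) (qpow ħ (1 : R) • (e31 ħ g * g (.f 0)))
  | e32_e31 : QRel ħ g (g (.f 1) * e31 ħ g) (qpow ħ (-1 : R) • (e31 ħ g * g (.f 1)))

/-- A family `g` satisfies the defining relations of `U_q(sl_3)`. -/
def QRelations (ħ : R) (g : Gen → A) : Prop := ∀ x y, QRel ħ g x y → x = y

theorem QRel.map {R' A' : Type} [CommRing R'] [Algebra ℚ R'] [Ring A'] [Algebra R' A']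
    [Algebra ℚ A'] (φ : R →+* R') (f : A →+* A') (hf : ∀ (r : R) (a : A), f (r • a) = φ r • f a)
    {ħ : R} (hħ : IsNilpotent ħ) {g : Gen → A} {x y : A} (h : QRel ħ g x y) :
    QRel (φ ħ) (fun i => f (g i)) (f x) (f y) := by
  have hq : ∀ r : R, φ (qpow ħ r) = qpow (φ ħ) (φ r) := fun r =>
    map_qpow φ φ (fun r a => by simp) hħ r
  have hn : φ (qnum ħ 1) = qnum (φ ħ) 1 := by
    rw [map_qnum φ φ (fun r a => by simp) hħ, map_one]
  have he : f (e13 ħ g) = e13 (φ ħ) (fun i => f (g i)) := by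
    simp [e13, hf, hq]
  have hf' : f (e31 ħ g) = e31 (φ ħ) (fun i => f (g i)) := by
    simp [e31, hf, hq]
  cases h with
  | h_h => simpa using QRel.h_h
  | h_e i j => simpa [hf] using QRel.h_e (ħ := φ ħ) (g := fun i => f (g i)) i j
  | h_f i j => simpa [hf] using QRel.h_f (ħ := φ ħ) (g := fun i => f (g i)) i j
  | e_f_ne i j hij => simpa using QRel.e_f_ne (ħ := φ ħ) (g := fun i => f (g i)) i j hij
  | e_f i =>
    simpa [hf, hn, map_qnum φ f hf hħ] using QRel.e_f (ħ := φ ħ) (g := fun i => f (g i)) i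
  | e13_e12 => simpa [hf, he, hq] using QRel.e13_e12 (ħ := φ ħ) (g := fun i => f (g i))
  | e13_e23 => simpa [hf, he, hq] using QRel.e13_e23 (ħ := φ ħ) (g := fun i => f (g i))
  | e21_e31 => simpa [hf, hf', hq] using QRel.e21_e31 (ħ := φ ħ) (g := fun i => f (g i))
  | e32_e31 => simpa [hf, hf', hq] using QRel.e32_e31 (ħ := φ ħ) (g := fun i => f (g i))

theorem QRel.exists_of_map {A' : Type} [Ring A'] [Algebra R A'] [Algebra ℚ A'] (f : A →ₐ[R] A')
    {ħ : R} (hħ : IsNilpotent ħ) {g : Gen → A} {x y : A'} (h : QRel ħ (fun i => f (g i)) x y) :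
    ∃ x' y', QRel ħ g x' y' ∧ f x' = x ∧ f y' = y := by
  have hn : ∀ a, f (qnum ħ a) = qnum ħ (f a) := fun a =>
    map_qnum (RingHom.id R) f.toRingHom (fun r a => by simp) hħ a
  cases h with
  | h_h => exact ⟨_, _, .h_h, by simp, by simp⟩
  | h_e i j => exact ⟨_, _, .h_e i j, by simp, by simp⟩
  | h_f i j => exact ⟨_, _, .h_f i j, by simp, by simp⟩
  | e_f_ne i j hij => exact ⟨_, _, .e_f_ne i j hij, by simp, by simp⟩
  | e_f i => exact ⟨_, _, .e_f i, by simp, by simp [hn]⟩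
  | e13_e12 => exact ⟨_, _, .e13_e12, by simp [e13], by simp [e13]⟩
  | e13_e23 => exact ⟨_, _, .e13_e23, by simp [e13], by simp [e13]⟩
  | e21_e31 => exact ⟨_, _, .e21_e31, by simp [e31], by simp [e31]⟩
  | e32_e31 => exact ⟨_, _, .e32_e31, by simp [e31], by simp [e31]⟩

end Relations

/-- The `q`-Serre identity for `X, Y`, with `p = q` and `r = q⁻¹`. -/
def Serre {R A : Type} [CommRing R] [Ring A] [Algebra R A] (p r : R) (X Y : A) : Prop :=
  X * X * Y + Y * X * X = (p + r) • (X * Y * X)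

theorem Serre.add {R A : Type} [CommRing R] [Ring A] [Algebra R A] {p r : R} (hpr : p * r = 1)
    {a b c d : A} (hac : Serre p r a c) (hbd : Serre p r b d)
    (hba : b * a = (r * r) • (a * b)) (hbc : b * c = p • (c * b)) (hda : d * a = p • (a * d)) :
    Serre p r (a + b) (c + d) := by
  have hba' : ∀ z, b * (a * z) = (r * r) • (a * (b * z)) := fun z => by
    rw [← mul_assoc, hba, smul_mul_assoc, mul_assoc]
  have hbc' : ∀ z, b * (c * z) = p • (c * (b * z)) := fun z => by
    rw [← mul_assoc, hbc, smul_mul_assoc, mul_assoc]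
  have hda' : ∀ z, d * (a * z) = p • (a * (d * z)) := fun z => by
    rw [← mul_assoc, hda, smul_mul_assoc, mul_assoc]
  unfold Serre at *
  simp only [mul_assoc] at hac hbd
  simp only [mul_add, add_mul, mul_assoc, hba, hbc, hda, hba', hbc', hda', smul_smul,
    mul_smul_comm, smul_mul_assoc, smul_add] at hac hbd ⊢
  have h0 := congrArg₂ (· + ·) (sub_eq_zero.2 hac) (sub_eq_zero.2 hbd)
  simp only [add_zero] at h0
  refine sub_eq_zero.1 (Eq.trans ?_ h0)

  match_scalars
  all_goals first
    | ring1
    | linear_combination r * hpr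
    | linear_combination (-1 : R) * hpr
    | linear_combination (-(p * r + 1 + r ^ 2)) * hpr

section RelationLemmas

variable {R A : Type} [CommRing R] [Algebra ℚ R] [Ring A] [Algebra R A] [Algebra ℚ A]
  {ħ : R} {g : Gen → A}

theorem cartan_symm (i j : Fin 2) : cartan i j = cartan j i := by
  simp only [cartan, eq_comm]

theorem qpow_one_mul (hħ : IsNilpotent ħ) : qpow ħ (1 : R) * qpow ħ (-1 : R) = 1 :=
  qpow_mul_neg hħ 1

theorem iff_of_sub_eq_smul {u : R} (hu : IsUnit u) {x y z w : A} (h : x - y = u • (z - w)) :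
    x = y ↔ z = w := by
  rw [← sub_eq_zero, h, hu.smul_eq_zero, sub_eq_zero]

theorem serre_iff₁ {p r : R} (hpr : p * r = 1) (X Y : A) :
    (X * Y - r • (Y * X)) * X = r • (X * (X * Y - r • (Y * X))) ↔ Serre p r X Y := by
  refine iff_of_sub_eq_smul (u := -r) (IsUnit.of_mul_eq_one (-p) (by linear_combination hpr)) ?_
  simp only [mul_sub, sub_mul, mul_assoc, smul_mul_assoc, mul_smul_comm]
  match_scalars
  all_goals first
    | ring1
    | linear_combination hpr
    | linear_combination -hpr

theorem serre_iff₂ {p r : R} (hpr : p * r = 1) (X Y : A) :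
    (X * Y - r • (Y * X)) * Y = p • (Y * (X * Y - r • (Y * X))) ↔ Serre p r Y X := by
  refine iff_of_sub_eq_smul (u := (1 : R)) isUnit_one ?_
  simp only [mul_sub, sub_mul, mul_assoc, smul_mul_assoc, mul_smul_comm]
  match_scalars
  all_goals first
    | ring1
    | linear_combination hpr

theorem serre_iff₃ {p r : R} (hpr : p * r = 1) (X Y : A) :
    X * (Y * X - p • (X * Y)) = p • ((Y * X - p • (X * Y)) * X) ↔ Serre p r X Y := by
  refine iff_of_sub_eq_smul (u := -p) (IsUnit.of_mul_eq_one (-r) (by linear_combination hpr)) ?_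
  simp only [mul_sub, sub_mul, mul_assoc, smul_mul_assoc, mul_smul_comm]
  match_scalars
  all_goals first
    | ring1
    | linear_combination hpr
    | linear_combination -hpr

theorem serre_iff₄ {p r : R} (hpr : p * r = 1) (X Y : A) :
    Y * (Y * X - p • (X * Y)) = r • ((Y * X - p • (X * Y)) * Y) ↔ Serre p r Y X := by
  refine iff_of_sub_eq_smul (u := (1 : R)) isUnit_one ?_
  simp only [mul_sub, sub_mul, mul_assoc, smul_mul_assoc, mul_smul_comm]
  match_scalars
  all_goals first
    | ring1
    | linear_combination hpr


theorem QRelations.mk (hħ : IsNilpotent ħ)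
    (h_h : Commute (g (.h 0)) (g (.h 1)))
    (h_e : ∀ i j, g (.h i) * g (.e j) = g (.e j) * g (.h i) + (cartan i j : R) • g (.e j))
    (h_f : ∀ i j, g (.h i) * g (.f j) = g (.f j) * g (.h i) + (-cartan i j : R) • g (.f j))
    (e_f_ne : ∀ i j, i ≠ j → g (.e i) * g (.f j) = g (.f j) * g (.e i))
    (e_f : ∀ i, qnum ħ (1 : R) • (g (.e i) * g (.f i) - g (.f i) * g (.e i)) = qnum ħ (g (.h i)))
    (serre_e : ∀ i j, i ≠ j → Serre (qpow ħ (1 : R)) (qpow ħ (-1 : R)) (g (.e i)) (g (.e j)))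
    (serre_f : ∀ i j, i ≠ j → Serre (qpow ħ (1 : R)) (qpow ħ (-1 : R)) (g (.f i)) (g (.f j))) :
    QRelations ħ g := by
  have hpr := qpow_one_mul hħ
  intro x y h
  cases h with
  | h_h => exact h_h
  | h_e i j => rw [sub_eq_iff_eq_add', h_e i j]
  | h_f i j => rw [sub_eq_iff_eq_add', h_f i j]
  | e_f_ne i j hij => exact e_f_ne i j hij
  | e_f i => exact e_f i
  | e13_e12 => exact (serre_iff₁ hpr _ _).2 (serre_e 0 1 (by decide))
  | e13_e23 => exact (serre_iff₂ hpr _ _).2 (serre_e 1 0 (by decide))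
  | e21_e31 => exact (serre_iff₃ hpr _ _).2 (serre_f 0 1 (by decide))
  | e32_e31 => exact (serre_iff₄ hpr _ _).2 (serre_f 1 0 (by decide))

namespace QRelations

theorem h_comm (hg : QRelations ħ g) (i j : Fin 2) : Commute (g (.h i)) (g (.h j)) := by
  have := hg _ _ .h_h
  fin_cases i <;> fin_cases j
  exacts [Commute.refl _, this, this.symm, Commute.refl _]

theorem h_e (hg : QRelations ħ g) (i j : Fin 2) :
    g (.h i) * g (.e j) = g (.e j) * g (.h i) + (cartan i j : R) • g (.e j) := by
  rw [← sub_eq_iff_eq_add']; exact hg _ _ (.h_e i j)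

theorem h_f (hg : QRelations ħ g) (i j : Fin 2) :
    g (.h i) * g (.f j) = g (.f j) * g (.h i) + (-cartan i j : R) • g (.f j) := by
  rw [← sub_eq_iff_eq_add']; exact hg _ _ (.h_f i j)

theorem serre_e (hg : QRelations ħ g) (hħ : IsNilpotent ħ) (i j : Fin 2) (hij : i ≠ j) :
    Serre (qpow ħ (1 : R)) (qpow ħ (-1 : R)) (g (.e i)) (g (.e j)) := by
  have hpr := qpow_one_mul hħ
  have h1 := (serre_iff₁ hpr _ _).1 (hg _ _ .e13_e12)
  have h2 := (serre_iff₂ hpr _ _).1 (hg _ _ .e13_e23)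
  fin_cases i <;> fin_cases j
  exacts [absurd rfl hij, h1, h2, absurd rfl hij]

theorem serre_f (hg : QRelations ħ g) (hħ : IsNilpotent ħ) (i j : Fin 2) (hij : i ≠ j) :
    Serre (qpow ħ (1 : R)) (qpow ħ (-1 : R)) (g (.f i)) (g (.f j)) := by
  have hpr := qpow_one_mul hħ
  have h1 := (serre_iff₃ hpr _ _).1 (hg _ _ .e21_e31)
  have h2 := (serre_iff₄ hpr _ _).1 (hg _ _ .e32_e31)
  fin_cases i <;> fin_cases j
  exacts [absurd rfl hij, h1, h2, absurd rfl hij]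

theorem kp_e (hg : QRelations ħ g) (hħ : IsNilpotent ħ) (i j : Fin 2) :
    qpow ħ (g (.h i)) * g (.e j) = qpow ħ (cartan i j : R) • (g (.e j) * qpow ħ (g (.h i))) :=
  qpow_mul_of_bracket hħ (hg.h_e i j)

theorem kp_f (hg : QRelations ħ g) (hħ : IsNilpotent ħ) (i j : Fin 2) :
    qpow ħ (g (.h i)) * g (.f j) = qpow ħ (-cartan i j : R) • (g (.f j) * qpow ħ (g (.h i))) :=
  qpow_mul_of_bracket hħ (hg.h_f i j)

theorem km_e (hg : QRelations ħ g) (hħ : IsNilpotent ħ) (i j : Fin 2) :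
    qpow ħ (-g (.h i)) * g (.e j) = qpow ħ (-cartan i j : R) • (g (.e j) * qpow ħ (-g (.h i))) :=
  qpow_mul_of_bracket hħ (by rw [neg_mul, mul_neg, hg.h_e i j, neg_add, neg_smul])

theorem km_f (hg : QRelations ħ g) (hħ : IsNilpotent ħ) (i j : Fin 2) :
    qpow ħ (-g (.h i)) * g (.f j) = qpow ħ (cartan i j : R) • (g (.f j) * qpow ħ (-g (.h i))) :=
  qpow_mul_of_bracket hħ (by rw [neg_mul, mul_neg, hg.h_f i j, neg_add, neg_smul, neg_neg])

variable (ħ g) in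
/-- The family of the coproducts of the generators. -/
noncomputable def comulGen : Gen → A ⊗[R] A
  | .e i => qpow ħ (-g (.h i)) ⊗ₜ g (.e i) + g (.e i) ⊗ₜ 1
  | .f i => g (.f i) ⊗ₜ qpow ħ (g (.h i)) + 1 ⊗ₜ g (.f i)
  | .h i => g (.h i) ⊗ₜ 1 + 1 ⊗ₜ g (.h i)

theorem qpow_tmul_one (hħ : IsNilpotent ħ) (a : A) :
    qpow ħ (a ⊗ₜ[R] (1 : A)) = qpow ħ a ⊗ₜ[R] (1 : A) :=
  (map_qpow (RingHom.id R) (Algebra.TensorProduct.includeLeft : A →ₐ[R] A ⊗[R] A).toRingHom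
    (fun r a => by simp [smul_tmul']) hħ a).symm

theorem qpow_one_tmul (hħ : IsNilpotent ħ) (a : A) :
    qpow ħ ((1 : A) ⊗ₜ[R] a) = (1 : A) ⊗ₜ[R] qpow ħ a :=
  (map_qpow (RingHom.id R) (Algebra.TensorProduct.includeRight : A →ₐ[R] A ⊗[R] A).toRingHom
    (fun r a => by simp) hħ a).symm

theorem qnum_tmul_one (hħ : IsNilpotent ħ) (a : A) :
    qnum ħ (a ⊗ₜ[R] (1 : A)) = qnum ħ a ⊗ₜ[R] (1 : A) :=
  (map_qnum (RingHom.id R) (Algebra.TensorProduct.includeLeft : A →ₐ[R] A ⊗[R] A).toRingHom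
    (fun r a => by simp [smul_tmul']) hħ a).symm

theorem qnum_one_tmul (hħ : IsNilpotent ħ) (a : A) :
    qnum ħ ((1 : A) ⊗ₜ[R] a) = (1 : A) ⊗ₜ[R] qnum ħ a :=
  (map_qnum (RingHom.id R) (Algebra.TensorProduct.includeRight : A →ₐ[R] A ⊗[R] A).toRingHom
    (fun r a => by simp) hħ a).symm

theorem bracket_e_f (hg : QRelations ħ g) (hħ : IsNilpotent ħ) (i j : Fin 2) :
    comulGen ħ g (.e i) * comulGen ħ g (.f j) - comulGen ħ g (.f j) * comulGen ħ g (.e i) =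
      qpow ħ (-g (.h i)) ⊗ₜ (g (.e i) * g (.f j) - g (.f j) * g (.e i)) +
        (g (.e i) * g (.f j) - g (.f j) * g (.e i)) ⊗ₜ qpow ħ (g (.h j)) := by
  simp only [comulGen, add_mul, mul_add, Algebra.TensorProduct.tmul_mul_tmul, one_mul, mul_one,
    hg.km_f hħ, hg.kp_e hħ, cartan_symm j i, tmul_sub, sub_tmul, smul_tmul', tmul_smul]
  abel

theorem _root_.QSl3.Serre.tmul_one {p r : R} {X Y : A} (h : Serre p r X Y) :
    Serre p r (X ⊗ₜ[R] (1 : A)) (Y ⊗ₜ[R] (1 : A)) := by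
  simp only [Serre, Algebra.TensorProduct.tmul_mul_tmul, one_mul, smul_tmul', ← add_tmul] at h ⊢
  rw [h]

theorem _root_.QSl3.Serre.one_tmul {p r : R} {X Y : A} (h : Serre p r X Y) :
    Serre p r ((1 : A) ⊗ₜ[R] X) ((1 : A) ⊗ₜ[R] Y) := by
  simp only [Serre, Algebra.TensorProduct.tmul_mul_tmul, one_mul, ← tmul_smul, ← tmul_add] at h ⊢
  rw [h]

theorem _root_.QSl3.Serre.tmul_comm {p r : R} {X Y K L : A} (h : Serre p r X Y)
    (hKL : Commute K L) : Serre p r (K ⊗ₜ[R] X) (L ⊗ₜ[R] Y) := by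
  have h1 : L * K * K = K * K * L := by rw [← hKL.eq, mul_assoc, ← hKL.eq, ← mul_assoc]
  have h2 : K * L * K = K * K * L := by rw [mul_assoc, ← hKL.eq, ← mul_assoc]
  simp only [Serre, Algebra.TensorProduct.tmul_mul_tmul, h1, h2, ← tmul_smul, ← tmul_add] at h ⊢
  rw [h]

theorem _root_.QSl3.Serre.comm_tmul {p r : R} {X Y K L : A} (h : Serre p r X Y)
    (hKL : Commute K L) : Serre p r (X ⊗ₜ[R] K) (Y ⊗ₜ[R] L) := by
  have h1 : L * K * K = K * K * L := by rw [← hKL.eq, mul_assoc, ← hKL.eq, ← mul_assoc]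
  have h2 : K * L * K = K * K * L := by rw [mul_assoc, ← hKL.eq, ← mul_assoc]
  simp only [Serre, Algebra.TensorProduct.tmul_mul_tmul, h1, h2, smul_tmul', ← add_tmul] at h ⊢
  rw [h]

theorem comul_relations (hg : QRelations ħ g) (hħ : IsNilpotent ħ) :
    QRelations ħ (comulGen ħ g) := by
  have hpr := qpow_one_mul hħ (R := R)
  have hrr : qpow ħ (-1 : R) * qpow ħ (-1 : R) = qpow ħ (-2 : R) := by
    rw [← qpow_add hħ (Commute.all _ _)]; norm_num
  refine QRelations.mk hħ ?_ ?_ ?_ ?_ ?_ ?_ ?_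
  · have h01 := hg.h_comm 0 1
    simp only [comulGen]
    refine Commute.add_left (Commute.add_right ?_ ?_) (Commute.add_right ?_ ?_) <;>
    simp [Commute, SemiconjBy, h01.eq]
  · intro i j
    have hk : g (.h i) * qpow ħ (-g (.h j)) = qpow ħ (-g (.h j)) * g (.h i) :=
      Commute.qpow (hg.h_comm i j).neg_right
    simp only [comulGen, add_mul, mul_add, Algebra.TensorProduct.tmul_mul_tmul, one_mul, mul_one,
      hk, hg.h_e, tmul_add, add_tmul, smul_add, smul_tmul', tmul_smul]
    abel
  · intro i j
    have hk : g (.h i) * qpow ħ (g (.h j)) = qpow ħ (g (.h j)) * g (.h i) :=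
      Commute.qpow (hg.h_comm i j)
    simp only [comulGen, add_mul, mul_add, Algebra.TensorProduct.tmul_mul_tmul, one_mul, mul_one,
      hk, hg.h_f, tmul_add, add_tmul, smul_add, smul_tmul', tmul_smul]
    abel
  · intro i j hij
    rw [← sub_eq_zero, hg.bracket_e_f hħ, sub_eq_zero.2 (hg _ _ (.e_f_ne i j hij))]
    simp
  · intro i
    have hc : Commute (g (.h i) ⊗ₜ[R] (1 : A)) ((1 : A) ⊗ₜ[R] g (.h i)) := by
      simp [Commute, SemiconjBy]
    have hn : -(g (.h i) ⊗ₜ[R] (1 : A)) = (-g (.h i)) ⊗ₜ[R] (1 : A) := by rw [neg_tmul]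
    rw [hg.bracket_e_f hħ, comulGen, qnum_add hħ hc, hn, qpow_tmul_one hħ, qpow_one_tmul hħ,
      qnum_tmul_one hħ, qnum_one_tmul hħ, ← hg _ _ (.e_f i), smul_add, ← tmul_smul, smul_tmul']
    simp only [Algebra.TensorProduct.tmul_mul_tmul, one_mul, mul_one]
    rw [add_comm]
  · intro i j hij
    have c1 : cartan i j = -1 := if_neg hij
    have c2 : cartan j i = -1 := if_neg hij.symm
    have c3 : cartan i i = 2 := if_pos rfl
    have hs := hg.serre_e hħ i j hij
    simp only [comulGen]
    rw [add_comm, add_comm (_ ⊗ₜ[R] g (.e j))]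
    refine Serre.add hpr ?_ ?_ ?_ ?_ ?_
    · exact hs.tmul_one
    · exact hs.tmul_comm (Commute.qpow (Commute.qpow (hg.h_comm i j).neg_left.neg_right.symm).symm)
    · simp [hg.km_e hħ, c3, hrr, smul_tmul']
    · simp [hg.km_e hħ, c1, smul_tmul']
    · simp [hg.km_e hħ, c2, smul_tmul']
  · intro i j hij
    have c1 : cartan i j = -1 := if_neg hij
    have c2 : cartan j i = -1 := if_neg hij.symm
    have c3 : cartan i i = 2 := if_pos rfl
    have hs := hg.serre_f hħ i j hij
    simp only [comulGen]
    rw [add_comm, add_comm (g (.f j) ⊗ₜ[R] _)]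
    refine Serre.add hpr ?_ ?_ ?_ ?_ ?_
    · exact hs.one_tmul
    · exact hs.comm_tmul (Commute.qpow (Commute.qpow (hg.h_comm i j).symm).symm)
    · simp [hg.kp_f hħ, c3, hrr]
    · simp [hg.kp_f hħ, c1]
    · simp [hg.kp_f hħ, c2]

end QRelations

end RelationLemmas

/-- `U_q(sl_3)` over a commutative `ℚ`-algebra `R`, for `q = exp ħ` with `ħ ∈ R` nilpotent. -/
def Uq {R : Type} [CommRing R] [Algebra ℚ R] (ħ : R) : Type :=
  RingQuot (QRel ħ (FreeAlgebra.ι R : Gen → FreeAlgebra R Gen))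

namespace Uq

variable {R : Type} [CommRing R] [Algebra ℚ R] (ħ : R)

noncomputable instance : Ring (Uq ħ) := inferInstanceAs (Ring (RingQuot _))
noncomputable instance : Algebra R (Uq ħ) := inferInstanceAs (Algebra R (RingQuot _))
noncomputable instance : Algebra ℚ (Uq ħ) := inferInstanceAs (Algebra ℚ (RingQuot _))

/-- The quotient map from the free algebra. -/
noncomputable def mk : FreeAlgebra R Gen →ₐ[R] Uq ħ := RingQuot.mkAlgHom R _

/-- The generators of `U_q(sl_3)`. -/
noncomputable def gen (i : Gen) : Uq ħ := mk ħ (FreeAlgebra.ι R i)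

theorem mk_surjective : Function.Surjective (mk ħ) := RingQuot.mkAlgHom_surjective R _

theorem gen_relations [hħ : Fact (IsNilpotent ħ)] : QRelations ħ (gen ħ) := by
  intro x y h
  obtain ⟨x', y', h', rfl, rfl⟩ := QRel.exists_of_map (mk ħ) hħ.out h
  exact RingQuot.mkAlgHom_rel R h'

variable {ħ}

/-- Ring homomorphisms out of `U_q(sl_3)`, semilinear along `φ : R → R'`, are given by families
that satisfy the relations. -/
noncomputable def lift {R' A' : Type} [CommRing R'] [Algebra ℚ R'] [Ring A'] [Algebra R' A']
    [Algebra ℚ A'] [hħ : Fact (IsNilpotent ħ)] (φ : R →+* R') (g : Gen → A')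
    (hg : QRelations (φ ħ) g) : Uq ħ →+* A' :=
  letI : Algebra R A' := Algebra.compHom A' φ
  (RingQuot.lift ⟨(FreeAlgebra.lift R g).toRingHom, fun x y h => hg _ _ (by
    simpa using h.map φ (FreeAlgebra.lift R g).toRingHom
      (fun r a => by simp; rfl) hħ.out)⟩ : RingQuot _ →+* A')


@[simp] theorem lift_gen {R' A' : Type} [CommRing R'] [Algebra ℚ R'] [Ring A'] [Algebra R' A']
    [Algebra ℚ A'] [hħ : Fact (IsNilpotent ħ)] (φ : R →+* R') (g : Gen → A')
    (hg : QRelations (φ ħ) g) (i : Gen) : lift φ g hg (gen ħ i) = g i := by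
  let _ : Algebra R A' := Algebra.compHom A' φ
  have : mk ħ (FreeAlgebra.ι R i) = RingQuot.mkRingHom _ (FreeAlgebra.ι R i) :=
    congrFun (congrArg DFunLike.coe (RingQuot.mkAlgHom_coe R _)) _
  unfold lift gen
  rw [this]
  erw [RingQuot.lift_mkRingHom_apply]
  simp

@[simp] theorem lift_algebraMap {R' A' : Type} [CommRing R'] [Algebra ℚ R'] [Ring A'] [Algebra R' A']
    [Algebra ℚ A'] [hħ : Fact (IsNilpotent ħ)] (φ : R →+* R') (g : Gen → A')
    (hg : QRelations (φ ħ) g) (r : R) :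
    lift φ g hg (algebraMap R _ r) = algebraMap R' A' (φ r) := by
  let _ : Algebra R A' := Algebra.compHom A' φ
  have : algebraMap R (Uq ħ) r = RingQuot.mkRingHom _ (algebraMap R (FreeAlgebra R Gen) r) := by
    rw [← (mk ħ).commutes]
    exact congrFun (congrArg DFunLike.coe (RingQuot.mkAlgHom_coe R _)) _
  unfold lift
  rw [this]
  erw [RingQuot.lift_mkRingHom_apply]
  simp
  rfl

theorem lift_smul {R' A' : Type} [CommRing R'] [Algebra ℚ R'] [Ring A'] [Algebra R' A']
    [Algebra ℚ A'] [hħ : Fact (IsNilpotent ħ)] (φ : R →+* R') (g : Gen → A')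
    (hg : QRelations (φ ħ) g) (r : R) (x : Uq ħ) :
    lift φ g hg (r • x) = φ r • lift φ g hg x := by
  rw [Algebra.smul_def, map_mul, lift_algebraMap, Algebra.smul_def]

theorem ringHom_ext {B : Type} [Semiring B] {f g : Uq ħ →+* B}
    (h₁ : ∀ r, f (algebraMap R _ r) = g (algebraMap R _ r)) (h₂ : ∀ i, f (gen ħ i) = g (gen ħ i)) :
    f = g := by
  ext x
  obtain ⟨x, rfl⟩ := mk_surjective ħ x
  induction x using FreeAlgebra.induction with
  | grade0 r => simpa using h₁ r
  | grade1 i => exact h₂ i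
  | mul a b ha hb => rw [map_mul, map_mul, map_mul, ha, hb]
  | add a b ha hb => rw [map_add, map_add, map_add, ha, hb]


section Bialgebra

variable [hħ : Fact (IsNilpotent ħ)]

/-- `R`-algebra homomorphisms out of `U_q(sl_3)`. -/
noncomputable def liftAlg {A' : Type} [Ring A'] [Algebra R A'] [Algebra ℚ A'] (g : Gen → A')
    (hg : QRelations ħ g) : Uq ħ →ₐ[R] A' :=
  { lift (RingHom.id R) g hg with commutes' := fun r => lift_algebraMap (RingHom.id R) g hg r }

@[simp] theorem liftAlg_gen {A' : Type} [Ring A'] [Algebra R A'] [Algebra ℚ A'] (g : Gen → A')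
    (hg : QRelations ħ g) (i : Gen) : liftAlg g hg (gen ħ i) = g i :=
  lift_gen (RingHom.id R) g hg i

theorem algHom_ext {B : Type} [Semiring B] [Algebra R B] {f g : Uq ħ →ₐ[R] B}
    (h : ∀ i, f (gen ħ i) = g (gen ħ i)) : f = g := by
  have : f.toRingHom = g.toRingHom := ringHom_ext (fun r => by simp) h
  ext x
  exact congrFun (congrArg DFunLike.coe this) x

theorem counit_relations : QRelations ħ (fun _ : Gen => (0 : R)) := by
  refine QRelations.mk hħ.out ?_ ?_ ?_ ?_ ?_ ?_ ?_ <;> simp [qnum, Serre, Commute, SemiconjBy]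

variable (ħ) in
/-- The coproduct: `Δ(e_{i,i+1}) = q^{-h} ⊗ e + e ⊗ 1`, `Δ(e_{i+1,i}) = f ⊗ q^h + 1 ⊗ f`,
`Δ(h) = h ⊗ 1 + 1 ⊗ h`. -/
noncomputable def comulHom : Uq ħ →ₐ[R] Uq ħ ⊗[R] Uq ħ :=
  liftAlg (QRelations.comulGen ħ (gen ħ)) ((gen_relations ħ).comul_relations hħ.out)

variable (ħ) in
/-- The counit, which vanishes on all generators. -/
noncomputable def counitHom : Uq ħ →ₐ[R] R := liftAlg (fun _ => 0) counit_relations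

theorem algHom_qpow {A B : Type} [Ring A] [Algebra R A] [Algebra ℚ A] [Ring B] [Algebra R B]
    [Algebra ℚ B] (f : A →ₐ[R] B) (a : A) : f (qpow ħ a) = qpow ħ (f a) :=
  map_qpow (RingHom.id R) f.toRingHom (fun r a => by simp) hħ.out a

theorem comulHom_qpow (i : Fin 2) (hsgn : Uq ħ) (hs : hsgn = gen ħ (.h i) ∨ hsgn = -gen ħ (.h i)) :
    comulHom ħ (qpow ħ hsgn) = qpow ħ hsgn ⊗ₜ[R] qpow ħ hsgn := by
  have h1 : comulHom ħ hsgn = hsgn ⊗ₜ[R] 1 + 1 ⊗ₜ[R] hsgn := by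
    rcases hs with rfl | rfl
    · simp [comulHom, QRelations.comulGen]
    · simp [comulHom, QRelations.comulGen, neg_tmul, tmul_neg]
      abel
  rw [algHom_qpow, h1, qpow_add hħ.out (by simp [Commute, SemiconjBy]),
    QRelations.qpow_tmul_one hħ.out, QRelations.qpow_one_tmul hħ.out]
  simp

noncomputable instance : Bialgebra R (Uq ħ) :=
  Bialgebra.ofAlgHom (comulHom ħ) (counitHom ħ)
    (by
      have hkp := fun i => comulHom_qpow (ħ := ħ) i _ (Or.inl rfl)
      have hkm := fun i => comulHom_qpow (ħ := ħ) i _ (Or.inr rfl)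
      have hgen : ∀ i, comulHom ħ (gen ħ i) = QRelations.comulGen ħ (gen ħ) i :=
        fun i => liftAlg_gen _ _ i
      apply algHom_ext
      intro i
      cases i <;>
      simp [hgen, QRelations.comulGen, hkp, hkm, tmul_add, add_tmul,
        Algebra.TensorProduct.one_def, add_assoc])
    (by
      have hq : ∀ a, counitHom ħ (qpow ħ a) = qpow ħ (counitHom ħ a) := algHom_qpow _
      have hgen : ∀ i, comulHom ħ (gen ħ i) = QRelations.comulGen ħ (gen ħ) i :=
        fun i => liftAlg_gen _ _ i
      have hc : ∀ i, counitHom ħ (gen ħ i) = 0 := fun i => liftAlg_gen _ _ i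
      apply algHom_ext
      intro i
      cases i <;> simp [hgen, QRelations.comulGen, hq, hc, qpow_zero])
    (by
      have hq : ∀ a, counitHom ħ (qpow ħ a) = qpow ħ (counitHom ħ a) := algHom_qpow _
      have hgen : ∀ i, comulHom ħ (gen ħ i) = QRelations.comulGen ħ (gen ħ) i :=
        fun i => liftAlg_gen _ _ i
      have hc : ∀ i, counitHom ħ (gen ħ i) = 0 := fun i => liftAlg_gen _ _ i
      apply algHom_ext
      intro i
      cases i <;> simp [hgen, QRelations.comulGen, hq, hc, qpow_zero])

end Bialgebra

end Uq

section Enveloping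

attribute [local instance 100] LieRing.ofAssociativeRing

section

variable (R L : Type) [CommRing R] [LieRing L] [LieAlgebra R L]

/-- The coproduct of a universal enveloping algebra, `x ↦ x ⊗ 1 + 1 ⊗ x` for `x ∈ L`. -/
noncomputable def primComul : UniversalEnvelopingAlgebra R L →ₐ[R]
    UniversalEnvelopingAlgebra R L ⊗[R] UniversalEnvelopingAlgebra R L :=
  UniversalEnvelopingAlgebra.lift R
    { toFun := fun x => UniversalEnvelopingAlgebra.ι R x ⊗ₜ 1 +
        1 ⊗ₜ UniversalEnvelopingAlgebra.ι R x
      map_add' := fun x y => by simp only [map_add, add_tmul, tmul_add]; abel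
      map_smul' := fun r x => by simp [smul_tmul']
      map_lie' := fun {x y} => by
        simp only [LieHom.map_lie, LieRing.of_associative_ring_bracket, mul_add, add_mul,
          Algebra.TensorProduct.tmul_mul_tmul, one_mul, mul_one, sub_tmul, tmul_sub]
        abel }

/-- The counit of a universal enveloping algebra, which vanishes on `L`. -/
noncomputable def primCounit : UniversalEnvelopingAlgebra R L →ₐ[R] R :=
  UniversalEnvelopingAlgebra.lift R 0

variable {R L} in
theorem envelopingHom_ext {B : Type} [Ring B] [Algebra R B]
    {f g : UniversalEnvelopingAlgebra R L →ₐ[R] B}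
    (h : ∀ x, f (UniversalEnvelopingAlgebra.ι R x) = g (UniversalEnvelopingAlgebra.ι R x)) :
    f = g :=
  UniversalEnvelopingAlgebra.hom_ext R (LieHom.ext h)

theorem primComul_ι (x : L) : primComul R L (UniversalEnvelopingAlgebra.ι R x) =
    UniversalEnvelopingAlgebra.ι R x ⊗ₜ 1 + 1 ⊗ₜ UniversalEnvelopingAlgebra.ι R x :=
  UniversalEnvelopingAlgebra.lift_ι_apply R _ x

theorem primCounit_ι (x : L) : primCounit R L (UniversalEnvelopingAlgebra.ι R x) = 0 :=
  UniversalEnvelopingAlgebra.lift_ι_apply R _ x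

/-- The standard bialgebra structure of a universal enveloping algebra. -/
noncomputable instance : Bialgebra R (UniversalEnvelopingAlgebra R L) :=
  Bialgebra.ofAlgHom (primComul R L) (primCounit R L)
    (by
      refine envelopingHom_ext fun x => ?_
      simp [primComul_ι, -UniversalEnvelopingAlgebra.ι_apply, tmul_add, add_tmul,
        Algebra.TensorProduct.one_def, add_assoc])
    (by
      refine envelopingHom_ext fun x => ?_
      simp [primComul_ι, primCounit_ι, -UniversalEnvelopingAlgebra.ι_apply])
    (by
      refine envelopingHom_ext fun x => ?_
      simp [primComul_ι, primCounit_ι, -UniversalEnvelopingAlgebra.ι_apply])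

end

/-- The Lie algebra `sl_3(ℂ)`. -/
abbrev sl3 := LieAlgebra.SpecialLinear.sl (Fin 3) ℂ

/-- The universal enveloping algebra `U(sl_3(ℂ))`. -/
abbrev Usl3 := UniversalEnvelopingAlgebra ℂ sl3

/-- The elements `E_12, E_23` (`e`), `E_21, E_32` (`f`) and `E_11 - E_22, E_22 - E_33` (`h`)
of `sl_3(ℂ)`. -/
noncomputable def slGen : Gen → sl3
  | .e 0 => LieAlgebra.SpecialLinear.single 0 1 (by decide) 1
  | .e 1 => LieAlgebra.SpecialLinear.single 1 2 (by decide) 1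
  | .f 0 => LieAlgebra.SpecialLinear.single 1 0 (by decide) 1
  | .f 1 => LieAlgebra.SpecialLinear.single 2 1 (by decide) 1
  | .h 0 => LieAlgebra.SpecialLinear.singleSubSingle 0 1 1
  | .h 1 => LieAlgebra.SpecialLinear.singleSubSingle 1 2 1

/-- The element `H_12^⊥ = (E_11 + E_22) / 3 - (2 / 3) E_33` of `sl_3(ℂ)`. -/
noncomputable def slHperp : sl3 :=
  ⟨Matrix.diagonal ![1 / 3, 1 / 3, -2 / 3], by
    simp [LieAlgebra.SpecialLinear.sl, Matrix.trace_diagonal, Fin.sum_univ_three]; norm_num⟩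

end Enveloping

section Levels

/-- `K⟦t⟧ / (t ^ n)`. -/
def LevelRing (K : Type) [CommRing K] (n : ℕ) : Type :=
  K⟦X⟧ ⧸ Ideal.span {(X : K⟦X⟧) ^ n}

noncomputable instance (K : Type) [CommRing K] (n : ℕ) : CommRing (LevelRing K n) :=
  inferInstanceAs (CommRing (K⟦X⟧ ⧸ Ideal.span {(X : K⟦X⟧) ^ n}))

noncomputable instance (S K : Type) [CommSemiring S] [CommRing K] [Algebra S K] (n : ℕ) :
    Algebra S (LevelRing K n) :=
  inferInstanceAs (Algebra S (K⟦X⟧ ⧸ Ideal.span {(X : K⟦X⟧) ^ n}))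

/-- The class of a power series in `K⟦t⟧ / (t ^ n)`. -/
noncomputable def toLevel {K : Type} [CommRing K] (n : ℕ) : K⟦X⟧ →+* LevelRing K n :=
  Ideal.Quotient.mk (Ideal.span {(X : K⟦X⟧) ^ n})

theorem toLevel_surjective {K : Type} [CommRing K] (n : ℕ) :
    Function.Surjective (toLevel (K := K) n) := Ideal.Quotient.mk_surjective

theorem toLevel_eq_zero {K : Type} [CommRing K] {n : ℕ} {x : K⟦X⟧} (h : X ^ n ∣ x) :
    toLevel n x = 0 :=
  Ideal.Quotient.eq_zero_iff_mem.2 (Ideal.mem_span_singleton.2 h)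

/-- The projection `K⟦t⟧ / (t ^ (n + 1)) → K⟦t⟧ / (t ^ n)`. -/
noncomputable def levelTrans (K : Type) [CommRing K] (n : ℕ) : LevelRing K (n + 1) →+* LevelRing K n :=
  Ideal.Quotient.factor (Ideal.span_singleton_le_span_singleton.2 (pow_dvd_pow X n.le_succ))

@[simp] theorem levelTrans_toLevel {K : Type} [CommRing K] (n : ℕ) (x : K⟦X⟧) :
    levelTrans K n (toLevel (n + 1) x) = toLevel n x := rfl

/-- The map `K⟦t⟧ / (t ^ n) → K'⟦t⟧ / (t ^ n)` induced by a map of coefficients. -/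
noncomputable def levelMap {K K' : Type} [CommRing K] [CommRing K'] (f : K →+* K') (n : ℕ) :
    LevelRing K n →+* LevelRing K' n :=
  Ideal.Quotient.lift _ ((toLevel n).comp (PowerSeries.map f)) fun a ha => by
    obtain ⟨b, rfl⟩ := Ideal.mem_span_singleton.1 ha
    rw [RingHom.comp_apply, map_mul, map_pow, PowerSeries.map_X]
    exact toLevel_eq_zero (dvd_mul_right _ _)

@[simp] theorem levelMap_toLevel {K K' : Type} [CommRing K] [CommRing K'] (f : K →+* K') (n : ℕ)
    (x : K⟦X⟧) : levelMap f n (toLevel n x) = toLevel n (PowerSeries.map f x) := rfl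

theorem toLevel_isNilpotent {K : Type} [CommRing K] {c : K⟦X⟧} (hc : constantCoeff c = 0) (n : ℕ) :
    IsNilpotent (toLevel n c) := by
  refine ⟨n, ?_⟩
  rw [← map_pow]
  exact toLevel_eq_zero (pow_dvd_pow_of_dvd (X_dvd_iff.2 hc) n)

theorem levelMap_comp_trans {K K' : Type} [CommRing K] [CommRing K'] (f : K →+* K') (n : ℕ)
    (x : LevelRing K (n + 1)) :
    levelTrans K' n (levelMap f (n + 1) x) = levelMap f n (levelTrans K n x) := by
  obtain ⟨x, rfl⟩ := toLevel_surjective _ x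
  rfl

/-- The inverse limit of a sequence of rings. -/
def invLim {A : ℕ → Type} [∀ n, Ring (A n)] (π : ∀ n, A (n + 1) →+* A n) : Subring (∀ n, A n) where
  carrier := {x | ∀ n, π n (x (n + 1)) = x n}
  mul_mem' hx hy n := by simp [hx n, hy n]
  one_mem' n := by simp
  add_mem' hx hy n := by simp [hx n, hy n]
  zero_mem' n := by simp
  neg_mem' hx n := by simp [hx n]

/-- The map of inverse limits induced by a compatible sequence of ring homomorphisms. -/
def invLim.map {A B : ℕ → Type} [∀ n, Ring (A n)] [∀ n, Ring (B n)] {π : ∀ n, A (n + 1) →+* A n}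
    {π' : ∀ n, B (n + 1) →+* B n} (f : ∀ n, A n →+* B n)
    (h : ∀ n x, π' n (f (n + 1) x) = f n (π n x)) : invLim π →+* invLim π' where
  toFun x := ⟨fun n => f n (x.1 n), fun n => by rw [h, x.2 n]⟩
  map_one' := Subtype.ext (funext fun n => map_one (f n))
  map_mul' x y := Subtype.ext (funext fun n => map_mul (f n) _ _)
  map_zero' := Subtype.ext (funext fun n => map_zero (f n))
  map_add' x y := Subtype.ext (funext fun n => map_add (f n) _ _)

end Levels

section SemilinearTensor

variable {R R' A B A' B' : Type} [CommRing R] [CommRing R'] [Ring A] [Ring B] [Ring A'] [Ring B']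
  [Algebra R A] [Algebra R B] [Algebra R' A'] [Algebra R' B']

/-- The tensor product `a ⊗ b ↦ f a ⊗ g b` of two ring homomorphisms that are semilinear along
`φ : R → R'`. -/
noncomputable def tensorMap (φ : R →+* R') (f : A →+* A') (g : B →+* B')
    (hf : ∀ r, f (algebraMap R A r) = algebraMap R' A' (φ r))
    (hg : ∀ r, g (algebraMap R B r) = algebraMap R' B' (φ r)) : A ⊗[R] B →+* A' ⊗[R'] B' :=
  letI : Algebra R (A' ⊗[R'] B') := Algebra.compHom _ φ
  (Algebra.TensorProduct.lift (R := R) (S := R) (C := A' ⊗[R'] B')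
    { (Algebra.TensorProduct.includeLeft : A' →ₐ[R'] A' ⊗[R'] B').toRingHom.comp f with
      commutes' := fun r => by
        change (Algebra.TensorProduct.includeLeft : A' →ₐ[R'] A' ⊗[R'] B')
          (f (algebraMap R A r)) = algebraMap R' (A' ⊗[R'] B') (φ r)
        rw [hf]; exact AlgHom.commutes _ _ }
    { (Algebra.TensorProduct.includeRight : B' →ₐ[R'] A' ⊗[R'] B').toRingHom.comp g with
      commutes' := fun r => by
        change (Algebra.TensorProduct.includeRight : B' →ₐ[R'] A' ⊗[R'] B')
          (g (algebraMap R B r)) = algebraMap R' (A' ⊗[R'] B') (φ r)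
        rw [hg]; exact AlgHom.commutes _ _ }
    (fun a b => by
      change Commute (f a ⊗ₜ[R'] (1 : B')) ((1 : A') ⊗ₜ[R'] g b)
      simp [Commute, SemiconjBy])).toRingHom

@[simp] theorem tensorMap_tmul (φ : R →+* R') (f : A →+* A') (g : B →+* B')
    (hf : ∀ r, f (algebraMap R A r) = algebraMap R' A' (φ r))
    (hg : ∀ r, g (algebraMap R B r) = algebraMap R' B' (φ r)) (a : A) (b : B) :
    tensorMap φ f g hf hg (a ⊗ₜ b) = f a ⊗ₜ g b := by
  let _ : Algebra R (A' ⊗[R'] B') := Algebra.compHom _ φ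
  unfold tensorMap
  erw [Algebra.TensorProduct.lift_tmul]
  change f a ⊗ₜ[R'] (1 : B') * (1 : A') ⊗ₜ[R'] g b = _
  simp

theorem tensorMap_algebraMap (φ : R →+* R') (f : A →+* A') (g : B →+* B')
    (hf : ∀ r, f (algebraMap R A r) = algebraMap R' A' (φ r))
    (hg : ∀ r, g (algebraMap R B r) = algebraMap R' B' (φ r)) (r : R) :
    tensorMap φ f g hf hg (algebraMap R _ r) = algebraMap R' _ (φ r) := by
  rw [Algebra.TensorProduct.algebraMap_apply, tensorMap_tmul, hf, map_one,
    Algebra.TensorProduct.algebraMap_apply]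

theorem tensorMap_smul (φ : R →+* R') (f : A →+* A') (g : B →+* B')
    (hf : ∀ r, f (algebraMap R A r) = algebraMap R' A' (φ r))
    (hg : ∀ r, g (algebraMap R B r) = algebraMap R' B' (φ r)) (r : R) (x : A ⊗[R] B) :
    tensorMap φ f g hf hg (r • x) = φ r • tensorMap φ f g hf hg x := by
  rw [Algebra.smul_def, map_mul, tensorMap_algebraMap, Algebra.smul_def]

end SemilinearTensor

section Completed

/-- A formal parameter `q ∈ K⟦t⟧` with `q ≡ 1 mod t`. -/
structure FormalParameter (K : Type) [CommRing K] where
  /-- the power series -/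
  q : K⟦X⟧
  constantCoeff_q : constantCoeff q = 1

namespace FormalParameter

variable {K K' : Type} [CommRing K] [Algebra ℚ K] [CommRing K'] [Algebra ℚ K']

/-- `ħ = log q`, a power series in `t` without constant term. -/
noncomputable def hbar (p : FormalParameter K) : K⟦X⟧ := logOf p.q

theorem constantCoeff_hbar (p : FormalParameter K) : constantCoeff p.hbar = 0 :=
  constantCoeff_logOf p.constantCoeff_q

/-- The class of `ħ = log q` in `K⟦t⟧ / (t ^ n)`. -/
noncomputable def level (p : FormalParameter K) (n : ℕ) : LevelRing K n := toLevel n p.hbar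

instance (p : FormalParameter K) (n : ℕ) : Fact (IsNilpotent (p.level n)) :=
  ⟨toLevel_isNilpotent p.constantCoeff_hbar n⟩

/-- Change of the coefficient ring. -/
noncomputable def map (p : FormalParameter K) (f : K →+* K') : FormalParameter K' where
  q := PowerSeries.map f p.q
  constantCoeff_q := by
    rw [← coeff_zero_eq_constantCoeff_apply, coeff_map, coeff_zero_eq_constantCoeff_apply,
      p.constantCoeff_q, map_one]

theorem map_logOf (f : K →+* K') {x : K⟦X⟧} (hx : constantCoeff x = 1) :
    PowerSeries.map f (logOf x) = logOf (PowerSeries.map f x) := by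
  have h : HasSubst (x - 1) := HasSubst.of_constantCoeff_zero' (by simp [hx])
  rw [logOf_eq, logOf_eq, ← map_log f, ← map_one (PowerSeries.map f), ← map_sub]
  exact PowerSeries.map_subst h _

theorem levelTrans_level (p : FormalParameter K) (n : ℕ) :
    levelTrans K n (p.level (n + 1)) = p.level n := rfl

theorem levelMap_level (p : FormalParameter K) (f : K →+* K') (n : ℕ) :
    levelMap f n (p.level n) = (p.map f).level n := by
  rw [level, levelMap_toLevel, hbar, map_logOf f p.constantCoeff_q]
  rfl

theorem levelMap_level_eq_zero (p : FormalParameter K) (f : K →+* K')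
    (hf : PowerSeries.map f p.q = 1) (n : ℕ) : levelMap f n (p.level n) = 0 := by
  rw [level, levelMap_toLevel, hbar, map_logOf f p.constantCoeff_q, hf, logOf_eq, sub_self,
    subst_zero_of_constantCoeff_zero constantCoeff_log, map_zero]

end FormalParameter

/-- The map `U_q(sl_3) → U_{q'}(sl_3)`, generators to generators, along `φ : R → R'` with
`φ ħ = ħ'`. -/
noncomputable def Uq.map {R R' : Type} [CommRing R] [Algebra ℚ R] [CommRing R'] [Algebra ℚ R']
    {ħ : R} {ħ' : R'} [Fact (IsNilpotent ħ)] [Fact (IsNilpotent ħ')] (φ : R →+* R')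
    (h : φ ħ = ħ') : Uq ħ →+* Uq ħ' :=
  Uq.lift φ (Uq.gen ħ') (h ▸ Uq.gen_relations ħ')

section MapLemmas

variable {R R' : Type} [CommRing R] [Algebra ℚ R] [CommRing R'] [Algebra ℚ R']
    {ħ : R} {ħ' : R'} [Fact (IsNilpotent ħ)] [Fact (IsNilpotent ħ')] (φ : R →+* R')
    (h : φ ħ = ħ')

@[simp] theorem Uq.map_gen (i : Gen) : Uq.map φ h (Uq.gen ħ i) = Uq.gen ħ' i :=
  Uq.lift_gen _ _ _ i

@[simp] theorem Uq.map_algebraMap (r : R) :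
    Uq.map φ h (algebraMap R _ r) = algebraMap R' _ (φ r) :=
  Uq.lift_algebraMap _ _ _ r

theorem Uq.map_smul (r : R) (x : Uq ħ) : Uq.map φ h (r • x) = φ r • Uq.map φ h x :=
  Uq.lift_smul _ _ _ r x

/-- The map `x ⊗ y ↦ map x ⊗ map y`. -/
noncomputable def Uq.map₂ : Uq ħ ⊗[R] Uq ħ →+* Uq ħ' ⊗[R'] Uq ħ' :=
  tensorMap φ (Uq.map φ h) (Uq.map φ h) (Uq.map_algebraMap φ h) (Uq.map_algebraMap φ h)

theorem Uq.map₂_smul (r : R) (x : Uq ħ ⊗[R] Uq ħ) :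
    Uq.map₂ φ h (r • x) = φ r • Uq.map₂ φ h x :=
  tensorMap_smul _ _ _ _ _ r x

theorem Uq.map₂_comul (x : Uq ħ) :
    Uq.map₂ φ h (Uq.comulHom ħ x) = Uq.comulHom ħ' (Uq.map φ h x) := by
  have hq : ∀ a, Uq.map φ h (qpow ħ a) = qpow ħ' (Uq.map φ h a) := fun a => by
    rw [map_qpow φ (Uq.map φ h) (Uq.map_smul φ h) Fact.out, h]
  have key : (Uq.map₂ φ h).comp (Uq.comulHom ħ).toRingHom =
      (Uq.comulHom ħ').toRingHom.comp (Uq.map φ h) := by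
    refine Uq.ringHom_ext (fun r => ?_) (fun i => ?_)
    · simp [Uq.map₂]
    · cases i <;> simp [Uq.comulHom, Uq.map₂, QRelations.comulGen, hq]
  exact congrFun (congrArg DFunLike.coe key) x

end MapLemmas

/-- The sum `∑ c ^ k / k! x ^ k` in the inverse limit of algebras over `K⟦t⟧ / (t ^ n)`, where
`c ∈ t K⟦t⟧`. -/
noncomputable def invLim.exp {K : Type} [CommRing K] {A : ℕ → Type}
    [∀ n, Ring (A n)] [∀ n, Algebra (LevelRing K n) (A n)] [∀ n, Algebra ℚ (A n)]
    {π : ∀ n, A (n + 1) →+* A n} (hπ : ∀ n r x, π n (r • x) = levelTrans K n r • π n x)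
    (c : K⟦X⟧) (hc : constantCoeff c = 0) (x : invLim π) : invLim π :=
  ⟨fun n => IsNilpotent.exp (toLevel n c • x.1 n), fun n => by
    rw [IsNilpotent.map_exp (isNilpotent_smul (toLevel_isNilpotent hc _) _), hπ, x.2 n,
      levelTrans_toLevel]⟩

/-- The `q`-factorial `(k)_Q! = (1)_Q ⋯ (k)_Q` with `(j)_Q = (Q ^ j - 1) / (Q - 1)
= 1 + Q + ⋯ + Q ^ (j - 1)`. -/
def qFactorial {S : Type} [CommRing S] (Q : S) (k : ℕ) : S :=
  ∏ j ∈ Finset.range k, ∑ i ∈ Finset.range (j + 1), Q ^ i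

/-- The `q`-exponential `exp_Q (c x) = ∑ c ^ k / (k)_Q! x ^ k` in the inverse limit of algebras over
`K⟦t⟧ / (t ^ n)`, where `c ∈ t K⟦t⟧`. -/
noncomputable def invLim.qExp {K : Type} [CommRing K] {A : ℕ → Type}
    [∀ n, Ring (A n)] [∀ n, Algebra (LevelRing K n) (A n)]
    {π : ∀ n, A (n + 1) →+* A n} (hπ : ∀ n r x, π n (r • x) = levelTrans K n r • π n x)
    (Q c : K⟦X⟧) (hc : constantCoeff c = 0) (x : invLim π) : invLim π :=
  ⟨fun n => ∑ k ∈ Finset.range n, toLevel n (c ^ k * Ring.inverse (qFactorial Q k)) • x.1 n ^ k,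
    fun n => by
    have h0 : toLevel n (c ^ n * Ring.inverse (qFactorial Q n)) = 0 :=
      toLevel_eq_zero ((pow_dvd_pow_of_dvd (X_dvd_iff.2 hc) n).mul_right _)
    simp only [map_sum, hπ, map_pow, x.2 n, levelTrans_toLevel]
    rw [Finset.sum_range_succ, h0, Algebra.smul_def 0, map_zero, zero_mul, add_zero]⟩

section

variable {K : Type} [CommRing K] [Algebra ℚ K] (p : FormalParameter K)

/-- `U_q(sl_3) / (t ^ n)`. -/
abbrev ULevel (n : ℕ) : Type := Uq (p.level n)

/-- `(U_q(sl_3) ⊗ U_q(sl_3)) / (t ^ n)`. -/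
abbrev ULevel₂ (n : ℕ) : Type := ULevel p n ⊗[LevelRing K n] ULevel p n

/-- The projection `U_q(sl_3) / (t ^ (n + 1)) → U_q(sl_3) / (t ^ n)`. -/
noncomputable def ULevel.trans (n : ℕ) : ULevel p (n + 1) →+* ULevel p n :=
  Uq.map (levelTrans K n) (p.levelTrans_level n)

/-- The projection for the tensor squares. -/
noncomputable def ULevel₂.trans (n : ℕ) : ULevel₂ p (n + 1) →+* ULevel₂ p n :=
  Uq.map₂ (levelTrans K n) (p.levelTrans_level n)

theorem ULevel.trans_smul (n : ℕ) (r : LevelRing K (n + 1)) (x : ULevel p (n + 1)) :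
    ULevel.trans p n (r • x) = levelTrans K n r • ULevel.trans p n x :=
  Uq.map_smul _ _ r x

theorem ULevel₂.trans_smul (n : ℕ) (r : LevelRing K (n + 1)) (x : ULevel₂ p (n + 1)) :
    ULevel₂.trans p n (r • x) = levelTrans K n r • ULevel₂.trans p n x :=
  Uq.map₂_smul _ _ r x

@[simp] theorem ULevel.trans_gen (n : ℕ) (i : Gen) :
    ULevel.trans p n (Uq.gen (p.level (n + 1)) i) = Uq.gen (p.level n) i :=
  Uq.map_gen _ _ i

@[simp] theorem ULevel₂.trans_tmul (n : ℕ) (x y : ULevel p (n + 1)) :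
    ULevel₂.trans p n (x ⊗ₜ y) = ULevel.trans p n x ⊗ₜ ULevel.trans p n y :=
  tensorMap_tmul _ _ _ (Uq.map_algebraMap _ _) (Uq.map_algebraMap _ _) x y

theorem ULevel₂.trans_algebraMap (n : ℕ) (r : LevelRing K (n + 1)) :
    ULevel₂.trans p n (algebraMap _ _ r) = algebraMap _ _ (levelTrans K n r) :=
  tensorMap_algebraMap _ _ _ (Uq.map_algebraMap _ _) (Uq.map_algebraMap _ _) r

/-- The `t`-adically complete algebra `U_q(sl_3)` over `K⟦t⟧`. -/
noncomputable abbrev UHat := invLim (ULevel.trans p)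

/-- The `t`-adically completed tensor square of `U_q(sl_3)` over `K⟦t⟧`. -/
noncomputable abbrev UHat₂ := invLim (ULevel₂.trans p)

/-- The generators of the completed `U_q(sl_3)`. -/
noncomputable def UHat.gen (i : Gen) : UHat p :=
  ⟨fun n => Uq.gen (p.level n) i, fun n => ULevel.trans_gen p n i⟩

/-- The Cartan element `h_12^⊥ = (h_12 + 2 h_23) / 3`, that is `(e_11 + e_22) / 3 - (2 / 3) e_33`. -/
noncomputable def UHat.hperp : UHat p :=
  ⟨fun n => (1 / 3 : ℚ) • (Uq.gen (p.level n) (.h 0) + 2 • Uq.gen (p.level n) (.h 1)), fun n => by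
    rw [map_rat_smul, map_add, map_nsmul, ULevel.trans_gen, ULevel.trans_gen]⟩

/-- `x ⊗ y` in the completed tensor square. -/
noncomputable def UHat.tmul (x y : UHat p) : UHat₂ p :=
  ⟨fun n => x.1 n ⊗ₜ y.1 n, fun n => by
    rw [ULevel₂.trans_tmul, x.2 n, y.2 n]⟩

/-- The coproduct of the completed `U_q(sl_3)`. -/
noncomputable def UHat.comul : UHat p →+* UHat₂ p :=
  invLim.map (fun n => (Bialgebra.comulAlgHom (LevelRing K n) (ULevel p n)).toRingHom)
    fun n x => Uq.map₂_comul (levelTrans K n) (p.levelTrans_level n) x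

/-- The scalar `c ∈ K⟦t⟧` in the completed tensor square. -/
noncomputable def UHat₂.scalar (c : K⟦X⟧) : UHat₂ p :=
  ⟨fun n => algebraMap (LevelRing K n) (ULevel₂ p n) (toLevel n c), fun n => by
    rw [ULevel₂.trans_algebraMap, levelTrans_toLevel]⟩

end

section BaseChange

variable {K K' : Type} [CommRing K] [Algebra ℚ K] [CommRing K'] [Algebra ℚ K']
  (p : FormalParameter K) (f : K →+* K')

theorem tensor_ringHom_ext {R A B C : Type} [CommRing R] [Ring A] [Ring B] [Ring C] [Algebra R A]
    [Algebra R B] {f g : A ⊗[R] B →+* C} (h : ∀ a b, f (a ⊗ₜ b) = g (a ⊗ₜ b)) : f = g := by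
  refine RingHom.ext fun x => ?_
  induction x using TensorProduct.induction_on with
  | zero => simp
  | tmul a b => exact h a b
  | add x y hx hy => rw [map_add, map_add, hx, hy]

theorem ULevel.baseChange_trans (n : ℕ) (x : ULevel p (n + 1)) :
    ULevel.trans (p.map f) n (Uq.map (levelMap f (n + 1)) (p.levelMap_level f (n + 1)) x) =
      Uq.map (levelMap f n) (p.levelMap_level f n) (ULevel.trans p n x) := by
  have h : (ULevel.trans (p.map f) n).comp
        (Uq.map (levelMap f (n + 1)) (p.levelMap_level f (n + 1))) =
      (Uq.map (levelMap f n) (p.levelMap_level f n)).comp (ULevel.trans p n) := by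
    refine Uq.ringHom_ext (fun r => ?_) (fun i => by simp)
    simp only [ULevel.trans, RingHom.comp_apply, Uq.map_algebraMap, levelMap_comp_trans]
  exact congrFun (congrArg DFunLike.coe h) x

/-- The map from the completed tensor square of `U_q(sl_3)` over `K⟦t⟧` to that over `K'⟦t⟧`. -/
noncomputable def UHat₂.baseChange : UHat₂ p →+* UHat₂ (p.map f) :=
  invLim.map (fun n => Uq.map₂ (levelMap f n) (p.levelMap_level f n)) fun n x => by
    have h : (ULevel₂.trans (p.map f) n).comp
          (Uq.map₂ (levelMap f (n + 1)) (p.levelMap_level f (n + 1))) =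
        (Uq.map₂ (levelMap f n) (p.levelMap_level f n)).comp (ULevel₂.trans p n) := by
      refine tensor_ringHom_ext fun a b => ?_
      simp only [RingHom.comp_apply, Uq.map₂, tensorMap_tmul, ULevel₂.trans_tmul,
        ULevel.baseChange_trans]
    exact congrFun (congrArg DFunLike.coe h) x

end BaseChange

section Classical

attribute [local instance 100] LieRing.ofAssociativeRing

/-- `U(sl_3(ℂ))⟦t⟧ / (t ^ n) = ℂ⟦t⟧ / (t ^ n) ⊗ U(sl_3(ℂ))`. -/
def ClassicalLevel (n : ℕ) : Type := LevelRing ℂ n ⊗[ℂ] Usl3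

namespace ClassicalLevel

noncomputable instance (n : ℕ) : Ring (ClassicalLevel n) :=
  inferInstanceAs (Ring (LevelRing ℂ n ⊗[ℂ] Usl3))
noncomputable instance (n : ℕ) : Algebra ℚ (ClassicalLevel n) :=
  inferInstanceAs (Algebra ℚ (LevelRing ℂ n ⊗[ℂ] Usl3))

/-- The bialgebra structure obtained from that of `U(sl_3(ℂ))` by extension of scalars. -/
noncomputable instance (n : ℕ) : Bialgebra (LevelRing ℂ n) (ClassicalLevel n) :=
  inferInstanceAs (Bialgebra (LevelRing ℂ n) (LevelRing ℂ n ⊗[ℂ] Usl3))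

/-- The element of `U(sl_3(ℂ))⟦t⟧ / (t ^ n)` given by `x ∈ U(sl_3(ℂ))`. -/
noncomputable def of (n : ℕ) : Usl3 →+* ClassicalLevel n :=
  (Algebra.TensorProduct.includeRight : Usl3 →ₐ[ℂ] LevelRing ℂ n ⊗[ℂ] Usl3).toRingHom

/-- The projection `U(sl_3(ℂ))⟦t⟧ / (t ^ (n + 1)) → U(sl_3(ℂ))⟦t⟧ / (t ^ n)`. -/
noncomputable def trans (n : ℕ) : ClassicalLevel (n + 1) →+* ClassicalLevel n :=
  tensorMap (A := LevelRing ℂ (n + 1)) (A' := LevelRing ℂ n) (B := Usl3) (B' := Usl3)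
    (RingHom.id ℂ) (levelTrans ℂ n) (RingHom.id Usl3) (fun _ => rfl) (fun _ => rfl)

theorem trans_of (n : ℕ) (x : Usl3) : trans n (of (n + 1) x) = of n x :=
  (tensorMap_tmul (A := LevelRing ℂ (n + 1)) (A' := LevelRing ℂ n) (B := Usl3) (B' := Usl3)
    (RingHom.id ℂ) (levelTrans ℂ n) (RingHom.id Usl3) (fun _ => rfl) (fun _ => rfl) 1 x).trans
    (by rw [map_one]; rfl)

theorem trans_algebraMap (n : ℕ) (r : LevelRing ℂ (n + 1)) :
    trans n (algebraMap (LevelRing ℂ (n + 1)) (ClassicalLevel (n + 1)) r) =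
      algebraMap (LevelRing ℂ n) (ClassicalLevel n) (levelTrans ℂ n r) :=
  (tensorMap_tmul (A := LevelRing ℂ (n + 1)) (A' := LevelRing ℂ n) (B := Usl3) (B' := Usl3)
    (RingHom.id ℂ) (levelTrans ℂ n) (RingHom.id Usl3) (fun _ => rfl) (fun _ => rfl) r 1).trans
    (by rw [map_one]; rfl)

end ClassicalLevel

/-- `(U(sl_3(ℂ)) ⊗ U(sl_3(ℂ)))⟦t⟧ / (t ^ n)`. -/
abbrev ClassicalLevel₂ (n : ℕ) : Type := ClassicalLevel n ⊗[LevelRing ℂ n] ClassicalLevel n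

/-- The projection for the tensor squares. -/
noncomputable def ClassicalLevel₂.trans (n : ℕ) : ClassicalLevel₂ (n + 1) →+* ClassicalLevel₂ n :=
  tensorMap (levelTrans ℂ n) (ClassicalLevel.trans n) (ClassicalLevel.trans n)
    (ClassicalLevel.trans_algebraMap n) (ClassicalLevel.trans_algebraMap n)

theorem ClassicalLevel₂.trans_tmul (n : ℕ) (x y : ClassicalLevel (n + 1)) :
    ClassicalLevel₂.trans n (x ⊗ₜ y) = ClassicalLevel.trans n x ⊗ₜ ClassicalLevel.trans n y :=
  tensorMap_tmul _ _ _ (ClassicalLevel.trans_algebraMap n) (ClassicalLevel.trans_algebraMap n) x y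

theorem ClassicalLevel₂.trans_smul (n : ℕ) (r : LevelRing ℂ (n + 1)) (x : ClassicalLevel₂ (n + 1)) :
    ClassicalLevel₂.trans n (r • x) = levelTrans ℂ n r • ClassicalLevel₂.trans n x :=
  tensorMap_smul _ _ _ (ClassicalLevel.trans_algebraMap n) (ClassicalLevel.trans_algebraMap n) r x

/-- The completed tensor square `(U(sl_3(ℂ)) ⊗ U(sl_3(ℂ)))⟦t⟧`. -/
noncomputable abbrev ClassicalHat₂ := invLim ClassicalLevel₂.trans

/-- `x ⊗ y` in `(U(sl_3(ℂ)) ⊗ U(sl_3(ℂ)))⟦t⟧`, for `x, y ∈ U(sl_3(ℂ))`. -/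
noncomputable def ClassicalHat₂.tmul (x y : Usl3) : ClassicalHat₂ :=
  ⟨fun n => ClassicalLevel.of n x ⊗ₜ ClassicalLevel.of n y, fun n => by
    rw [ClassicalLevel₂.trans_tmul, ClassicalLevel.trans_of, ClassicalLevel.trans_of]⟩

theorem qnum_zero {R A : Type} [CommRing R] [Ring A] [Algebra R A] [Algebra ℚ A] (a : A) :
    qnum (0 : R) a = (2 : R) • a := by
  have h : ∀ b : A, expDiv (0 : R) b = b := fun b => by
    rw [expDiv_eq_sum (N := 1) (by simp)]; simp
  rw [qnum, h, h, sub_neg_eq_add, two_smul]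

theorem zero_qpow {R A : Type} [CommRing R] [Ring A] [Algebra R A] [Algebra ℚ A] (a : A) :
    qpow (0 : R) a = 1 := by simp [qpow]

theorem ι_mul {x y z : sl3} (h : x.1 * y.1 - y.1 * x.1 = z.1) :
    UniversalEnvelopingAlgebra.ι ℂ x * UniversalEnvelopingAlgebra.ι ℂ y =
      UniversalEnvelopingAlgebra.ι ℂ y * UniversalEnvelopingAlgebra.ι ℂ x +
        UniversalEnvelopingAlgebra.ι ℂ z := by
  have hz : z = ⁅x, y⁆ := Subtype.ext h.symm
  rw [hz, LieHom.map_lie, LieRing.of_associative_ring_bracket]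
  abel

theorem serre_of_bracket {x y z : sl3} (h : x.1 * y.1 - y.1 * x.1 = z.1)
    (h' : x.1 * z.1 - z.1 * x.1 = 0) :
    Serre (1 : ℂ) 1 (UniversalEnvelopingAlgebra.ι ℂ x) (UniversalEnvelopingAlgebra.ι ℂ y) := by
  have h1 := ι_mul h
  have h2 := ι_mul (z := 0) h'
  rw [map_zero, add_zero] at h2
  rw [Serre, ← sub_eq_zero]
  generalize UniversalEnvelopingAlgebra.ι ℂ x = X at *
  generalize UniversalEnvelopingAlgebra.ι ℂ y = Y at *
  generalize UniversalEnvelopingAlgebra.ι ℂ z = Z at *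
  have hZ : Z = X * Y - Y * X := by rw [h1]; abel
  rw [← sub_eq_zero, hZ] at h2
  rw [← h2, add_smul, one_smul]
  noncomm_ring

theorem slGen_val : ∀ g, (slGen g).1 = match g with
  | .e 0 => !![0, 1, 0; 0, 0, 0; 0, 0, 0]
  | .e 1 => !![0, 0, 0; 0, 0, 1; 0, 0, 0]
  | .f 0 => !![0, 0, 0; 1, 0, 0; 0, 0, 0]
  | .f 1 => !![0, 0, 0; 0, 0, 0; 0, 1, 0]
  | .h 0 => !![1, 0, 0; 0, -1, 0; 0, 0, 0]
  | .h 1 => !![0, 0, 0; 0, 1, 0; 0, 0, -1] := by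
  intro g
  rcases g with i | i | i <;> fin_cases i <;> ext a b <;> fin_cases a <;> fin_cases b <;>
    simp [slGen, LieAlgebra.SpecialLinear.val_single, LieAlgebra.SpecialLinear.val_singleSubSingle, Matrix.single]


/-- The image of `slGen i` in `U(sl_3(ℂ))`. -/
noncomputable def classicalGen (i : Gen) : Usl3 := UniversalEnvelopingAlgebra.ι ℂ (slGen i)

theorem classicalGen_h_h : classicalGen (.h 0) * classicalGen (.h 1) =
    classicalGen (.h 1) * classicalGen (.h 0) := by
  have h := ι_mul (x := slGen (.h 0)) (y := slGen (.h 1)) (z := 0) (by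
    change _ = 0
    simp only [slGen_val]
    ext a b; fin_cases a <;> fin_cases b <;> simp)
  rw [map_zero, add_zero] at h
  exact h

theorem classicalGen_h_e (i j : Fin 2) : classicalGen (.h i) * classicalGen (.e j) =
    classicalGen (.e j) * classicalGen (.h i) + (cartan i j) • classicalGen (.e j) := by
  have h := ι_mul (x := slGen (.h i)) (y := slGen (.e j)) (z := cartan i j • slGen (.e j)) (by
    change _ = cartan i j • (slGen (.e j)).1
    fin_cases i <;> fin_cases j <;> simp only [slGen_val, cartan] <;>
    ext a b <;> fin_cases a <;> fin_cases b <;> simp <;> norm_num)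
  rw [map_zsmul] at h
  exact h

theorem classicalGen_h_f (i j : Fin 2) : classicalGen (.h i) * classicalGen (.f j) =
    classicalGen (.f j) * classicalGen (.h i) + (-cartan i j) • classicalGen (.f j) := by
  have h := ι_mul (x := slGen (.h i)) (y := slGen (.f j)) (z := (-cartan i j) • slGen (.f j)) (by
    change _ = -cartan i j • (slGen (.f j)).1
    fin_cases i <;> fin_cases j <;> simp only [slGen_val, cartan] <;>
    ext a b <;> fin_cases a <;> fin_cases b <;> simp <;> norm_num)
  rw [map_zsmul] at h
  exact h

theorem classicalGen_e_f_ne (i j : Fin 2) (hij : i ≠ j) : classicalGen (.e i) * classicalGen (.f j) =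
    classicalGen (.f j) * classicalGen (.e i) := by
  have h := ι_mul (x := slGen (.e i)) (y := slGen (.f j)) (z := 0) (by
    change _ = 0
    fin_cases i <;> fin_cases j <;> simp only [slGen_val] <;> first
      | exact absurd rfl hij
      | ext a b; fin_cases a <;> fin_cases b <;> simp)
  rw [map_zero, add_zero] at h
  exact h

theorem classicalGen_e_f (i : Fin 2) : classicalGen (.e i) * classicalGen (.f i) =
    classicalGen (.f i) * classicalGen (.e i) + classicalGen (.h i) := by
  exact ι_mul (x := slGen (.e i)) (y := slGen (.f i)) (z := slGen (.h i)) (by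
    fin_cases i <;> simp only [slGen_val] <;>
    ext a b <;> fin_cases a <;> fin_cases b <;> simp)

theorem classicalGen_serre_e (i j : Fin 2) (hij : i ≠ j) :
    Serre (1 : ℂ) 1 (classicalGen (.e i)) (classicalGen (.e j)) := by
  refine serre_of_bracket (z := ⟨_, LieSubalgebra.lie_mem _ (slGen (.e i)).2 (slGen (.e j)).2⟩) rfl ?_
  change (slGen (.e i)).1 * ((slGen (.e i)).1 * (slGen (.e j)).1 - (slGen (.e j)).1 * (slGen (.e i)).1) -
    ((slGen (.e i)).1 * (slGen (.e j)).1 - (slGen (.e j)).1 * (slGen (.e i)).1) * (slGen (.e i)).1 = 0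
  fin_cases i <;> fin_cases j <;> simp only [slGen_val] <;> first
    | exact absurd rfl hij
    | ext a b; fin_cases a <;> fin_cases b <;> simp

theorem classicalGen_serre_f (i j : Fin 2) (hij : i ≠ j) :
    Serre (1 : ℂ) 1 (classicalGen (.f i)) (classicalGen (.f j)) := by
  refine serre_of_bracket (z := ⟨_, LieSubalgebra.lie_mem _ (slGen (.f i)).2 (slGen (.f j)).2⟩) rfl ?_
  change (slGen (.f i)).1 * ((slGen (.f i)).1 * (slGen (.f j)).1 - (slGen (.f j)).1 * (slGen (.f i)).1) -
    ((slGen (.f i)).1 * (slGen (.f j)).1 - (slGen (.f j)).1 * (slGen (.f i)).1) * (slGen (.f i)).1 = 0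
  fin_cases i <;> fin_cases j <;> simp only [slGen_val] <;> first
    | exact absurd rfl hij
    | ext a b; fin_cases a <;> fin_cases b <;> simp

/-- The classical generators of `U(sl_3(ℂ))⟦t⟧ / (t ^ n)` satisfy the relations at `q = 1`. -/
theorem classical_relations (n : ℕ) : QRelations (0 : LevelRing ℂ n)
    (fun i => ClassicalLevel.of n (classicalGen i)) := by
  have hs : ∀ {x y : Usl3}, Serre (1 : ℂ) 1 x y →
      Serre (1 : LevelRing ℂ n) 1 (ClassicalLevel.of n x) (ClassicalLevel.of n y) := by
    intro x y h
    simp only [Serre, ← map_mul, ← map_add, add_smul, one_smul] at h ⊢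
    rw [h]
  refine QRelations.mk IsNilpotent.zero ?_ ?_ ?_ ?_ ?_ ?_ ?_
  · rw [Commute, SemiconjBy, ← map_mul, ← map_mul, classicalGen_h_h]
  · intro i j
    rw [← map_mul, ← map_mul, classicalGen_h_e, map_add, map_zsmul, Int.cast_smul_eq_zsmul]
  · intro i j
    rw [← map_mul, ← map_mul, classicalGen_h_f, map_add, map_zsmul, ← Int.cast_neg,
      Int.cast_smul_eq_zsmul]
  · intro i j hij
    rw [← map_mul, ← map_mul, classicalGen_e_f_ne i j hij]
  · intro i
    rw [qnum_zero, qnum_zero, ← map_mul, ← map_mul, classicalGen_e_f, map_add, add_sub_cancel_left,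
      smul_assoc, one_smul]
  · intro i j hij
    rw [zero_qpow, zero_qpow]
    exact hs (classicalGen_serre_e i j hij)
  · intro i j hij
    rw [zero_qpow, zero_qpow]
    exact hs (classicalGen_serre_f i j hij)

variable {K : Type} [CommRing K] [Algebra ℚ K] (p : FormalParameter K) (f : K →+* ℂ)
  (hf : PowerSeries.map f p.q = 1)

/-- The specialisation `U_q(sl_3) → U(sl_3(ℂ))⟦t⟧`, generators to generators, modulo `t ^ n`, along
a map `f` of coefficients that sends `q` to `1`. -/
noncomputable def ULevel.specialize (n : ℕ) : ULevel p n →+* ClassicalLevel n :=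
  Uq.lift (levelMap f n) (fun i => ClassicalLevel.of n (classicalGen i))
    ((p.levelMap_level_eq_zero f hf n).symm ▸ classical_relations n)

theorem ULevel.specialize_trans (n : ℕ) (x : ULevel p (n + 1)) :
    ClassicalLevel.trans n (ULevel.specialize p f hf (n + 1) x) =
      ULevel.specialize p f hf n (ULevel.trans p n x) := by
  have h : (ClassicalLevel.trans n).comp (ULevel.specialize p f hf (n + 1)) =
      (ULevel.specialize p f hf n).comp (ULevel.trans p n) := by
    refine Uq.ringHom_ext (fun r => ?_) (fun i => ?_)
    · simp only [ULevel.specialize, ULevel.trans, RingHom.comp_apply, Uq.lift_algebraMap,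
        Uq.map_algebraMap, ClassicalLevel.trans_algebraMap, levelMap_comp_trans]
    · simp [ULevel.specialize, ClassicalLevel.trans_of]
  exact congrFun (congrArg DFunLike.coe h) x

theorem ULevel.specialize_algebraMap (n : ℕ) (r : LevelRing K n) :
    ULevel.specialize p f hf n (algebraMap (LevelRing K n) (ULevel p n) r) =
      algebraMap (LevelRing ℂ n) (ClassicalLevel n) (levelMap f n r) :=
  Uq.lift_algebraMap _ _ _ r

/-- The specialisation of the tensor squares modulo `t ^ n`. -/
noncomputable def ULevel₂.specialize (n : ℕ) : ULevel₂ p n →+* ClassicalLevel₂ n :=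
  tensorMap (levelMap f n) (ULevel.specialize p f hf n) (ULevel.specialize p f hf n)
    (ULevel.specialize_algebraMap p f hf n) (ULevel.specialize_algebraMap p f hf n)

theorem ULevel₂.specialize_tmul (n : ℕ) (x y : ULevel p n) :
    ULevel₂.specialize p f hf n (x ⊗ₜ y) =
      ULevel.specialize p f hf n x ⊗ₜ ULevel.specialize p f hf n y :=
  tensorMap_tmul _ _ _ (ULevel.specialize_algebraMap p f hf n)
    (ULevel.specialize_algebraMap p f hf n) x y

/-- The specialisation of the completed tensor squares. -/
noncomputable def UHat₂.specialize : UHat₂ p →+* ClassicalHat₂ :=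
  invLim.map (ULevel₂.specialize p f hf) fun n x => by
    have h : (ClassicalLevel₂.trans n).comp (ULevel₂.specialize p f hf (n + 1)) =
        (ULevel₂.specialize p f hf n).comp (ULevel₂.trans p n) := by
      refine tensor_ringHom_ext fun a b => ?_
      rw [RingHom.comp_apply, RingHom.comp_apply, ULevel₂.trans_tmul, ULevel₂.specialize_tmul,
        ULevel₂.specialize_tmul, ClassicalLevel₂.trans_tmul, ULevel.specialize_trans,
        ULevel.specialize_trans]
    exact congrFun (congrArg DFunLike.coe h) x

end Classical

section Twists

/-- `F ∈ B ⊗ B` is a twist of the bialgebra `B`: it is invertible, satisfies the Drinfeld equation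
`F_12 (Δ ⊗ id)(F) = F_23 (id ⊗ Δ)(F)` (in `B ⊗ (B ⊗ B)`) and is normalised by
`(ε ⊗ id)(F) = 1 = (id ⊗ ε)(F)`. -/
def IsTwist {R B : Type} [CommRing R] [Ring B] [Bialgebra R B] (F : B ⊗[R] B) : Prop :=
  IsUnit F ∧
  Algebra.TensorProduct.assoc R R R B B B (F ⊗ₜ 1) *
      Algebra.TensorProduct.assoc R R R B B B
        (Algebra.TensorProduct.map (Bialgebra.comulAlgHom R B) (AlgHom.id R B) F) =
    (1 ⊗ₜ F) * Algebra.TensorProduct.map (AlgHom.id R B) (Bialgebra.comulAlgHom R B) F ∧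
  Algebra.TensorProduct.lid R B
    (Algebra.TensorProduct.map (Bialgebra.counitAlgHom R B) (AlgHom.id R B) F) = 1 ∧
  Algebra.TensorProduct.rid R R B
    (Algebra.TensorProduct.map (AlgHom.id R B) (Bialgebra.counitAlgHom R B) F) = 1

/-- `F` is a twist of the completed `U_q(sl_3)` over `K⟦t⟧`; the equations between elements of the
completed tensor powers are checked modulo each power of `t`. -/
def UHat₂.IsTwist {K : Type} [CommRing K] [Algebra ℚ K] {p : FormalParameter K} (F : UHat₂ p) :
    Prop := ∀ n, QSl3.IsTwist (F.1 n)

/-- `F` is a twist of `U(sl_3(ℂ))⟦t⟧`, with the standard coproduct. -/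
def ClassicalHat₂.IsTwist (F : ClassicalHat₂) : Prop := ∀ n, QSl3.IsTwist (F.1 n)

/-- `F` and `G` are equivalent: `F = (V ⊗ V) G Δ(V⁻¹)` for an invertible `V` with `ε(V) = 1`. -/
def UHat₂.Equivalent {K : Type} [CommRing K] [Algebra ℚ K] {p : FormalParameter K}
    (F G : UHat₂ p) : Prop :=
  ∃ V : (UHat p)ˣ, (∀ n, Bialgebra.counitAlgHom (LevelRing K n) (ULevel p n) (V.1.1 n) = 1) ∧
    F = UHat.tmul p V V * G * UHat.comul p ↑V⁻¹

/-- `F ≡ G mod c` in `U_q(sl_3) ⊗ U_q(sl_3)` over `K'⟦t⟧`: the difference is `c` times an element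
that is defined over `K⟦t⟧`. -/
def UHat₂.CongrMod {K K' : Type} [CommRing K] [Algebra ℚ K] [CommRing K'] [Algebra ℚ K']
    {p : FormalParameter K} {f : K →+* K'} (c : K⟦X⟧) (F G : UHat₂ (p.map f)) : Prop :=
  ∃ D : UHat₂ p, F - G = UHat₂.baseChange p f (UHat₂.scalar p c * D)

section

/-- The scalar `s⁻¹` of `ℂ((s))`. -/
noncomputable def sInv : LaurentSeries ℂ := HahnSeries.single (-1) 1

variable (p : FormalParameter (LaurentSeries ℂ))

/-- `W = exp_{q²}(t s⁻¹ e_12)`. -/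
noncomputable def twistW : UHat p :=
  invLim.qExp (ULevel.trans_smul p) (p.q ^ 2) (PowerSeries.C sInv * X) (by simp) (UHat.gen p (.e 0))

/-- The Abelian twist `q ^ (s⁻¹ h_12^⊥ ⊗ h_12) = exp(s⁻¹ log(q) h_12^⊥ ⊗ h_12)`. -/
noncomputable def abelianTwist : UHat₂ p :=
  invLim.exp (ULevel₂.trans_smul p) (PowerSeries.C sInv * p.hbar) (by simp [p.constantCoeff_hbar])
    (UHat.tmul p (UHat.hperp p) (UHat.gen p (.h 0)))

/-- `J(s,t) = (W ⊗ W) Δ(W⁻¹)`. -/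
noncomputable def coboundaryJ : UHat₂ p :=
  UHat.tmul p (twistW p) (twistW p) * UHat.comul p (Ring.inverse (twistW p))

/-- `F_q = (W ⊗ W) q ^ (s⁻¹ h_12^⊥ ⊗ h_12) Δ(W⁻¹)`. -/
noncomputable def twistFq : UHat₂ p :=
  UHat.tmul p (twistW p) (twistW p) * abelianTwist p * UHat.comul p (Ring.inverse (twistW p))

/-- `exp(c h_12^⊥ ⊗ e_12)` for `c ∈ t ℂ((s))⟦t⟧`. -/
noncomputable def expHperpE (c : (LaurentSeries ℂ)⟦X⟧) (hc : constantCoeff c = 0) : UHat₂ p :=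
  invLim.exp (ULevel₂.trans_smul p) c hc (UHat.tmul p (UHat.hperp p) (UHat.gen p (.e 0)))

end

/-- The Reshetikhin twist `exp(ξ H_12^⊥ ⊗ E_12)` of `U(sl_3(ℂ))⟦t⟧`, for `ξ ∈ t ℂ⟦t⟧`. -/
noncomputable def reshetikhinTwist (ξ : ℂ⟦X⟧) (hξ : constantCoeff ξ = 0) : ClassicalHat₂ :=
  invLim.exp ClassicalLevel₂.trans_smul ξ hξ (ClassicalHat₂.tmul
    (UniversalEnvelopingAlgebra.ι ℂ slHperp) (UniversalEnvelopingAlgebra.ι ℂ (slGen (.e 0))))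

/-- The inclusion `ℂ⟦s⟧ → ℂ((s))`. -/
noncomputable abbrev toLaurent : ℂ⟦X⟧ →+* LaurentSeries ℂ := HahnSeries.ofPowerSeries ℤ ℂ

/-- The evaluation `s = 0`. -/
noncomputable abbrev atZero : ℂ⟦X⟧ →+* ℂ := constantCoeff

/-- The variable `s` of `ℂ⟦s⟧⟦t⟧`. -/
noncomputable abbrev sVar : ℂ⟦X⟧⟦X⟧ := PowerSeries.C X

/-- The variable `t` of `ℂ⟦s⟧⟦t⟧`. -/
noncomputable abbrev tVar : ℂ⟦X⟧⟦X⟧ := X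

/-- If `q ≡ 1 + s² t mod s³ t` then `q = 1` at `s = 0`. -/
theorem map_atZero_eq_one (p : FormalParameter ℂ⟦X⟧)
    (hp : sVar ^ 3 * tVar ∣ p.q - (1 + sVar ^ 2 * tVar)) : PowerSeries.map atZero p.q = 1 := by
  obtain ⟨d, hd⟩ := hp
  have h : p.q = 1 + sVar ^ 2 * tVar + sVar ^ 3 * tVar * d := by
    rw [← hd]; ring
  rw [h]
  simp

/-- `L` is the `s → 0` limit of an element `F` over `ℂ((s))⟦t⟧`: `F` is defined over `ℂ⟦s⟧⟦t⟧`, and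
setting `s = 0` (so that `q = 1`) gives `L`. -/
def UHat₂.HasLimit {p : FormalParameter ℂ⟦X⟧} (hp : PowerSeries.map atZero p.q = 1)
    (F : UHat₂ (p.map toLaurent)) (L : ClassicalHat₂) : Prop :=
  ∃ F₀ : UHat₂ p, UHat₂.baseChange p toLaurent F₀ = F ∧ UHat₂.specialize p atZero hp F₀ = L

end Twists

end Completed

end QSl3

/-!
Everything reduces to an explicit formula for `F_q` in which no negative power of `s` is left.
Write `e = e_12`, `h = h_12`, `c = t s⁻¹`, `Q = q²` and `Φ = q ^ (s⁻¹ h_12^⊥ ⊗ h_12)`.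

* The summands of `Δ(e) = q ^ (-h) ⊗ e + e ⊗ 1` `Q`-commute, so the `Q`-binomial theorem
  (`powSum_qDivPow_add`) gives `Δ(W) = exp_Q(c q ^ (-h) ⊗ e) (W ⊗ 1)`.
* `h_12^⊥` commutes with `e`, so `Φ` commutes with `W ⊗ 1`, and moving `Φ` past `1 ⊗ e` multiplies
  it by `q ^ (2 s⁻¹ h_12^⊥) ⊗ 1`. Hence `F_q = exp_Q(c (1 ⊗ e)) exp_Q(c G (1 ⊗ e))⁻¹ Φ` with
  `G = q ^ (-h + 2 s⁻¹ h_12^⊥) ⊗ 1`.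
* `G` commutes with `1 ⊗ e`, so that quotient of `Q`-exponentials is
  `∑ c ^ k (1 - G) (1 - Q G) ⋯ (1 - Q ^ (k - 1) G) (1 ⊗ e) ^ k / (k)_Q!`
  (`powSum_qPochhammer_mul`).
* The hypothesis on `q` gives `log q = s² t v` with `v ≡ 1 mod s`. Then `Q ^ j G = exp(s t a_j)` with
  `a_j = v (2 h_12^⊥ - s h + 2 j s) ⊗ 1`, so `c (1 - Q ^ j G) = -t² (exp(s t a_j) - 1) / (s t)` is
  defined over `ℂ⟦s⟧⟦t⟧` and congruent to `-2 t² h_12^⊥ ⊗ 1` modulo `s t²`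
  (`Uq.ratio_mul_exp_mul_comul`, `UHat₂.scalar_dvd_ratioCoeff_sub`).

So `F_q` comes from an element over `ℂ⟦s⟧⟦t⟧` (`UHat₂.integralTwist`), which is congruent term by
term to `exp(-2 t² h_12^⊥ ⊗ e)` modulo `s t`. The congruence has to be witnessed by an element of the
completed tensor square and not only modulo each power of `t`, where division by `s t` is not
unique; therefore it is proved for the coefficients of a series in the completion. The limit
`s → 0` follows from the congruence.

The twist properties are general facts: the exponential of a multiple of `a ⊗ b` is a twist for
commuting primitive `a`, `b` (`isTwist_exp_tmul`), which covers the Abelian twist and the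
Reshetikhin twist, and a gauge transform of a twist is a twist (`IsTwist.gauge`), which covers
`F_q`.
-/

namespace QSl3

/-! ### The exponential of the logarithm of a power series -/

section ExpLog

variable {K : Type} [CommRing K] [Algebra ℚ K]

theorem exp_subst_log : (PowerSeries.exp K).subst (PowerSeries.log K) = 1 + X := by
  set E := (PowerSeries.exp K).subst (PowerSeries.log K) with hE
  set g := d⁄dX K (PowerSeries.log K) with hg
  have hgX : (1 + X) * g = 1 := by
    rw [hg, deriv_log]
    ext n
    cases n with
    | zero => simp
    | succ n => simp [add_mul, coeff_succ_X_mul, coeff_one, pow_succ]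
  have hdE : (1 + X) * d⁄dX K E = E := by
    rw [hE, derivative_subst HasSubst.log, derivative_exp, ← hg, mul_left_comm, hgX, mul_one]
  have h0 : coeff 0 E = 1 := by
    rw [coeff_zero_eq_constantCoeff_apply, hE, ← sub_eq_zero]
    have h := constantCoeff_subst_eq_zero (a := PowerSeries.log K) constantCoeff_log
      (PowerSeries.exp K - 1) (by simp)
    rw [subst_sub HasSubst.log] at h
    have h1 : (1 : K⟦X⟧).subst (PowerSeries.log K) = (1 : K⟦X⟧) := by
      rw [← coe_substAlgHom HasSubst.log, map_one]
    rw [h1, ← PowerSeries.constantCoeff.eq_def] at h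
    rwa [map_sub, map_one] at h
  have hrec : ∀ n, coeff (n + 1) E * (n + 1) + coeff n E * n = coeff n E := fun n => by
    conv_rhs => rw [← hdE, add_mul, one_mul, map_add, coeff_derivative]
    cases n with
    | zero => simp
    | succ n => rw [coeff_succ_X_mul, coeff_derivative]; push_cast; rfl
  have hcancel : ∀ (n : ℕ) (x : K), x * (n + 1) = 0 → x = 0 := fun n x hx => by
    have hu : IsUnit ((n : K) + 1) := by
      have := (IsUnit.mk0 ((n : ℚ) + 1) (by positivity)).map (algebraMap ℚ K)
      simpa using this
    exact (hu.mul_left_eq_zero).1 hx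
  have h1 : coeff 1 E = 1 := by simpa [h0] using hrec 0
  have h2 : ∀ n, coeff (n + 2) E = 0 := fun n => by
    induction n with
    | zero => exact hcancel 1 _ (by simpa [h1] using hrec 1)
    | succ n ih => exact hcancel (n + 2) _ (by simpa [ih] using hrec (n + 2))
  ext n
  match n with
  | 0 => simpa using h0
  | 1 => simpa [coeff_one] using h1
  | n + 2 => rw [h2]; simp [coeff_one, coeff_X]

theorem subst_logOf_exp {x : K⟦X⟧} (hx : constantCoeff x = 1) :
    (PowerSeries.exp K).subst (logOf x) = x := by
  have h : HasSubst (x - 1) := HasSubst.of_constantCoeff_zero' (by simp [hx])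
  have h1 : (1 : K⟦X⟧).subst (x - 1) = (1 : K⟦X⟧) := by rw [← coe_substAlgHom h, map_one]
  rw [logOf_eq, ← subst_comp_subst_apply HasSubst.log h, exp_subst_log, subst_add h, h1,
    subst_X h, add_sub_cancel]

/-- Modulo `t ^ n` the substitution of `u ∈ t K⟦t⟧` into a power series is a finite sum. -/
theorem toLevel_subst {u : K⟦X⟧} (hu : constantCoeff u = 0) (F : K⟦X⟧) (n : ℕ) :
    toLevel n (F.subst u) =
      ∑ k ∈ Finset.range n, toLevel n (C (coeff k F)) * toLevel n u ^ k := by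
  have h : HasSubst u := HasSubst.of_constantCoeff_zero' hu
  have h0 : toLevel n (u ^ n) = 0 := toLevel_eq_zero (pow_dvd_pow_of_dvd (X_dvd_iff.2 hu) n)
  have ht : F.trunc n = ∑ k ∈ Finset.range n, Polynomial.monomial k (coeff k F) := by
    ext i
    simp [coeff_trunc, Polynomial.coeff_monomial]
  conv_lhs => rw [eq_X_pow_mul_shift_add_trunc n F]
  rw [subst_add h, subst_mul h, subst_pow h, subst_X h, subst_coe h, map_add, map_mul, h0,
    zero_mul, zero_add, ht, map_sum, map_sum]
  refine Finset.sum_congr rfl fun k _ => ?_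
  rw [Polynomial.aeval_monomial, map_mul, map_pow]
  rfl

/-- `log (1 + u) ≡ u mod u²`. -/
theorem exists_logOf_one_add {u : K⟦X⟧} (hu : constantCoeff u = 0) :
    ∃ w, logOf (1 + u) = u + u ^ 2 * w := by
  have h : HasSubst u := HasSubst.of_constantCoeff_zero' hu
  have hl := eq_X_pow_mul_shift_add_trunc 2 (PowerSeries.log K)
  have ht : ((PowerSeries.log K).trunc 2 : K⟦X⟧) = X := by
    ext n
    rw [Polynomial.coeff_coe, coeff_trunc]
    match n with
    | 0 => simp
    | 1 => simp
    | n + 2 => simp [coeff_X]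
  rw [ht] at hl
  refine ⟨subst u (mk fun i => coeff (i + 2) (PowerSeries.log K)), ?_⟩
  rw [logOf_eq, add_sub_cancel_left]
  conv_lhs => rw [hl]
  rw [subst_add h, subst_mul h, subst_pow h, subst_X h, add_comm]

end ExpLog

/-! ### `q`-exponentials in a nilpotent parameter -/

section PowSum

variable {R A : Type} [CommRing R] [Ring A] [Algebra R A]

/-- The truncated power series `∑_{k < N} c ^ k u_k`. It is used for `c ^ N = 0`, when it is the
value at `c` of the series with coefficients `u_k`. -/
def powSum (c : R) (N : ℕ) (u : ℕ → A) : A := ∑ k ∈ Finset.range N, c ^ k • u k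

theorem powSum_mul {c : R} {N : ℕ} (hc : c ^ N = 0) (u v : ℕ → A) :
    powSum c N u * powSum c N v =
      powSum c N fun n => ∑ p ∈ Finset.HasAntidiagonal.antidiagonal n, u p.1 * v p.2 := by
  set T : ℕ → ℕ → A := fun i j => c ^ (i + j) • (u i * v j) with hT
  have key : ∀ n, c ^ n • ∑ p ∈ Finset.HasAntidiagonal.antidiagonal n, u p.1 * v p.2 =
      ∑ i ∈ Finset.range (n + 1), T i (n - i) := fun n => by
    rw [← Finset.Nat.sum_antidiagonal_eq_sum_range_succ T n, Finset.smul_sum]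
    refine Finset.sum_congr rfl fun p hp => ?_
    rw [hT, ← Finset.HasAntidiagonal.mem_antidiagonal.1 hp]
  rw [powSum, powSum, powSum, Finset.sum_congr rfl fun n _ => key n, Finset.sum_range_diag_flip,
    Finset.sum_mul]
  refine Finset.sum_congr rfl fun i hi => ?_
  rw [Finset.mul_sum]
  have hsub : ∑ j ∈ Finset.range (N - i), T i j = ∑ j ∈ Finset.range N, T i j :=
    Finset.sum_subset (Finset.range_mono (Nat.sub_le _ _)) fun j _ hj => by
      have hij : N ≤ i + j := by simp only [Finset.mem_range] at hj; omega
      rw [hT]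
      change c ^ (i + j) • _ = _
      rw [pow_eq_zero_of_le hij hc, zero_smul]
  rw [hsub]
  refine Finset.sum_congr rfl fun j _ => ?_
  rw [smul_mul_smul_comm, ← pow_add]

theorem powSum_congr_right {c : R} {N : ℕ} {u v : ℕ → A} (h : ∀ k, u k = v k) :
    powSum c N u = powSum c N v := by rw [funext h]

/-- Splitting off the constant term. As `c ^ N = 0`, the number of terms need not drop; in
particular the formula also holds for `N = 0`, where `R` is the zero ring. -/
theorem powSum_eq_add {c : R} {N : ℕ} (hc : c ^ N = 0) (u : ℕ → A) :
    powSum c N u = u 0 + c • powSum c N fun k => u (k + 1) := by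
  have h : powSum c N u = powSum c (N + 1) u := by
    rw [powSum, powSum, Finset.sum_range_succ, hc, zero_smul, add_zero]
  rw [h, powSum, powSum, Finset.sum_range_succ', pow_zero, one_smul, add_comm, Finset.smul_sum]
  congr 1
  refine Finset.sum_congr rfl fun k _ => ?_
  rw [smul_smul, ← pow_succ']

theorem map_powSum {R' A' : Type} [CommRing R'] [Ring A'] [Algebra R' A'] (φ : R →+* R')
    (f : A →+* A') (hf : ∀ (r : R) (a : A), f (r • a) = φ r • f a) (c : R) (N : ℕ) (u : ℕ → A) :
    f (powSum c N u) = powSum (φ c) N fun k => f (u k) := by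
  simp only [powSum, map_sum, hf, map_pow]

theorem _root_.SemiconjBy.powSum {a : A} {u v : ℕ → A} (h : ∀ k, SemiconjBy a (u k) (v k))
    (c : R) (N : ℕ) : SemiconjBy a (powSum c N u) (powSum c N v) := by
  rw [SemiconjBy, QSl3.powSum, QSl3.powSum, Finset.mul_sum, Finset.sum_mul]
  refine Finset.sum_congr rfl fun k _ => ?_
  rw [mul_smul_comm, (h k).eq, smul_mul_assoc]

theorem expDiv_eq_powSum [Algebra ℚ A] {ħ : R} {N : ℕ} (hN : ħ ^ N = 0) (a : A) :
    expDiv ħ a = powSum ħ N fun k => ((k + 1).factorial : ℚ)⁻¹ • a ^ (k + 1) := by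
  rw [expDiv_eq_sum hN, powSum]
  exact Finset.sum_congr rfl fun k _ => smul_comm _ _ _

theorem exp_smul_eq_powSum [Algebra ℚ A] {c : R} {N : ℕ} (hN : c ^ N = 0) (a : A) :
    IsNilpotent.exp (c • a) = powSum c N fun k => (k.factorial : ℚ)⁻¹ • a ^ k := by
  rw [IsNilpotent.exp_eq_sum (k := N) (by rw [smul_pow, hN, zero_smul]), powSum]
  refine Finset.sum_congr rfl fun k _ => ?_
  rw [smul_pow, smul_comm]

end PowSum

section QFactorial

variable {S : Type} [CommRing S]

theorem qFactorial_zero (Q : S) : qFactorial Q 0 = 1 := by simp [qFactorial]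

theorem qFactorial_succ (Q : S) (k : ℕ) :
    qFactorial Q (k + 1) = qFactorial Q k * ∑ i ∈ Finset.range (k + 1), Q ^ i := by
  rw [qFactorial, Finset.prod_range_succ, qFactorial]

theorem map_qFactorial {S' : Type} [CommRing S'] (f : S →+* S') (Q : S) (k : ℕ) :
    f (qFactorial Q k) = qFactorial (f Q) k := by
  simp [qFactorial, map_prod, map_sum, map_pow]

theorem qFactorial_one (k : ℕ) : qFactorial (1 : S) k = (k.factorial : S) := by
  induction k with
  | zero => simp [qFactorial]
  | succ k ih => rw [qFactorial_succ, ih]; simp [Nat.factorial_succ, mul_comm]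

theorem map_ringInverse_of_isUnit {S' : Type} [CommRing S'] (f : S →+* S') {x : S}
    (hx : IsUnit x) : f (Ring.inverse x) = Ring.inverse (f x) := by
  refine left_inv_eq_right_inv (a := f x) ?_ (Ring.mul_inverse_cancel _ (hx.map f))
  rw [← map_mul, Ring.inverse_mul_cancel _ hx, map_one]

end QFactorial

section QExp

variable {R A : Type} [CommRing R] [Ring A] [Algebra R A]

/-- The `q`-divided power `x ^ k / (k)_Q!`. -/
noncomputable def qDivPow (Q : R) (x : A) (k : ℕ) : A := Ring.inverse (qFactorial Q k) • x ^ k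

theorem qDivPow_zero (Q : R) (x : A) : qDivPow Q x 0 = 1 := by
  rw [qDivPow, qFactorial_zero, Ring.inverse_one, pow_zero, one_smul]

variable {Q : R} (hQ : ∀ k, IsUnit (qFactorial Q k))
include hQ

theorem qint_isUnit (k : ℕ) : IsUnit (∑ i ∈ Finset.range (k + 1), Q ^ i) :=
  isUnit_of_mul_isUnit_right (qFactorial_succ Q k ▸ hQ (k + 1))

theorem qint_mul_inverse_qFactorial (k : ℕ) :
    (∑ i ∈ Finset.range (k + 1), Q ^ i) * Ring.inverse (qFactorial Q (k + 1)) =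
      Ring.inverse (qFactorial Q k) := by
  refine (hQ k).mul_left_cancel ?_
  rw [← mul_assoc, ← qFactorial_succ, Ring.mul_inverse_cancel _ (hQ _),
    Ring.mul_inverse_cancel _ (hQ _)]

theorem qint_smul_qDivPow (x : A) (k : ℕ) :
    (∑ i ∈ Finset.range (k + 1), Q ^ i) • qDivPow Q x (k + 1) = x * qDivPow Q x k := by
  rw [qDivPow, qDivPow, smul_smul, qint_mul_inverse_qFactorial hQ, mul_smul_comm, pow_succ']

/-- The sequence of `q`-divided powers of `x` is the solution of `(n + 1)_Q T_{n+1} = x T_n`,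
`T_0 = 1`. -/
theorem eq_qDivPow_of_rec {x : A} {T : ℕ → A} (h0 : T 0 = 1)
    (h : ∀ n, (∑ i ∈ Finset.range (n + 1), Q ^ i) • T (n + 1) = x * T n) (n : ℕ) :
    T n = qDivPow Q x n := by
  induction n with
  | zero => rw [h0, qDivPow_zero]
  | succ n ih =>
    refine (qint_isUnit hQ n).smul_left_cancel.1 ?_
    rw [h, ih, qint_smul_qDivPow hQ]

omit hQ in
/-- The `q`-Leibniz rule for Cauchy products, from `(i + j)_Q = (i)_Q + Q ^ i (j)_Q`. -/
theorem qint_smul_sum_antidiagonal (a b : ℕ → A) (n : ℕ) :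
    (∑ i ∈ Finset.range (n + 1), Q ^ i) •
        ∑ p ∈ Finset.HasAntidiagonal.antidiagonal (n + 1), a p.1 * b p.2 =
      ∑ p ∈ Finset.HasAntidiagonal.antidiagonal n,
        (((∑ i ∈ Finset.range (p.1 + 1), Q ^ i) • a (p.1 + 1)) * b p.2 +
          Q ^ p.1 • (a p.1 * ((∑ i ∈ Finset.range (p.2 + 1), Q ^ i) • b (p.2 + 1)))) := by
  have h1 : ∀ p ∈ Finset.HasAntidiagonal.antidiagonal (n + 1),
      (∑ i ∈ Finset.range (n + 1), Q ^ i) • (a p.1 * b p.2) =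
        ((∑ i ∈ Finset.range p.1, Q ^ i) • a p.1) * b p.2 +
          Q ^ p.1 • (a p.1 * ((∑ i ∈ Finset.range p.2, Q ^ i) • b p.2)) := fun p hp => by
    rw [← Finset.HasAntidiagonal.mem_antidiagonal.1 hp, Finset.sum_range_add, add_smul,
      smul_mul_assoc, mul_smul_comm, smul_smul, Finset.mul_sum]
    simp only [pow_add]
  rw [Finset.smul_sum, Finset.sum_congr rfl h1, Finset.sum_add_distrib, Finset.sum_add_distrib,
    Finset.Nat.sum_antidiagonal_succ, Finset.Nat.sum_antidiagonal_succ']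
  simp

/-- The `q`-binomial theorem in terms of `q`-divided powers. -/
theorem qDivPow_add {x y : A} (hxy : y * x = Q • (x * y)) (n : ℕ) :
    ∑ p ∈ Finset.HasAntidiagonal.antidiagonal n, qDivPow Q x p.1 * qDivPow Q y p.2 =
      qDivPow Q (x + y) n := by
  refine eq_qDivPow_of_rec hQ (T := fun n => ∑ p ∈ Finset.HasAntidiagonal.antidiagonal n,
    qDivPow Q x p.1 * qDivPow Q y p.2)
    (by simp [qDivPow_zero]) (fun n => ?_) n
  have hyx : ∀ k, y * x ^ k = Q ^ k • (x ^ k * y) := fun k => by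
    induction k with
    | zero => simp
    | succ k ih =>
      rw [pow_succ, ← mul_assoc, ih, smul_mul_assoc, mul_assoc, hxy, mul_smul_comm, smul_smul,
        ← pow_succ, mul_assoc]
  rw [qint_smul_sum_antidiagonal, Finset.mul_sum]
  refine Finset.sum_congr rfl fun p _ => ?_
  rw [qint_smul_qDivPow hQ, qint_smul_qDivPow hQ, add_mul, mul_assoc]
  congr 1
  have hyD : y * qDivPow Q x p.1 = Q ^ p.1 • (qDivPow Q x p.1 * y) := by
    rw [qDivPow, mul_smul_comm, hyx, smul_mul_assoc, smul_comm]
  rw [← mul_assoc, ← mul_assoc, hyD, smul_mul_assoc]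

/-- The coefficients of `exp_Q(x) / exp_Q(g x)`, for commuting `g` and `x`: their Cauchy product
with the `q`-divided powers of `g x` is the sequence of `q`-divided powers of `x`. -/
theorem sum_qPochhammer_mul_qDivPow {g x : A} (hgx : Commute g x) (n : ℕ) :
    ∑ p ∈ Finset.HasAntidiagonal.antidiagonal n,
      (((List.range p.1).map fun j => 1 - Q ^ j • g).prod * qDivPow Q x p.1) *
        qDivPow Q (g * x) p.2 = qDivPow Q x n := by
  refine eq_qDivPow_of_rec hQ (T := fun n => ∑ p ∈ Finset.HasAntidiagonal.antidiagonal n,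
    (((List.range p.1).map fun j => 1 - Q ^ j • g).prod * qDivPow Q x p.1) * qDivPow Q (g * x) p.2)
    (by simp [qDivPow_zero]) (fun n => ?_) n
  have hx : ∀ k, Commute x (((List.range k).map fun j => 1 - Q ^ j • g).prod) := fun k => by
    refine Commute.list_prod_right _ _ fun y hy => ?_
    obtain ⟨j, -, rfl⟩ := List.mem_map.1 hy
    exact (Commute.one_right x).sub_right (hgx.symm.smul_right _)
  rw [qint_smul_sum_antidiagonal
    (fun i => ((List.range i).map fun j => 1 - Q ^ j • g).prod * qDivPow Q x i)
    (qDivPow Q (g * x)), Finset.mul_sum]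
  refine Finset.sum_congr rfl fun p _ => ?_
  rw [← mul_smul_comm, qint_smul_qDivPow hQ, qint_smul_qDivPow hQ, List.prod_range_succ]
  generalize hP : ((List.range p.1).map fun j => 1 - Q ^ j • g).prod = P
  have hxP : x * P = P * x := hP ▸ (hx p.1).eq
  have hgD : g * qDivPow Q x p.1 = qDivPow Q x p.1 * g :=
    ((hgx.pow_right p.1).smul_right _).eq
  have hxD : x * qDivPow Q x p.1 = qDivPow Q x p.1 * x :=
    (((Commute.refl x).pow_right p.1).smul_right _).eq
  have h1 : P * (1 - Q ^ p.1 • g) * (x * qDivPow Q x p.1) * qDivPow Q (g * x) p.2 =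
      x * (P * qDivPow Q x p.1 * qDivPow Q (g * x) p.2) -
        Q ^ p.1 • (P * qDivPow Q x p.1 * (g * x * qDivPow Q (g * x) p.2)) := by
    have h2 : P * (x * qDivPow Q x p.1) = x * (P * qDivPow Q x p.1) := by
      rw [← mul_assoc, ← mul_assoc, hxP]
    have h3 : P * g * (x * qDivPow Q x p.1) = P * qDivPow Q x p.1 * (g * x) := by
      rw [hxD, mul_assoc, ← mul_assoc g, hgD]; simp only [mul_assoc]
    rw [mul_sub, mul_one, sub_mul, sub_mul, h2, mul_smul_comm, smul_mul_assoc, smul_mul_assoc, h3]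
    simp only [mul_assoc]
  rw [h1, sub_add_cancel]

/-- `exp_Q(c (x + y)) = exp_Q(c x) exp_Q(c y)` if `y x = Q x y`. -/
theorem powSum_qDivPow_add {c : R} {N : ℕ} (hc : c ^ N = 0) {x y : A}
    (hxy : y * x = Q • (x * y)) :
    powSum c N (qDivPow Q (x + y)) = powSum c N (qDivPow Q x) * powSum c N (qDivPow Q y) := by
  rw [powSum_mul hc]
  exact powSum_congr_right fun n => (qDivPow_add hQ hxy n).symm

/-- The quotient `exp_Q(c x) / exp_Q(c g x)` of `q`-exponentials, for commuting `g` and `x`, is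
`∑ c ^ k (1 - g) (1 - Q g) ⋯ (1 - Q ^ (k - 1) g) x ^ k / (k)_Q!`. -/
theorem powSum_qPochhammer_mul {c : R} {N : ℕ} (hc : c ^ N = 0) {g x : A} (hgx : Commute g x) :
    powSum c N (fun k => ((List.range k).map fun j => 1 - Q ^ j • g).prod * qDivPow Q x k) *
      powSum c N (qDivPow Q (g * x)) = powSum c N (qDivPow Q x) := by
  rw [powSum_mul hc]
  exact powSum_congr_right fun n => sum_qPochhammer_mul_qDivPow hQ hgx n

omit hQ in
theorem isUnit_powSum_qDivPow {c : R} {N : ℕ} (hc : c ^ N = 0) (x : A) :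
    IsUnit (powSum c N (qDivPow Q x)) := by
  rw [powSum_eq_add hc, qDivPow_zero]
  exact (isNilpotent_smul ⟨N, hc⟩ _).isUnit_one_add

end QExp

/-- If `Φ (g y) = (G y) Φ`, then `exp_Q(c x) exp_Q(c y) Φ exp_Q(c (g y + x))⁻¹` is
`(exp_Q(c y) / exp_Q(c G y)) Φ`: the `q`-exponential of `g y + x` splits as
`exp_Q(c g y) exp_Q(c x)`, the factors in `x` cancel, and `Φ` turns `g y` into `G y`. -/
theorem powSum_qPochhammer_mul_comm {R T : Type} [CommRing R] [Ring T] [Algebra R T] {Q c : R}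
    (hQ : ∀ k, IsUnit (qFactorial Q k)) {N : ℕ} (hc : c ^ N = 0) {x y g G Φ : T}
    (hgy : x * (g * y) = Q • ((g * y) * x)) (hxy : Commute x y) (hx : Commute Φ x)
    (hG : Commute G y) (hΦ : SemiconjBy Φ (g * y) (G * y)) :
    powSum c N (fun k => ((List.range k).map fun j => 1 - Q ^ j • G).prod * qDivPow Q y k) * Φ *
        powSum c N (qDivPow Q (g * y + x)) =
      powSum c N (qDivPow Q x) * powSum c N (qDivPow Q y) * Φ := by
  have h1 : SemiconjBy Φ (powSum c N (qDivPow Q (g * y))) (powSum c N (qDivPow Q (G * y))) :=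
    SemiconjBy.powSum (fun k => by
      rw [SemiconjBy, qDivPow, qDivPow, mul_smul_comm, (hΦ.pow_right k).eq, smul_mul_assoc]) c N
  have h2 : Commute Φ (powSum c N (qDivPow Q x)) :=
    SemiconjBy.powSum (fun k => (hx.pow_right k).smul_right _) c N
  have h3 : Commute (powSum c N (qDivPow Q x)) (powSum c N (qDivPow Q y)) :=
    SemiconjBy.powSum (fun k => (Commute.smul_right (Commute.pow_right
      (SemiconjBy.powSum (fun k => (hxy.symm.pow_right k).smul_right _) c N).symm k) _)) c N
  rw [powSum_qDivPow_add hQ hc hgy, mul_assoc, ← mul_assoc Φ, h1.eq, mul_assoc _ Φ, h2.eq,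
    ← mul_assoc, ← mul_assoc, powSum_qPochhammer_mul hQ hc hG, h3.eq]

/-! ### Twists of bialgebras -/

section Twist

variable {R B : Type} [CommRing R] [Ring B] [Bialgebra R B]

/-- The gauge transform `(V ⊗ V) F Δ(V⁻¹)` of a twist by an invertible `V` with `ε(V) = 1`. -/
theorem IsTwist.gauge {F : B ⊗[R] B} (hF : IsTwist F) {V V' : B} (hV : V * V' = 1)
    (hV' : V' * V = 1) (hε : Bialgebra.counitAlgHom R B V = 1) :
    IsTwist ((V ⊗ₜ[R] V) * F * Bialgebra.comulAlgHom R B V') := by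
  obtain ⟨hu, hD, hl, hr⟩ := hF
  set Δ := Bialgebra.comulAlgHom R B with hΔ
  set ε := Bialgebra.counitAlgHom R B
  set as := (Algebra.TensorProduct.assoc R R R B B B).toAlgHom with has
  set i12 : B ⊗[R] B →ₐ[R] B ⊗[R] (B ⊗[R] B) := as.comp Algebra.TensorProduct.includeLeft with hi12
  set i23 : B ⊗[R] B →ₐ[R] B ⊗[R] (B ⊗[R] B) := Algebra.TensorProduct.includeRight with hi23
  set d1 := as.comp (Algebra.TensorProduct.map Δ (AlgHom.id R B)) with hd1
  set d2 := Algebra.TensorProduct.map (AlgHom.id R B) Δ with hd2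
  have hΔΔ : Δ V' * Δ V = 1 := by rw [← map_mul, hV', map_one]
  have hΔΔ' : Δ V * Δ V' = 1 := by rw [← map_mul, hV, map_one]
  have huΔ : IsUnit (Δ V') := ⟨⟨Δ V', Δ V, hΔΔ, hΔΔ'⟩, rfl⟩
  have huV : IsUnit (V ⊗ₜ[R] V) := ⟨⟨V ⊗ₜ V, V' ⊗ₜ V', by simp [hV, Algebra.TensorProduct.one_def],
    by simp [hV', Algebra.TensorProduct.one_def]⟩, rfl⟩
  have hε0 : Coalgebra.counit (R := R) V = 1 := hε
  refine ⟨(huV.mul hu).mul huΔ, ?_, ?_, ?_⟩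
  · change i12 _ * d1 _ = i23 _ * d2 _
    have hD' : i12 F * d1 F = i23 F * d2 F := hD
    -- `i12` does not meet the third tensor factor, `i23` does not meet the first
    have c12 : ∀ x, Commute (i12 x) (as (1 ⊗ₜ[R] V)) := fun x => by
      change as (x ⊗ₜ 1) * as (1 ⊗ₜ V) = as (1 ⊗ₜ V) * as (x ⊗ₜ 1)
      rw [← map_mul, ← map_mul]; simp
    have c23 : ∀ x, Commute (i23 x) (V ⊗ₜ[R] (1 : B ⊗[R] B)) := fun x => by
      change ((1 : B) ⊗ₜ[R] x) * _ = _ * ((1 : B) ⊗ₜ[R] x)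
      simp
    have e1 : d1 (V ⊗ₜ V) = i12 (Δ V) * as (1 ⊗ₜ V) := by
      change as (Δ V ⊗ₜ V) = as (Δ V ⊗ₜ 1) * as (1 ⊗ₜ V)
      rw [← map_mul]; simp
    have e2 : d2 (V ⊗ₜ V) = (V ⊗ₜ[R] (1 : B ⊗[R] B)) * i23 (Δ V) := by
      change V ⊗ₜ Δ V = (V ⊗ₜ[R] (1 : B ⊗[R] B)) * ((1 : B) ⊗ₜ[R] Δ V)
      simp
    have e3 : i12 (V ⊗ₜ V) * as (1 ⊗ₜ V) = V ⊗ₜ (V ⊗ₜ V) := by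
      change as ((V ⊗ₜ V) ⊗ₜ 1) * as (1 ⊗ₜ V) = _
      rw [← map_mul]; simp [has]
    have e4 : i23 (V ⊗ₜ V) * (V ⊗ₜ[R] (1 : B ⊗[R] B)) = V ⊗ₜ (V ⊗ₜ V) := by
      change ((1 : B) ⊗ₜ[R] (V ⊗ₜ[R] V)) * _ = _
      simp
    -- coassociativity
    have e5 : d1 (Δ V') = d2 (Δ V') := Coalgebra.coassoc_apply (R := R) V'
    have i12Δ : i12 (Δ V') * i12 (Δ V) = 1 := by rw [← map_mul, hΔΔ, map_one]
    have i23Δ : i23 (Δ V') * i23 (Δ V) = 1 := by rw [← map_mul, hΔΔ, map_one]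
    calc i12 (V ⊗ₜ V * F * Δ V') * d1 (V ⊗ₜ V * F * Δ V')
        = i12 (V ⊗ₜ V) * i12 F * (i12 (Δ V') * i12 (Δ V)) * as (1 ⊗ₜ V) * d1 F * d1 (Δ V') := by
          simp only [map_mul, e1, mul_assoc]
      _ = V ⊗ₜ (V ⊗ₜ V) * (i12 F * d1 F) * d1 (Δ V') := by
          rw [i12Δ, mul_one, mul_assoc (i12 (V ⊗ₜ V)), (c12 F).eq, ← mul_assoc, e3]
          simp only [mul_assoc]
      _ = V ⊗ₜ (V ⊗ₜ V) * (i23 F * d2 F) * d2 (Δ V') := by rw [hD', e5]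
      _ = i23 (V ⊗ₜ V) * i23 F * (V ⊗ₜ[R] (1 : B ⊗[R] B)) * (i23 (Δ V') * i23 (Δ V)) * d2 F *
            d2 (Δ V') := by
          rw [i23Δ, mul_one, mul_assoc (i23 (V ⊗ₜ V)), (c23 F).eq, ← mul_assoc (i23 _), e4]
          simp only [mul_assoc]
      _ = i23 (V ⊗ₜ V * F * Δ V') * d2 (V ⊗ₜ V * F * Δ V') := by
          rw [← mul_assoc, mul_assoc _ (V ⊗ₜ[R] (1 : B ⊗[R] B)), ← (c23 _).eq]
          simp only [map_mul, e2, mul_assoc]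
  · have h : Algebra.TensorProduct.lid R B (Algebra.TensorProduct.map ε (AlgHom.id R B) (Δ V')) =
        V' := by
      have := Coalgebra.rTensor_counit_comul (R := R) V'
      change Algebra.TensorProduct.lid R B (Coalgebra.counit.rTensor B (Coalgebra.comul V')) = _
      rw [this]; simp
    rw [map_mul, map_mul, map_mul, map_mul, hl, h]
    simp [hε0, hV]
  · have h : Algebra.TensorProduct.rid R R B (Algebra.TensorProduct.map (AlgHom.id R B) ε (Δ V')) =
        V' := by
      have := Coalgebra.lTensor_counit_comul (R := R) V'
      change Algebra.TensorProduct.rid R R B (Coalgebra.counit.lTensor B (Coalgebra.comul V')) = _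
      rw [this]; simp
    rw [map_mul, map_mul, map_mul, map_mul, hr, h]
    simp [hε0, hV]

/-- The exponential of a multiple of `a ⊗ b` is a twist, for commuting primitive `a`, `b`. The
Drinfeld equation holds because both sides are the exponential of the same sum of three commuting
elements. -/
theorem isTwist_exp_tmul [Algebra ℚ R] [Algebra ℚ B] {r : R} (hr : IsNilpotent r) {a b : B}
    (hab : Commute a b) (ha : Bialgebra.comulAlgHom R B a = a ⊗ₜ 1 + 1 ⊗ₜ a)
    (hb : Bialgebra.comulAlgHom R B b = b ⊗ₜ 1 + 1 ⊗ₜ b)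
    (ha0 : Bialgebra.counitAlgHom R B a = 0) (hb0 : Bialgebra.counitAlgHom R B b = 0) :
    IsTwist (IsNilpotent.exp (r • (a ⊗ₜ[R] b))) := by
  have hn := isNilpotent_smul hr (a ⊗ₜ[R] b)
  set i12 : B ⊗[R] B →ₐ[R] B ⊗[R] (B ⊗[R] B) :=
    (Algebra.TensorProduct.assoc R R R B B B).toAlgHom.comp Algebra.TensorProduct.includeLeft
  set i23 : B ⊗[R] B →ₐ[R] B ⊗[R] (B ⊗[R] B) := Algebra.TensorProduct.includeRight
  set d1 := (Algebra.TensorProduct.assoc R R R B B B).toAlgHom.comp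
    (Algebra.TensorProduct.map (Bialgebra.comulAlgHom R B) (AlgHom.id R B))
  set d2 := Algebra.TensorProduct.map (AlgHom.id R B) (Bialgebra.comulAlgHom R B)
  refine ⟨IsNilpotent.isUnit_exp hn, ?_, ?_, ?_⟩
  · change i12 _ * d1 _ = i23 _ * d2 _
    have e12 : i12 (a ⊗ₜ b) = a ⊗ₜ (b ⊗ₜ 1) := by simp [i12]
    have e1 : d1 (a ⊗ₜ b) = a ⊗ₜ (1 ⊗ₜ b) + 1 ⊗ₜ (a ⊗ₜ b) := by simp [d1, ha, add_tmul]
    have e23 : i23 (a ⊗ₜ b) = 1 ⊗ₜ (a ⊗ₜ b) := by simp [i23]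
    have e2 : d2 (a ⊗ₜ b) = a ⊗ₜ (b ⊗ₜ 1) + a ⊗ₜ (1 ⊗ₜ b) := by simp [d2, hb, tmul_add]
    have key : ∀ {x y : B ⊗[R] (B ⊗[R] B)}, Commute x y →
        IsNilpotent.exp (r • (x + y)) = IsNilpotent.exp (r • x) * IsNilpotent.exp (r • y) :=
      fun {x y} h => qpow_add hr h
    have cxy : Commute (a ⊗ₜ[R] (b ⊗ₜ[R] (1 : B))) (a ⊗ₜ[R] ((1 : B) ⊗ₜ[R] b)) := by
      simp [Commute, SemiconjBy]
    have cxz : Commute (a ⊗ₜ[R] (b ⊗ₜ[R] (1 : B))) ((1 : B) ⊗ₜ[R] (a ⊗ₜ[R] b)) := by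
      simp [Commute, SemiconjBy, hab.eq]
    have cyz : Commute (a ⊗ₜ[R] ((1 : B) ⊗ₜ[R] b)) ((1 : B) ⊗ₜ[R] (a ⊗ₜ[R] b)) := by
      simp [Commute, SemiconjBy]
    rw [IsNilpotent.map_exp hn, IsNilpotent.map_exp hn, IsNilpotent.map_exp hn,
      IsNilpotent.map_exp hn, map_smul, map_smul, map_smul, map_smul, e12, e1, e23, e2,
      ← key (cxy.add_right cxz), ← key (cxz.symm.add_right cyz.symm)]
    congr 2
    abel
  · rw [IsNilpotent.map_exp hn, IsNilpotent.map_exp (hn.map _)]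
    simp [ha0]
  · rw [IsNilpotent.map_exp hn, IsNilpotent.map_exp (hn.map _)]
    simp [hb0]

end Twist

/-! ### The twisted coboundary in `U_q(sl_3)` with nilpotent parameter -/

section NilpotentParameter

variable {R A : Type} [CommRing R] [Ring A] [Algebra R A]

theorem semiconjBy_exp_smul [Algebra ℚ A] {r : R} (hr : IsNilpotent r) {a x y : A}
    (h : SemiconjBy a x y) : SemiconjBy a (IsNilpotent.exp (r • x)) (IsNilpotent.exp (r • y)) := by
  obtain ⟨N, hN⟩ := hr
  rw [exp_smul_eq_powSum hN, exp_smul_eq_powSum hN]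
  exact SemiconjBy.powSum (fun k => by
    rw [SemiconjBy, mul_smul_comm, (h.pow_right k).eq, smul_mul_assoc]) r N

theorem smul_list_prod_range (c : R) (u : ℕ → A) (k : ℕ) :
    c ^ k • ((List.range k).map u).prod = ((List.range k).map fun j => c • u j).prod := by
  induction k with
  | zero => simp
  | succ k ih => rw [List.prod_range_succ, List.prod_range_succ, ← ih, smul_mul_smul_comm, pow_succ]

theorem qpow_natCast_mul [Algebra ℚ R] {ħ : R} (hħ : IsNilpotent ħ) (a : R) (j : ℕ) :
    qpow ħ (j * a) = qpow ħ a ^ j := by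
  induction j with
  | zero => simp [qpow_zero]
  | succ j ih =>
    rw [pow_succ, ← ih, ← qpow_add hħ (Commute.all _ _)]
    congr 1; push_cast; ring

theorem qpow_smul_eq_qpow_add [Algebra ℚ R] [Algebra ℚ A] {ħ : R} (hħ : IsNilpotent ħ) (b : R)
    (a : A) : qpow ħ b • qpow ħ a = qpow ħ (b • 1 + a) := by
  have h3 : algebraMap R A (qpow ħ b) = qpow ħ (algebraMap R A b) :=
    map_qpow (RingHom.id R) (algebraMap R A) (fun r x => by simp [Algebra.smul_def]) hħ b
  rw [← Algebra.algebraMap_eq_smul_one, qpow_add hħ (Algebra.commutes b a), ← h3, Algebra.smul_def]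

variable [Algebra ℚ R] {ħ : R} [hħ : Fact (IsNilpotent ħ)]

variable (ħ) in
/-- The Cartan element `h_12^⊥ = (h_12 + 2 h_23) / 3`, which commutes with `e_12`. -/
noncomputable def Uq.hperp : Uq ħ := (1 / 3 : ℚ) • (Uq.gen ħ (.h 0) + 2 • Uq.gen ħ (.h 1))

theorem Uq.commute_hperp_e : Commute (Uq.hperp ħ) (Uq.gen ħ (.e 0)) := by
  rw [Uq.hperp]
  refine Commute.smul_left ?_ _
  rw [Commute, SemiconjBy, add_mul, mul_add, smul_mul_assoc, mul_smul_comm,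
    (Uq.gen_relations ħ).h_e 0 0, (Uq.gen_relations ħ).h_e 1 0]
  simp [cartan, two_smul]
  abel

theorem Uq.commute_hperp_h : Commute (Uq.hperp ħ) (Uq.gen ħ (.h 0)) := by
  rw [Uq.hperp]
  exact Commute.smul_left
    (Commute.add_left (Commute.refl _) (((Uq.gen_relations ħ).h_comm 1 0).smul_left _)) _

theorem Uq.comul_h (i : Fin 2) : Bialgebra.comulAlgHom R (Uq ħ) (Uq.gen ħ (.h i)) =
    Uq.gen ħ (.h i) ⊗ₜ 1 + 1 ⊗ₜ Uq.gen ħ (.h i) :=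
  Uq.liftAlg_gen _ ((Uq.gen_relations ħ).comul_relations hħ.out) _

theorem Uq.comul_e (i : Fin 2) : Bialgebra.comulAlgHom R (Uq ħ) (Uq.gen ħ (.e i)) =
    qpow ħ (-Uq.gen ħ (.h i)) ⊗ₜ Uq.gen ħ (.e i) + Uq.gen ħ (.e i) ⊗ₜ 1 :=
  Uq.liftAlg_gen _ ((Uq.gen_relations ħ).comul_relations hħ.out) _

theorem Uq.counit_gen (i : Gen) : Bialgebra.counitAlgHom R (Uq ħ) (Uq.gen ħ i) = 0 :=
  Uq.liftAlg_gen _ Uq.counit_relations _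

theorem Uq.comul_hperp : Bialgebra.comulAlgHom R (Uq ħ) (Uq.hperp ħ) =
    Uq.hperp ħ ⊗ₜ 1 + 1 ⊗ₜ Uq.hperp ħ := by
  have h : Uq.hperp ħ = algebraMap ℚ R (1 / 3) •
      (Uq.gen ħ (.h 0) + 2 • Uq.gen ħ (.h 1)) := by
    rw [Uq.hperp, algebraMap_smul]
  rw [h, _root_.map_smul, map_add, map_nsmul, Uq.comul_h, Uq.comul_h]
  simp only [← smul_tmul', tmul_smul, ← smul_add, add_tmul, tmul_add]
  congr 1
  abel

theorem Uq.counit_hperp : Bialgebra.counitAlgHom R (Uq ħ) (Uq.hperp ħ) = 0 := by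
  rw [Uq.hperp, map_rat_smul, map_add, map_nsmul, Uq.counit_gen, Uq.counit_gen]
  simp

/-- The exponent `a_j = v (2 h_12^⊥ - s h_12 + 2 j s) ⊗ 1`, for which `q ^ (2 j) (q ^ (-h_12)
q ^ (2 s⁻¹ h_12^⊥) ⊗ 1) = exp(s t a_j)` when `log q = s² t v`. -/
noncomputable def Uq.ratioExponent (ħ v s : R) [Fact (IsNilpotent ħ)] (j : ℕ) :
    Uq ħ ⊗[R] Uq ħ :=
  v • ((2 : R) • (Uq.hperp ħ ⊗ₜ 1) - s • (Uq.gen ħ (.h 0) ⊗ₜ 1) + (2 * j * s) • 1)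

/-- The computation of the twist: with `c = t s⁻¹`, `τ = s t`, `log q = s² t v = τ v s` and
`r = s⁻¹ log q = τ v`, the element `(W ⊗ W) Φ Δ(W⁻¹)` is a series without negative powers of `s`
times `Φ`. -/
theorem Uq.ratio_mul_exp_mul_comul {r c τ v s t : R} {N : ℕ} (hc : c ^ N = 0)
    (hτ : IsNilpotent τ) (h1 : ħ = τ * v * s) (h2 : r = τ * v) (h3 : c * τ = t ^ 2)
    (hQ : ∀ k, IsUnit (qFactorial (qpow ħ (2 : R)) k)) :
    powSum t N (fun k => t ^ k • (((List.range k).map fun j =>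
          -expDiv τ (Uq.ratioExponent ħ v s j)).prod *
            qDivPow (qpow ħ (2 : R)) ((1 : Uq ħ) ⊗ₜ[R] Uq.gen ħ (.e 0)) k)) *
        IsNilpotent.exp (r • (Uq.hperp ħ ⊗ₜ[R] Uq.gen ħ (.h 0))) *
        Bialgebra.comulAlgHom R (Uq ħ) (powSum c N (qDivPow (qpow ħ (2 : R)) (Uq.gen ħ (.e 0)))) =
      (powSum c N (qDivPow (qpow ħ (2 : R)) (Uq.gen ħ (.e 0))) ⊗ₜ
          powSum c N (qDivPow (qpow ħ (2 : R)) (Uq.gen ħ (.e 0)))) *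
        IsNilpotent.exp (r • (Uq.hperp ħ ⊗ₜ[R] Uq.gen ħ (.h 0))) := by
  have hr : IsNilpotent r := h2 ▸ (Commute.all τ v).isNilpotent_mul_right hτ
  set Q := qpow ħ (2 : R) with hQdef
  set e := Uq.gen ħ (.e 0) with he
  set h := Uq.gen ħ (.h 0) with hh
  set hp := Uq.hperp ħ with hhp
  set Φ := IsNilpotent.exp (r • (hp ⊗ₜ[R] h)) with hΦ
  have hpe : Commute hp e := Uq.commute_hperp_e
  have hph : Commute hp h := Uq.commute_hperp_h
  have hhe : h * e = e * h + (2 : R) • e := by simpa [cartan] using (Uq.gen_relations ħ).h_e 0 0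
  set x : Uq ħ ⊗[R] Uq ħ := e ⊗ₜ 1 with hx
  set y : Uq ħ ⊗[R] Uq ħ := 1 ⊗ₜ e with hy
  set g : Uq ħ ⊗[R] Uq ħ := qpow ħ (-h) ⊗ₜ 1 with hg
  set P : Uq ħ ⊗[R] Uq ħ := IsNilpotent.exp ((2 * r) • (hp ⊗ₜ[R] (1 : Uq ħ))) with hP
  have h2r : IsNilpotent (2 * r) := (Commute.all 2 r).isNilpotent_mul_left hr
  have hxy : Commute x y := by simp [hx, hy, Commute, SemiconjBy]
  have hgy' : Commute g y := by simp [hg, hy, Commute, SemiconjBy]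
  -- `Δ(e) = g y + x`, and `g y`, `x` commute up to `Q`, so the `q`-binomial theorem applies
  have hgx : x * (g * y) = Q • ((g * y) * x) := by
    have hke : qpow ħ (-h) * e = qpow ħ (-2 : R) • (e * qpow ħ (-h)) := by
      simpa [cartan] using (Uq.gen_relations ħ).km_e hħ.out 0 0
    have h22 : Q * qpow ħ (-2 : R) = 1 := qpow_mul_neg hħ.out 2
    simp only [hx, hy, hg, Algebra.TensorProduct.tmul_mul_tmul, mul_one, one_mul, hke,
      smul_tmul', smul_smul, h22, one_smul]
  have hΦx : Commute Φ x :=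
    (semiconjBy_exp_smul hr (by simp [hx, SemiconjBy, hpe.eq])).symm
  have hPy : Commute P y :=
    (semiconjBy_exp_smul h2r (by simp [hy, SemiconjBy])).symm
  have hΦg : Commute Φ g := by
    refine (semiconjBy_exp_smul hr ?_).symm
    have : hp * qpow ħ (-h) = qpow ħ (-h) * hp := Commute.qpow hph.neg_right
    simp [hg, SemiconjBy, this]
  have hΦP : Commute Φ P := by
    refine (semiconjBy_exp_smul hr (Commute.symm (semiconjBy_exp_smul h2r ?_))).symm
    simp [SemiconjBy]
  -- as `[h, e] = 2 e`, moving `Φ` past `1 ⊗ e` costs the factor `P = exp (2 r h^⊥ ⊗ 1)`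
  have hΦy : Φ * y = P * y * Φ := by
    have hs : SemiconjBy y (hp ⊗ₜ[R] h + (2 : R) • (hp ⊗ₜ[R] (1 : Uq ħ))) (hp ⊗ₜ[R] h) := by
      simp only [hy, SemiconjBy, mul_add, Algebra.TensorProduct.tmul_mul_tmul, one_mul, mul_one,
        hhe, tmul_add, tmul_smul, mul_smul_comm]
    have hexp := (semiconjBy_exp_smul hr hs).eq
    rw [smul_add, smul_smul, mul_comm r 2, IsNilpotent.exp_add_of_commute
      ((Commute.smul_left (by simp [Commute, SemiconjBy]) _).smul_right _)
      (isNilpotent_smul hr _) (isNilpotent_smul h2r _)] at hexp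
    rw [← hexp, hΦP.eq, ← mul_assoc, hPy.eq]
  have hGΦ : SemiconjBy Φ (g * y) (g * P * y) := by
    rw [SemiconjBy, ← mul_assoc, hΦg.eq, mul_assoc, hΦy]
    simp only [mul_assoc]
  -- with `G = g P`, the factors `1 - Q ^ j G` are divisible by `τ = s t`
  have hexpG : ∀ j : ℕ, Q ^ j • (g * P) = qpow τ (Uq.ratioExponent ħ v s j) := fun j => by
    have hg' : g = qpow ħ (-(h ⊗ₜ[R] (1 : Uq ħ))) := by
      rw [hg, ← QRelations.qpow_tmul_one hħ.out, neg_tmul]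
    rw [hQdef, ← qpow_natCast_mul hħ.out, ← smul_mul_assoc, hg', qpow_smul_eq_qpow_add hħ.out, hP,
      qpow, ← IsNilpotent.exp_add_of_commute _ (isNilpotent_smul hħ.out _)
        (isNilpotent_smul h2r _), qpow]
    · congr 1
      rw [Uq.ratioExponent, h2]
      conv_lhs => enter [1, 1]; rw [h1]
      match_scalars <;> ring
    · refine (Commute.smul_left (Commute.add_left ?_ ?_) _).smul_right _
      · exact (Commute.one_left _).smul_left _
      · refine Commute.neg_left ?_
        simp [Commute, SemiconjBy, hph.eq]
  -- as `c τ = t ^ 2`, this divisibility absorbs the negative powers of `s` in `c ^ k`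
  have hprod : ∀ k, c ^ k • (((List.range k).map fun j => 1 - Q ^ j • (g * P)).prod *
      qDivPow Q y k) = t ^ k • t ^ k • (((List.range k).map fun j =>
          -expDiv τ (Uq.ratioExponent ħ v s j)).prod * qDivPow Q y k) := fun k => by
    rw [smul_smul, ← smul_mul_assoc, ← smul_mul_assoc, ← mul_pow, ← pow_two, ← h3,
      smul_list_prod_range, smul_list_prod_range]
    congr 4
    funext j
    rw [hexpG, mul_smul, smul_neg, smul_expDiv hτ, neg_sub]
  have hsum : powSum t N (fun k => t ^ k • (((List.range k).map fun j =>
          -expDiv τ (Uq.ratioExponent ħ v s j)).prod * qDivPow Q y k)) =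
      powSum c N fun k => ((List.range k).map fun j => 1 - Q ^ j • (g * P)).prod * qDivPow Q y k :=
    Finset.sum_congr rfl fun k _ => (hprod k).symm
  have hG : Commute (g * P) y := hgy'.mul_left hPy
  have hΔ : Bialgebra.comulAlgHom R (Uq ħ) (powSum c N (qDivPow Q e)) =
      powSum c N (qDivPow Q (g * y + x)) := by
    have hgyx : g * y + x = Bialgebra.comulAlgHom R (Uq ħ) e := by
      rw [he, Uq.comul_e, hg, hy, hx]; simp [he, hh]
    rw [hgyx]
    simp only [powSum, qDivPow, map_sum, _root_.map_smul, map_pow]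
  have hleft : powSum c N (qDivPow Q x) = powSum c N (qDivPow Q e) ⊗ₜ[R] (1 : Uq ħ) := by
    simp only [powSum, qDivPow, sum_tmul, ← smul_tmul', hx, Algebra.TensorProduct.tmul_pow, one_pow]
  have hright : powSum c N (qDivPow Q y) = (1 : Uq ħ) ⊗ₜ[R] powSum c N (qDivPow Q e) := by
    simp only [powSum, qDivPow, tmul_sum, tmul_smul, hy, Algebra.TensorProduct.tmul_pow, one_pow]
  rw [hsum, hΔ, powSum_qPochhammer_mul_comm hQ hc hgx hxy hΦx hG hGΦ, hleft, hright]
  simp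

end NilpotentParameter

/-! ### Series in the completed algebras -/

section Completed

section InvLim

variable {K : Type} [CommRing K] {A : ℕ → Type} [∀ n, Ring (A n)]
    [∀ n, Algebra (LevelRing K n) (A n)] {π : ∀ n, A (n + 1) →+* A n}

theorem toLevel_pow_eq_zero {c : K⟦X⟧} (hc : constantCoeff c = 0) (n : ℕ) :
    toLevel n c ^ n = 0 := by
  rw [← map_pow]
  exact toLevel_eq_zero (pow_dvd_pow_of_dvd (X_dvd_iff.2 hc) n)

theorem invLim.isUnit_of_forall {x : invLim π} (h : ∀ n, IsUnit (x.1 n)) : IsUnit x := by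
  refine ⟨⟨x, ⟨fun n => Ring.inverse (x.1 n), fun n => ?_⟩, Subtype.ext (funext fun n =>
    Ring.mul_inverse_cancel _ (h n)), Subtype.ext (funext fun n =>
    Ring.inverse_mul_cancel _ (h n))⟩, rfl⟩
  refine left_inv_eq_right_inv (a := x.1 n) ?_ (Ring.mul_inverse_cancel _ (h n))
  rw [← x.2 n, ← map_mul, Ring.inverse_mul_cancel _ (h (n + 1)), map_one]

variable [Algebra ℚ K]

theorem isUnit_natCast_factorial {S : Type} [CommRing S] [Algebra ℚ S] (k : ℕ) :
    IsUnit (k.factorial : S) := by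
  have := (IsUnit.mk0 (k.factorial : ℚ) (by positivity)).map (algebraMap ℚ S)
  simpa using this

theorem isUnit_qFactorial {Q : K⟦X⟧} (hQ : constantCoeff Q = 1) (k : ℕ) :
    IsUnit (qFactorial Q k) := by
  rw [isUnit_iff_constantCoeff, map_qFactorial, hQ, qFactorial_one]
  exact isUnit_natCast_factorial k

theorem invLim.qExp_apply (hπ : ∀ n r x, π n (r • x) = levelTrans K n r • π n x) {Q c : K⟦X⟧}
    (hQ : constantCoeff Q = 1) (hc : constantCoeff c = 0) (x : invLim π) (n : ℕ) :
    (invLim.qExp hπ Q c hc x).1 n = powSum (toLevel n c) n (qDivPow (toLevel n Q) (x.1 n)) := by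
  change ∑ k ∈ Finset.range n, toLevel n (c ^ k * Ring.inverse (qFactorial Q k)) • x.1 n ^ k = _
  refine Finset.sum_congr rfl fun k _ => ?_
  rw [map_mul, map_pow, map_ringInverse_of_isUnit _ (isUnit_qFactorial hQ k), map_qFactorial,
    mul_smul, qDivPow]

theorem FormalParameter.toLevel_q (p : FormalParameter K) (n : ℕ) :
    toLevel n p.q = qpow (p.level n) 1 := by
  conv_lhs => rw [← subst_logOf_exp p.constantCoeff_q]
  have hn : p.level n ^ n = 0 := toLevel_pow_eq_zero p.constantCoeff_hbar n
  rw [toLevel_subst (constantCoeff_logOf p.constantCoeff_q), qpow, exp_smul_eq_powSum hn]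
  refine Finset.sum_congr rfl fun k _ => ?_
  have h : toLevel n (C (coeff k (PowerSeries.exp K))) =
      algebraMap ℚ (LevelRing K n) (k.factorial : ℚ)⁻¹ := by
    rw [coeff_exp, one_div]
    exact RingHom.map_rat_algebraMap ((toLevel n).comp C) _
  beta_reduce
  rw [h, one_pow, ← Algebra.algebraMap_eq_smul_one, smul_eq_mul, mul_comm]
  rfl

theorem FormalParameter.toLevel_q_sq (p : FormalParameter K) (n : ℕ) :
    toLevel n (p.q ^ 2) = qpow (p.level n) 2 := by
  rw [map_pow, p.toLevel_q, ← qpow_natCast_mul Fact.out]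
  norm_num

theorem FormalParameter.constantCoeff_q_sq (p : FormalParameter K) :
    constantCoeff (p.q ^ 2) = 1 := by
  rw [map_pow, p.constantCoeff_q, one_pow]

theorem FormalParameter.isUnit_qFactorial_qpow (p : FormalParameter K) (n k : ℕ) :
    IsUnit (qFactorial (qpow (p.level n) (2 : LevelRing K n)) k) := by
  rw [← p.toLevel_q_sq, ← map_qFactorial]
  exact (isUnit_qFactorial p.constantCoeff_q_sq k).map _

end InvLim

namespace UHat₂

variable {K : Type} [CommRing K] [Algebra ℚ K] (p : FormalParameter K)

/-- The series `∑ c ^ k u_k` in the completed tensor square, for `c ∈ t K⟦t⟧`. -/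
noncomputable def series (c : K⟦X⟧) (hc : constantCoeff c = 0) (u : ℕ → UHat₂ p) : UHat₂ p :=
  ⟨fun n => powSum (toLevel n c) n fun k => (u k).1 n, fun n => by
    rw [map_powSum (levelTrans K n) (ULevel₂.trans p n) (ULevel₂.trans_smul p n), powSum,
      Finset.sum_range_succ, levelTrans_toLevel, toLevel_pow_eq_zero hc, zero_smul, add_zero]
    exact Finset.sum_congr rfl fun k _ => by rw [(u k).2 n]⟩

variable {p} in
@[ext] theorem ext {x y : UHat₂ p} (h : ∀ n, x.1 n = y.1 n) : x = y := Subtype.ext (funext h)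

theorem scalar_apply (c : K⟦X⟧) (n : ℕ) :
    (scalar p c).1 n = algebraMap (LevelRing K n) (ULevel₂ p n) (toLevel n c) := rfl

theorem scalar_mul_apply (c : K⟦X⟧) (x : UHat₂ p) (n : ℕ) :
    (scalar p c * x).1 n = toLevel n c • x.1 n :=
  (Algebra.smul_def _ _).symm

theorem commute_scalar (c : K⟦X⟧) (x : UHat₂ p) : Commute (scalar p c) x :=
  ext fun n => Algebra.commutes (toLevel n c) (x.1 n)

variable {p} in
theorem mul_apply (x y : UHat₂ p) (n : ℕ) : (x * y).1 n = x.1 n * y.1 n := rfl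

variable {p} in
theorem tmul_apply (x y : UHat p) (n : ℕ) :
    (UHat.tmul p x y).1 n = x.1 n ⊗ₜ[LevelRing K n] y.1 n := rfl

theorem scalar_mul (c d : K⟦X⟧) : scalar p (c * d) = scalar p c * scalar p d :=
  ext fun n => by rw [scalar_mul_apply, scalar_apply, scalar_apply, map_mul, map_mul,
    Algebra.smul_def]

theorem scalar_sub (c d : K⟦X⟧) : scalar p (c - d) = scalar p c - scalar p d :=
  ext fun n => by
    change _ = (scalar p c).1 n - (scalar p d).1 n
    rw [scalar_apply, scalar_apply, scalar_apply, map_sub, map_sub]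

theorem scalar_one : scalar p 1 = 1 :=
  ext fun n => by
    rw [scalar_apply, map_one, map_one]
    rfl

theorem series_apply (c : K⟦X⟧) (hc : constantCoeff c = 0) (u : ℕ → UHat₂ p) (n : ℕ) :
    (series p c hc u).1 n = powSum (toLevel n c) n fun k => (u k).1 n := rfl

variable {p}

theorem scalar_dvd_scalar {c d : K⟦X⟧} (h : c ∣ d) : scalar p c ∣ scalar p d := by
  obtain ⟨e, rfl⟩ := h
  exact ⟨scalar p e, scalar_mul p c e⟩

theorem series_eq_add {c : K⟦X⟧} (hc : constantCoeff c = 0) (u : ℕ → UHat₂ p) :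
    series p c hc u = u 0 + scalar p c * series p c hc fun k => u (k + 1) :=
  Subtype.ext (funext fun n => by
    change _ = (u 0).1 n + (scalar p c * _).1 n
    rw [scalar_mul_apply]
    exact powSum_eq_add (toLevel_pow_eq_zero hc n) _)

/-- Congruences modulo a scalar may be checked on the coefficients of a series. -/
theorem scalar_dvd_series_sub {c z : K⟦X⟧} (hc : constantCoeff c = 0) {u v : ℕ → UHat₂ p}
    (h : ∀ k, scalar p z ∣ u k - v k) : scalar p z ∣ series p c hc u - series p c hc v := by
  choose d hd using h
  refine ⟨series p c hc d, Subtype.ext (funext fun n => ?_)⟩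
  rw [scalar_mul_apply]
  change powSum (toLevel n c) n (fun k => (u k).1 n) - powSum (toLevel n c) n (fun k => (v k).1 n) =
    toLevel n z • powSum (toLevel n c) n fun k => (d k).1 n
  rw [powSum, powSum, powSum, ← Finset.sum_sub_distrib, Finset.smul_sum]
  refine Finset.sum_congr rfl fun k _ => ?_
  rw [← smul_sub, smul_comm, ← scalar_mul_apply, ← hd]
  rfl

theorem scalar_dvd_mul_sub_mul {z : K⟦X⟧} {x x' y y' : UHat₂ p} (hx : scalar p z ∣ x - x')
    (hy : scalar p z ∣ y - y') : scalar p z ∣ x * y - x' * y' := by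
  have h : x * y - x' * y' = (x - x') * y + x' * (y - y') := by noncomm_ring
  obtain ⟨d, hd⟩ := hy
  rw [h, hd, ← mul_assoc, ← (commute_scalar p z x').eq, mul_assoc]
  exact dvd_add (hx.mul_right _) (dvd_mul_right _ _)

theorem scalar_dvd_list_prod_sub_pow {z : K⟦X⟧} {x : ℕ → UHat₂ p} {y : UHat₂ p}
    (h : ∀ j, scalar p z ∣ x j - y) (k : ℕ) :
    scalar p z ∣ ((List.range k).map x).prod - y ^ k := by
  induction k with
  | zero => simp
  | succ k ih =>
    rw [List.prod_range_succ, pow_succ]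
    exact scalar_dvd_mul_sub_mul ih (h k)

theorem scalar_dvd_sub_trans {z : K⟦X⟧} {x y w : UHat₂ p} (h : scalar p z ∣ x - y)
    (h' : scalar p z ∣ y - w) : scalar p z ∣ x - w := by
  have := dvd_add h h'
  rwa [sub_add_sub_cancel] at this

variable (p)

/-- The rational constant `a` as a scalar. -/
noncomputable def ratScalar (a : ℚ) : UHat₂ p := scalar p (C (algebraMap ℚ K a))

theorem ratScalar_mul_apply (a : ℚ) (x : UHat₂ p) (n : ℕ) :
    (ratScalar p a * x).1 n = a • x.1 n := by
  have h : toLevel n (C (algebraMap ℚ K a)) = algebraMap ℚ (LevelRing K n) a :=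
    RingHom.map_rat_algebraMap ((toLevel n).comp C) _
  rw [ratScalar, scalar_mul_apply, h, algebraMap_smul]

theorem ratScalar_one : ratScalar p 1 = 1 := by
  rw [ratScalar, map_one, map_one, scalar_one]

theorem exp_eq_series {c : K⟦X⟧} (hc : constantCoeff c = 0) (x : UHat₂ p) :
    invLim.exp (ULevel₂.trans_smul p) c hc x =
      series p c hc fun k => ratScalar p (k.factorial : ℚ)⁻¹ * x ^ k :=
  ext fun n => (exp_smul_eq_powSum (toLevel_pow_eq_zero hc n) (x.1 n)).trans
    (powSum_congr_right fun k => (ratScalar_mul_apply p _ (x ^ k) n).symm)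

/-- The element `(exp(c x) - 1) / c` of the completed tensor square. -/
noncomputable def expDiv (c : K⟦X⟧) (hc : constantCoeff c = 0) (x : UHat₂ p) : UHat₂ p :=
  series p c hc fun k => ratScalar p ((k + 1).factorial : ℚ)⁻¹ * x ^ (k + 1)

theorem expDiv_apply {c : K⟦X⟧} (hc : constantCoeff c = 0) (x : UHat₂ p) (n : ℕ) :
    (expDiv p c hc x).1 n = QSl3.expDiv (toLevel n c) (x.1 n) := by
  rw [expDiv_eq_powSum (toLevel_pow_eq_zero hc n)]
  exact powSum_congr_right fun k => ratScalar_mul_apply p _ _ n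

theorem scalar_dvd_expDiv_sub {c : K⟦X⟧} (hc : constantCoeff c = 0) (x : UHat₂ p) :
    scalar p c ∣ expDiv p c hc x - x := by
  rw [expDiv, series_eq_add]
  simp only [zero_add, Nat.factorial_one, Nat.cast_one, inv_one, ratScalar_one, pow_one, one_mul,
    add_sub_cancel_left]
  exact dvd_mul_right _ _

/-! ### The twist without negative powers of `s` -/

variable {s : K} {v : K⟦X⟧}

variable (s v) in
/-- The exponents `v (2 h_12^⊥ - s h_12 + 2 j s) ⊗ 1` in the completed tensor square. -/
noncomputable def ratioExponent (j : ℕ) : UHat₂ p :=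
  scalar p v * (scalar p 2 * UHat.tmul p (UHat.hperp p) 1 -
    scalar p (C s) * UHat.tmul p (UHat.gen p (.h 0)) 1 + scalar p (2 * j * C s))

theorem ratioExponent_apply (j n : ℕ) : (ratioExponent p s v j).1 n =
    Uq.ratioExponent (p.level n) (toLevel n v) (toLevel n (C s)) j := by
  rw [ratioExponent, scalar_mul_apply, Uq.ratioExponent]
  congr 1
  change (scalar p 2 * _).1 n - (scalar p (C s) * _).1 n + (scalar p (2 * j * C s)).1 n = _
  rw [scalar_mul_apply, scalar_mul_apply, map_ofNat]
  congr 1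
  rw [scalar_apply, Algebra.algebraMap_eq_smul_one, map_mul, map_mul, map_ofNat, map_natCast]

variable (s v) in
/-- The coefficients of `exp_{q²}(t s⁻¹ e_12) / exp_{q²}(t s⁻¹ g e_12)` as a series in `t`, where
`g = q ^ (-h_12 + 2 s⁻¹ h_12^⊥) ⊗ 1` and `e_12` is in the second factor. -/
noncomputable def ratioCoeff (k : ℕ) : UHat₂ p :=
  scalar p (X ^ k) * (((List.range k).map fun j =>
    -expDiv p (C s * X) (by simp) (ratioExponent p s v j)).prod *
      (scalar p (Ring.inverse (qFactorial (p.q ^ 2) k)) * UHat.tmul p 1 (UHat.gen p (.e 0)) ^ k))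

variable (s v) in
/-- The twist `F_q`, written without negative powers of `s`, for `log q = s² t v`. -/
noncomputable def integralTwist : UHat₂ p :=
  series p X (by simp) (ratioCoeff p s v) *
    invLim.exp (ULevel₂.trans_smul p) (C s * X * v) (by simp)
      (UHat.tmul p (UHat.hperp p) (UHat.gen p (.h 0)))

theorem ratioCoeff_apply (k n : ℕ) : (ratioCoeff p s v k).1 n =
    toLevel n (X : K⟦X⟧) ^ k • (((List.range k).map fun j => -QSl3.expDiv (toLevel n (C s * X))
      (Uq.ratioExponent (p.level n) (toLevel n v) (toLevel n (C s)) j)).prod *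
        qDivPow (qpow (p.level n) (2 : LevelRing K n)) (1 ⊗ₜ Uq.gen (p.level n) (.e 0)) k) := by
  have hprod : ∀ (u : ℕ → UHat₂ p), ((List.range k).map u).prod.1 n =
      ((List.range k).map fun j => (u j).1 n).prod := fun u => by
    let ev : UHat₂ p →+* ULevel₂ p n :=
      (Pi.evalRingHom (fun n => ULevel₂ p n) n).comp (invLim (ULevel₂.trans p)).subtype
    exact (map_list_prod ev ((List.range k).map u)).trans (by rw [List.map_map]; rfl)
  rw [ratioCoeff, scalar_mul_apply, map_pow, mul_apply, hprod, scalar_mul_apply,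
    map_ringInverse_of_isUnit _ (isUnit_qFactorial p.constantCoeff_q_sq k), map_qFactorial,
    p.toLevel_q_sq, qDivPow]
  congr 4
  funext j
  rw [← ratioExponent_apply, ← expDiv_apply _ (by simp)]
  rfl

theorem integralTwist_apply (n : ℕ) : (integralTwist p s v).1 n =
    powSum (toLevel n (X : K⟦X⟧)) n (fun k =>
      toLevel n (X : K⟦X⟧) ^ k • (((List.range k).map fun j => -QSl3.expDiv (toLevel n (C s * X))
        (Uq.ratioExponent (p.level n) (toLevel n v) (toLevel n (C s)) j)).prod *
          qDivPow (qpow (p.level n) (2 : LevelRing K n)) (1 ⊗ₜ Uq.gen (p.level n) (.e 0)) k)) *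
      IsNilpotent.exp (toLevel n (C s * X * v) •
        (Uq.hperp (p.level n) ⊗ₜ[LevelRing K n] Uq.gen (p.level n) (.h 0))) := by
  rw [integralTwist, mul_apply, series_apply, powSum_congr_right fun k => ratioCoeff_apply p k n]
  rfl

/-- For invertible `s` with inverse `a`, the equation `F Δ(W) = (W ⊗ W) q ^ (a h_12^⊥ ⊗ h_12)`
that characterises `F_q`. -/
theorem integralTwist_apply_mul_comul {a : K} (has : a * s = 1)
    (hbar : p.hbar = C s ^ 2 * X * v) (n : ℕ) :
    (integralTwist p s v).1 n * Bialgebra.comulAlgHom (LevelRing K n) (ULevel p n)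
        (powSum (toLevel n (C a * X)) n
          (qDivPow (qpow (p.level n) (2 : LevelRing K n)) (Uq.gen (p.level n) (.e 0)))) =
      (powSum (toLevel n (C a * X)) n
          (qDivPow (qpow (p.level n) (2 : LevelRing K n)) (Uq.gen (p.level n) (.e 0))) ⊗ₜ
        powSum (toLevel n (C a * X)) n
          (qDivPow (qpow (p.level n) (2 : LevelRing K n)) (Uq.gen (p.level n) (.e 0)))) *
        IsNilpotent.exp (toLevel n (C a * p.hbar) •
          (Uq.hperp (p.level n) ⊗ₜ[LevelRing K n] Uq.gen (p.level n) (.h 0))) := by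
  have hC : C a * C s = (1 : K⟦X⟧) := by rw [← map_mul, has, map_one]
  have hr : C a * p.hbar = C s * X * v := by
    rw [hbar]; linear_combination (C s * X * v) * hC
  have hX : C a * X * (C s * X) = (X : K⟦X⟧) ^ 2 := by linear_combination X ^ 2 * hC
  have hl : p.hbar = C s * X * v * C s := by rw [hbar]; ring
  have h1 : p.level n = toLevel n (C s * X) * toLevel n v * toLevel n (C s) := by
    rw [← map_mul, ← map_mul, ← hl, FormalParameter.level]
  have h2 : toLevel n (C a * p.hbar) = toLevel n (C s * X) * toLevel n v := by
    rw [← map_mul, hr]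
  have h3 : toLevel n (C a * X) * toLevel n (C s * X) = toLevel n X ^ 2 := by
    rw [← map_mul, ← map_pow, hX]
  have hc : toLevel n (C a * X) ^ n = 0 := toLevel_pow_eq_zero (by simp) n
  have hτ : IsNilpotent (toLevel n (C s * X)) := toLevel_isNilpotent (by simp) n
  have key := Uq.ratio_mul_exp_mul_comul hc hτ h1 h2 h3 (p.isUnit_qFactorial_qpow n)
  rw [hr] at key ⊢
  rw [integralTwist_apply]
  exact key

section Congruence

theorem dvd_inverse_qFactorial_sub {Q c : K⟦X⟧} (hQ : constantCoeff Q = 1) (h : c ∣ Q - 1) (k : ℕ) :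
    c ∣ Ring.inverse (qFactorial Q k) - C (algebraMap ℚ K (k.factorial : ℚ)⁻¹) := by
  rw [← Ideal.mem_span_singleton, ← Ideal.Quotient.eq]
  have h1 : Ideal.Quotient.mk (Ideal.span {c}) Q = 1 := by
    rw [← map_one (Ideal.Quotient.mk (Ideal.span {c})), Ideal.Quotient.eq,
      Ideal.mem_span_singleton]
    exact h
  have h2 : C (algebraMap ℚ K (k.factorial : ℚ)⁻¹) = Ring.inverse (k.factorial : K⟦X⟧) := by
    refine left_inv_eq_right_inv (a := (k.factorial : K⟦X⟧)) ?_
      (Ring.mul_inverse_cancel _ (isUnit_natCast_factorial k))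
    have h3 : (k.factorial : K⟦X⟧) = C (algebraMap ℚ K (k.factorial : ℚ)) := by simp
    rw [h3, ← map_mul, ← map_mul, inv_mul_cancel₀ (by positivity), map_one, map_one]
  rw [h2, map_ringInverse_of_isUnit _ (isUnit_qFactorial hQ k), map_qFactorial, h1, qFactorial_one,
    map_ringInverse_of_isUnit _ (isUnit_natCast_factorial k), map_natCast]

theorem scalar_dvd_ratioExponent_sub (hv : C s ∣ v - 1) (j : ℕ) :
    scalar p (C s) ∣ ratioExponent p s v j - scalar p 2 * UHat.tmul p (UHat.hperp p) 1 := by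
  have h1 : scalar p (C s) ∣ scalar p v - 1 := by
    rw [← scalar_one, ← scalar_sub]; exact scalar_dvd_scalar hv
  rw [ratioExponent, ← one_mul (scalar p 2 * UHat.tmul p (UHat.hperp p) 1)]
  refine scalar_dvd_mul_sub_mul h1 ?_
  rw [one_mul, add_sub_right_comm, sub_sub_cancel_left]
  exact dvd_add (dvd_neg.2 (dvd_mul_right _ _)) (scalar_dvd_scalar (dvd_mul_left _ _))

/-- The constant term in `s` of `ratioCoeff`, up to the power of `t`: the factors `-expDiv (s t) a_j`
are congruent to `-2 h_12^⊥ ⊗ 1` and `(k)_{q²}!` is congruent to `k!`. -/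
theorem scalar_dvd_ratioCoeff_sub (hv : C s ∣ v - 1) (hq : C s ∣ p.q ^ 2 - 1) (k : ℕ) :
    scalar p (C s * X) ∣ ratioCoeff p s v k - scalar p (X ^ k) *
      (ratScalar p (k.factorial : ℚ)⁻¹ *
        (scalar p (-2) * UHat.tmul p (UHat.hperp p) (UHat.gen p (.e 0))) ^ k) := by
  set a := UHat.tmul p (UHat.hperp p) 1 with ha
  set b := UHat.tmul p 1 (UHat.gen p (.e 0)) with hb
  have hab : UHat.tmul p (UHat.hperp p) (UHat.gen p (.e 0)) = a * b :=
    ext fun n => by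
      rw [mul_apply, ha, hb, tmul_apply, tmul_apply, tmul_apply,
        Algebra.TensorProduct.tmul_mul_tmul]
      exact (congrArg₂ _ (mul_one _) (one_mul _)).symm
  have hcomm : Commute a b := ext fun n => by
    rw [mul_apply, mul_apply, ha, hb, tmul_apply, tmul_apply,
      Algebra.TensorProduct.tmul_mul_tmul, Algebra.TensorProduct.tmul_mul_tmul]
    exact congrArg₂ _ (Commute.one_right _) (Commute.one_left _)
  have hfac : ∀ j, scalar p (C s) ∣
      -expDiv p (C s * X) (by simp) (ratioExponent p s v j) - scalar p (-2) * a := fun j => by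
    have h1 : scalar p (C s) ∣ expDiv p (C s * X) (by simp) (ratioExponent p s v j) -
        ratioExponent p s v j :=
      (scalar_dvd_scalar (dvd_mul_right _ _)).trans (scalar_dvd_expDiv_sub p _ _)
    have h2 := scalar_dvd_sub_trans h1 (scalar_dvd_ratioExponent_sub p hv j)
    have h3 : scalar p (-2) = -scalar p 2 := by
      rw [← zero_sub (2 : K⟦X⟧), scalar_sub, sub_eq_neg_self]
      simpa using scalar_sub p 0 0
    rw [h3, neg_mul, neg_sub_neg, ← neg_sub]
    exact dvd_neg.2 h2
  have key : scalar p (C s) ∣ (((List.range k).map fun j =>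
      -expDiv p (C s * X) (by simp) (ratioExponent p s v j)).prod *
        (scalar p (Ring.inverse (qFactorial (p.q ^ 2) k)) * b ^ k)) -
      (scalar p (-2) * a) ^ k * (ratScalar p (k.factorial : ℚ)⁻¹ * b ^ k) := by
    refine scalar_dvd_mul_sub_mul (scalar_dvd_list_prod_sub_pow hfac k)
      (scalar_dvd_mul_sub_mul ?_ (by simp))
    rw [ratScalar, ← scalar_sub]
    exact scalar_dvd_scalar (dvd_inverse_qFactorial_sub p.constantCoeff_q_sq hq k)
  have hpow : (scalar p (-2) * a) ^ k * (ratScalar p (k.factorial : ℚ)⁻¹ * b ^ k) =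
      ratScalar p (k.factorial : ℚ)⁻¹ *
        (scalar p (-2) * UHat.tmul p (UHat.hperp p) (UHat.gen p (.e 0))) ^ k := by
    rw [hab, ← mul_assoc (scalar p (-2)),
      ((commute_scalar p (-2) b).mul_left hcomm).mul_pow, ← mul_assoc, ← mul_assoc]
    congr 1
    exact (commute_scalar p _ _).symm
  rw [hpow] at key
  cases k with
  | zero =>
    rw [ratioCoeff]
    simp [qFactorial_zero, scalar_one, ratScalar_one]
  | succ k =>
    obtain ⟨d, hd⟩ := key
    refine ⟨scalar p (X ^ k) * d, ?_⟩
    rw [ratioCoeff, ← mul_sub, hd, ← mul_assoc, ← mul_assoc, ← scalar_mul, ← scalar_mul]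
    congr 2
    ring

theorem exp_eq_series_X (b : K) (x : UHat₂ p) :
    invLim.exp (ULevel₂.trans_smul p) (C b * X ^ 2) (by simp) x =
      series p X (by simp) fun k => scalar p (X ^ k) *
        (ratScalar p (k.factorial : ℚ)⁻¹ * (scalar p (C b) * x) ^ k) := by
  rw [exp_eq_series]
  refine ext fun n => ?_
  rw [series_apply, series_apply]
  have h : ∀ k, (scalar p (C b)) ^ k = scalar p (C b ^ k) := fun k => by
    induction k with
    | zero => rw [pow_zero, pow_zero, scalar_one]
    | succ k ih => rw [pow_succ, ih, pow_succ, scalar_mul]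
  refine Finset.sum_congr rfl fun k _ => ?_
  beta_reduce
  rw [scalar_mul_apply, ratScalar_mul_apply, ratScalar_mul_apply,
    (commute_scalar p (C b) x).mul_pow, h, scalar_mul_apply, smul_comm (_ : ℚ) (_ : LevelRing K n),
    smul_smul, smul_smul]
  congr 1
  simp only [map_pow, map_mul]
  ring

/-- The twist is congruent to `exp(-2 t² h_12^⊥ ⊗ e_12)` modulo `s t`. -/
theorem scalar_dvd_integralTwist_sub (hv : C s ∣ v - 1) (hq : C s ∣ p.q ^ 2 - 1) :
    scalar p (C s * X) ∣ integralTwist p s v -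
      invLim.exp (ULevel₂.trans_smul p) (-2 * X ^ 2) (by simp)
        (UHat.tmul p (UHat.hperp p) (UHat.gen p (.e 0))) := by
  have h2 : (C (-2) : K⟦X⟧) = -2 := by rw [map_neg, map_ofNat]
  have h := exp_eq_series_X p (-2) (UHat.tmul p (UHat.hperp p) (UHat.gen p (.e 0)))
  simp only [h2] at h
  rw [h, integralTwist, ← mul_one (series p X _ fun k => scalar p (X ^ k) * _)]
  refine scalar_dvd_mul_sub_mul
    (scalar_dvd_series_sub _ fun k => scalar_dvd_ratioCoeff_sub p hv hq k) ?_
  rw [exp_eq_series, series_eq_add]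
  simp only [Nat.factorial_zero, Nat.cast_one, inv_one, ratScalar_one, pow_zero, mul_one,
    add_sub_cancel_left]
  exact Dvd.dvd.mul_right (scalar_dvd_scalar (dvd_mul_right _ _)) _

end Congruence

end UHat₂

end Completed

/-! ### Change of coefficients -/

section Functoriality

namespace UHat₂

variable {K K' : Type} [CommRing K] [Algebra ℚ K] [CommRing K'] [Algebra ℚ K']
  (p : FormalParameter K) (f : K →+* K')

theorem baseChange_apply (x : UHat₂ p) (n : ℕ) : (baseChange p f x).1 n =
    Uq.map₂ (levelMap f n) (p.levelMap_level f n) (x.1 n) := rfl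

theorem baseChange_scalar (c : K⟦X⟧) :
    baseChange p f (scalar p c) = scalar (p.map f) (PowerSeries.map f c) :=
  ext fun n => by
    rw [baseChange_apply, scalar_apply, scalar_apply, ← levelMap_toLevel]
    exact tensorMap_algebraMap _ _ _ _ _ _

theorem baseChange_ratScalar (a : ℚ) :
    baseChange p f (ratScalar p a) = ratScalar (p.map f) a := by
  rw [ratScalar, baseChange_scalar, map_C, RingHom.map_rat_algebraMap, ratScalar]

theorem baseChange_series {c : K⟦X⟧} {c' : K'⟦X⟧} (hc : constantCoeff c = 0)
    (hc' : constantCoeff c' = 0) (h : PowerSeries.map f c = c') (u : ℕ → UHat₂ p) :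
    baseChange p f (series p c hc u) = series (p.map f) c' hc' fun k => baseChange p f (u k) :=
  ext fun n => by
    rw [baseChange_apply, series_apply, series_apply,
      map_powSum (levelMap f n) (Uq.map₂ _ _) (Uq.map₂_smul _ _), levelMap_toLevel, h]
    rfl

theorem baseChange_exp {c : K⟦X⟧} {c' : K'⟦X⟧} (hc : constantCoeff c = 0)
    (hc' : constantCoeff c' = 0) (h : PowerSeries.map f c = c') (x : UHat₂ p) :
    baseChange p f (invLim.exp (ULevel₂.trans_smul p) c hc x) =
      invLim.exp (ULevel₂.trans_smul (p.map f)) c' hc' (baseChange p f x) := by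
  simp only [exp_eq_series, baseChange_series p f hc hc' h, map_mul, map_pow, baseChange_ratScalar]

theorem baseChange_expDiv {c : K⟦X⟧} {c' : K'⟦X⟧} (hc : constantCoeff c = 0)
    (hc' : constantCoeff c' = 0) (h : PowerSeries.map f c = c') (x : UHat₂ p) :
    baseChange p f (expDiv p c hc x) = expDiv (p.map f) c' hc' (baseChange p f x) := by
  simp only [expDiv, baseChange_series p f hc hc' h, map_mul, map_pow, baseChange_ratScalar]

theorem baseChange_tmul {x y : UHat p} {x' y' : UHat (p.map f)}
    (hx : ∀ n, Uq.map (levelMap f n) (p.levelMap_level f n) (x.1 n) = x'.1 n)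
    (hy : ∀ n, Uq.map (levelMap f n) (p.levelMap_level f n) (y.1 n) = y'.1 n) :
    baseChange p f (UHat.tmul p x y) = UHat.tmul (p.map f) x' y' :=
  ext fun n => by
    rw [baseChange_apply, tmul_apply, tmul_apply, ← hx, ← hy]
    exact tensorMap_tmul _ _ _ (Uq.map_algebraMap _ _) (Uq.map_algebraMap _ _) _ _

theorem map_gen_apply (i : Gen) (n : ℕ) : Uq.map (levelMap f n) (p.levelMap_level f n)
    ((UHat.gen p i).1 n) = (UHat.gen (p.map f) i).1 n :=
  Uq.map_gen _ _ i

theorem map_one_apply (n : ℕ) : Uq.map (levelMap f n) (p.levelMap_level f n)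
    ((1 : UHat p).1 n) = (1 : UHat (p.map f)).1 n :=
  map_one _

theorem map_hperp_apply (n : ℕ) : Uq.map (levelMap f n) (p.levelMap_level f n)
    ((UHat.hperp p).1 n) = (UHat.hperp (p.map f)).1 n := by
  change Uq.map _ _ ((1 / 3 : ℚ) • (Uq.gen _ (.h 0) + 2 • Uq.gen _ (.h 1))) =
    (1 / 3 : ℚ) • (Uq.gen _ (.h 0) + 2 • Uq.gen _ (.h 1))
  rw [map_rat_smul, map_add, map_nsmul, Uq.map_gen, Uq.map_gen]

theorem baseChange_ratioExponent (s : K) (v : K⟦X⟧) (j : ℕ) :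
    baseChange p f (ratioExponent p s v j) =
      ratioExponent (p.map f) (f s) (PowerSeries.map f v) j := by
  simp only [ratioExponent, map_mul, map_add, map_sub, baseChange_scalar, map_ofNat, map_natCast,
    map_C, baseChange_tmul p f (map_hperp_apply p f) (map_one_apply p f),
    baseChange_tmul p f (map_gen_apply p f (.h 0)) (map_one_apply p f)]

theorem baseChange_ratioCoeff (s : K) (v : K⟦X⟧) (k : ℕ) :
    baseChange p f (ratioCoeff p s v k) =
      ratioCoeff (p.map f) (f s) (PowerSeries.map f v) k := by
  have hq : PowerSeries.map f (Ring.inverse (qFactorial (p.q ^ 2) k)) =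
      Ring.inverse (qFactorial ((p.map f).q ^ 2) k) := by
    rw [map_ringInverse_of_isUnit _ (isUnit_qFactorial p.constantCoeff_q_sq k), map_qFactorial,
      map_pow]
    rfl
  rw [ratioCoeff, ratioCoeff, map_mul, map_mul, map_mul, map_list_prod, List.map_map, map_pow,
    baseChange_scalar, baseChange_scalar, hq, map_pow, map_X,
    baseChange_tmul p f (map_one_apply p f) (map_gen_apply p f (.e 0))]
  congr 4
  funext j
  rw [Function.comp_apply, map_neg,
    baseChange_expDiv p f (c' := C (f s) * X) _ (by simp) (by rw [map_mul, map_C, map_X]),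
    baseChange_ratioExponent]

theorem baseChange_integralTwist (s : K) (v : K⟦X⟧) :
    baseChange p f (integralTwist p s v) =
      integralTwist (p.map f) (f s) (PowerSeries.map f v) := by
  rw [integralTwist, integralTwist, map_mul, baseChange_series p f _ (by simp) (map_X f),
    baseChange_exp p f (c' := C (f s) * X * PowerSeries.map f v) _ (by simp)
      (by rw [map_mul, map_mul, map_C, map_X]),
    baseChange_tmul p f (map_hperp_apply p f) (map_gen_apply p f (.h 0))]
  simp only [baseChange_ratioCoeff]

end UHat₂

end Functoriality

/-! ### The twist over Laurent series -/

section Laurent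

variable (p : FormalParameter (LaurentSeries ℂ))

theorem twistW_apply (n : ℕ) : (twistW p).1 n =
    powSum (toLevel n (C sInv * X)) n
      (qDivPow (qpow (p.level n) (2 : LevelRing (LaurentSeries ℂ) n))
        (Uq.gen (p.level n) (.e 0))) := by
  rw [twistW, invLim.qExp_apply _ p.constantCoeff_q_sq, p.toLevel_q_sq]
  rfl

theorem isUnit_twistW : IsUnit (twistW p) :=
  invLim.isUnit_of_forall fun n => by
    rw [twistW_apply]
    exact isUnit_powSum_qDivPow (toLevel_pow_eq_zero (by simp) n) _

theorem counit_twistW (n : ℕ) :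
    Bialgebra.counitAlgHom (LevelRing (LaurentSeries ℂ) n) (ULevel p n) ((twistW p).1 n) = 1 := by
  rw [twistW_apply, powSum_eq_add (toLevel_pow_eq_zero (by simp) n), map_add, map_smul,
    qDivPow_zero, map_one, powSum, map_sum, Finset.sum_eq_zero, smul_zero, add_zero]
  intro k _
  rw [map_smul, qDivPow, map_smul, map_pow, Uq.counit_gen, zero_pow k.succ_ne_zero, smul_zero,
    smul_zero]

theorem twistW_mul_inverse_apply (n : ℕ) :
    (twistW p).1 n * (Ring.inverse (twistW p)).1 n = 1 :=
  congrFun (congrArg Subtype.val (Ring.mul_inverse_cancel _ (isUnit_twistW p))) n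

theorem inverse_mul_twistW_apply (n : ℕ) :
    (Ring.inverse (twistW p)).1 n * (twistW p).1 n = 1 :=
  congrFun (congrArg Subtype.val (Ring.inverse_mul_cancel _ (isUnit_twistW p))) n

theorem abelianTwist_isTwist : UHat₂.IsTwist (abelianTwist p) := fun n =>
  isTwist_exp_tmul (toLevel_isNilpotent (by simp [p.constantCoeff_hbar]) n)
    Uq.commute_hperp_h Uq.comul_hperp (Uq.comul_h 0) Uq.counit_hperp (Uq.counit_gen _)

theorem twistFq_apply (n : ℕ) : (twistFq p).1 n =
    ((twistW p).1 n ⊗ₜ (twistW p).1 n) * (abelianTwist p).1 n *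
      Bialgebra.comulAlgHom (LevelRing (LaurentSeries ℂ) n) (ULevel p n)
        ((Ring.inverse (twistW p)).1 n) := rfl

theorem twistFq_isTwist : UHat₂.IsTwist (twistFq p) := fun n => by
  rw [twistFq_apply]
  exact (abelianTwist_isTwist p n).gauge (twistW_mul_inverse_apply p n)
    (inverse_mul_twistW_apply p n) (counit_twistW p n)

theorem twistFq_equivalent : UHat₂.Equivalent (twistFq p) (abelianTwist p) := by
  obtain ⟨V, hV⟩ := isUnit_twistW p
  refine ⟨V, fun n => by rw [hV, counit_twistW], ?_⟩
  rw [twistFq, ← hV, Ring.inverse_unit]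

theorem isUnit_tmul_twistW : IsUnit (UHat.tmul p (twistW p) (twistW p)) :=
  invLim.isUnit_of_forall fun n => by
    rw [UHat₂.tmul_apply]
    refine isUnit_iff_exists.2
      ⟨(Ring.inverse (twistW p)).1 n ⊗ₜ (Ring.inverse (twistW p)).1 n, ?_, ?_⟩
    · rw [Algebra.TensorProduct.tmul_mul_tmul, twistW_mul_inverse_apply,
        Algebra.TensorProduct.one_def]
    · rw [Algebra.TensorProduct.tmul_mul_tmul, inverse_mul_twistW_apply,
        Algebra.TensorProduct.one_def]

theorem twistFq_eq_conj_mul_coboundaryJ :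
    twistFq p = UHat.tmul p (twistW p) (twistW p) * abelianTwist p *
      Ring.inverse (UHat.tmul p (twistW p) (twistW p)) * coboundaryJ p := by
  rw [coboundaryJ, ← mul_assoc, mul_assoc _ (Ring.inverse _),
    Ring.inverse_mul_cancel _ (isUnit_tmul_twistW p), mul_one, twistFq]

theorem abelianTwist_apply (n : ℕ) : (abelianTwist p).1 n =
    IsNilpotent.exp (toLevel n (C sInv * p.hbar) •
      (Uq.hperp (p.level n) ⊗ₜ[LevelRing (LaurentSeries ℂ) n] Uq.gen (p.level n) (.h 0))) := rfl

/-- If `log q = s² t v`, then `F_q` has no negative powers of `s`. -/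
theorem twistFq_eq_integralTwist {s : LaurentSeries ℂ} {v : (LaurentSeries ℂ)⟦X⟧}
    (hs : sInv * s = 1) (hbar : p.hbar = C s ^ 2 * X * v) :
    twistFq p = UHat₂.integralTwist p s v := by
  refine UHat₂.ext fun n => ?_
  have key := UHat₂.integralTwist_apply_mul_comul p hs hbar n
  rw [← abelianTwist_apply, ← twistW_apply] at key
  rw [twistFq_apply, ← key, mul_assoc, ← map_mul, twistW_mul_inverse_apply, map_one, mul_one]

end Laurent

/-! ### The classical limit -/

section ClassicalLimit

variable (p : FormalParameter ℂ⟦X⟧)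

/-- If `q ≡ 1 + s² t mod s³ t`, then `log q = s² t v` with `v ≡ 1 mod s`. -/
theorem exists_hbar_eq (hp : sVar ^ 3 * tVar ∣ p.q - (1 + sVar ^ 2 * tVar)) :
    ∃ v : ℂ⟦X⟧⟦X⟧, p.hbar = sVar ^ 2 * tVar * v ∧ sVar ∣ v - 1 := by
  obtain ⟨d, hd⟩ := hp
  obtain ⟨w, hw⟩ := exists_logOf_one_add (u := sVar ^ 2 * tVar * (1 + sVar * d)) (by simp)
  have hq : p.q = 1 + sVar ^ 2 * tVar * (1 + sVar * d) := by linear_combination hd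
  refine ⟨(1 + sVar * d) * (1 + sVar ^ 2 * tVar * (1 + sVar * d) * w), ?_,
    ⟨d + (1 + sVar * d) ^ 2 * sVar * tVar * w, by ring⟩⟩
  rw [FormalParameter.hbar, hq, hw]
  ring

variable (hp : PowerSeries.map atZero p.q = 1)

theorem specialize_scalar_eq_zero {c : ℂ⟦X⟧⟦X⟧} (hc : PowerSeries.map atZero c = 0) :
    UHat₂.specialize p atZero hp (UHat₂.scalar p c) = 0 := by
  refine Subtype.ext (funext fun n => ?_)
  change ULevel₂.specialize p atZero hp n (algebraMap _ _ (toLevel n c)) = 0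
  rw [ULevel₂.specialize, tensorMap_algebraMap, levelMap_toLevel, hc, map_zero, map_zero]

theorem slHperp_val : slHperp.1 = !![1 / 3, 0, 0; 0, 1 / 3, 0; 0, 0, -2 / 3] := by
  ext a b
  fin_cases a <;> fin_cases b <;> simp [slHperp]

theorem specialize_hperp_apply (n : ℕ) :
    ULevel.specialize p atZero hp n ((UHat.hperp p).1 n) =
      ClassicalLevel.of n (UniversalEnvelopingAlgebra.ι ℂ slHperp) := by
  have h3 : slHperp = (1 / 3 : ℂ) • (slGen (.h 0) + (2 : ℂ) • slGen (.h 1)) := by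
    refine Subtype.ext ?_
    change slHperp.1 = (1 / 3 : ℂ) • ((slGen (.h 0)).1 + (2 : ℂ) • (slGen (.h 1)).1)
    simp only [slGen_val, slHperp_val]
    ext a b
    fin_cases a <;> fin_cases b <;> simp
    all_goals norm_num
  have h4 : (3 : ℕ) • UniversalEnvelopingAlgebra.ι ℂ slHperp =
      classicalGen (.h 0) + 2 • classicalGen (.h 1) := by
    rw [h3, map_smul, map_add, map_smul, ← Nat.cast_smul_eq_nsmul ℂ, smul_smul]
    norm_num [classicalGen, two_smul]
  have h5 := congrArg (ClassicalLevel.of n) h4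
  rw [map_nsmul, map_add, map_nsmul] at h5
  change ULevel.specialize p atZero hp n
    ((1 / 3 : ℚ) • (Uq.gen _ (.h 0) + 2 • Uq.gen _ (.h 1))) = _
  rw [map_rat_smul, map_add, map_nsmul, ULevel.specialize, Uq.lift_gen, Uq.lift_gen, ← h5,
    ← Nat.cast_smul_eq_nsmul ℚ, smul_smul]
  norm_num

theorem specialize_exp {c : ℂ⟦X⟧⟦X⟧} {c' : ℂ⟦X⟧} (hc : constantCoeff c = 0)
    (hc' : constantCoeff c' = 0) (h : PowerSeries.map atZero c = c') :
    UHat₂.specialize p atZero hp (invLim.exp (ULevel₂.trans_smul p) c hc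
      (UHat.tmul p (UHat.hperp p) (UHat.gen p (.e 0)))) = reshetikhinTwist c' hc' := by
  refine Subtype.ext (funext fun n => ?_)
  change ULevel₂.specialize p atZero hp n (IsNilpotent.exp (toLevel n c •
    ((UHat.hperp p).1 n ⊗ₜ (UHat.gen p (.e 0)).1 n))) = IsNilpotent.exp (toLevel n c' •
    (ClassicalLevel.of n (UniversalEnvelopingAlgebra.ι ℂ slHperp) ⊗ₜ
      ClassicalLevel.of n (UniversalEnvelopingAlgebra.ι ℂ (slGen (.e 0)))))
  have hg : ULevel.specialize p atZero hp n ((UHat.gen p (.e 0)).1 n) =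
      ClassicalLevel.of n (UniversalEnvelopingAlgebra.ι ℂ (slGen (.e 0))) := Uq.lift_gen _ _ _ _
  rw [IsNilpotent.map_exp (isNilpotent_smul (toLevel_isNilpotent hc n) _), ULevel₂.specialize,
    tensorMap_smul, ← ULevel₂.specialize, ULevel₂.specialize_tmul, specialize_hperp_apply, hg,
    levelMap_toLevel, h]

end ClassicalLimit

section Reshetikhin

attribute [local instance 100] LieRing.ofAssociativeRing

theorem commute_ι_slHperp : Commute (UniversalEnvelopingAlgebra.ι ℂ slHperp)
    (UniversalEnvelopingAlgebra.ι ℂ (slGen (.e 0))) := by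
  have h := ι_mul (x := slHperp) (y := slGen (.e 0)) (z := 0) (by
    change _ = 0
    simp only [slGen_val, slHperp_val]
    ext a b
    fin_cases a <;> fin_cases b <;> simp)
  rwa [map_zero, add_zero] at h

theorem ClassicalLevel.comul_of_ι (n : ℕ) (x : sl3) :
    Bialgebra.comulAlgHom (LevelRing ℂ n) (ClassicalLevel n)
      (ClassicalLevel.of n (UniversalEnvelopingAlgebra.ι ℂ x)) =
    ClassicalLevel.of n (UniversalEnvelopingAlgebra.ι ℂ x) ⊗ₜ 1 +
      1 ⊗ₜ ClassicalLevel.of n (UniversalEnvelopingAlgebra.ι ℂ x) := by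
  have h := TensorProduct.comul_tmul (R := ℂ) (S := LevelRing ℂ n) (A := LevelRing ℂ n)
    (B := Usl3) 1 (UniversalEnvelopingAlgebra.ι ℂ x)
  have h1 : Coalgebra.comul (R := ℂ) (UniversalEnvelopingAlgebra.ι ℂ x) =
    UniversalEnvelopingAlgebra.ι ℂ x ⊗ₜ[ℂ] (1 : Usl3) + 1 ⊗ₜ UniversalEnvelopingAlgebra.ι ℂ x :=
    primComul_ι ℂ sl3 x
  have h2 : Coalgebra.comul (R := LevelRing ℂ n) (1 : LevelRing ℂ n) = 1 ⊗ₜ 1 := rfl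
  rw [h1, h2, tmul_add, map_add] at h
  exact h

theorem ClassicalLevel.counit_of_ι (n : ℕ) (x : sl3) :
    Bialgebra.counitAlgHom (LevelRing ℂ n) (ClassicalLevel n)
      (ClassicalLevel.of n (UniversalEnvelopingAlgebra.ι ℂ x)) = 0 := by
  have h := TensorProduct.counit_tmul (R := ℂ) (S := LevelRing ℂ n) (A := LevelRing ℂ n)
    (B := Usl3) 1 (UniversalEnvelopingAlgebra.ι ℂ x)
  have h1 : Coalgebra.counit (R := ℂ) (UniversalEnvelopingAlgebra.ι ℂ x) = 0 := primCounit_ι ℂ sl3 x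
  rw [h1, zero_smul] at h
  exact h

theorem reshetikhinTwist_isTwist (ξ : ℂ⟦X⟧) (hξ : constantCoeff ξ = 0) :
    ClassicalHat₂.IsTwist (reshetikhinTwist ξ hξ) := fun n =>
  isTwist_exp_tmul (toLevel_isNilpotent hξ n)
    (commute_ι_slHperp.map (ClassicalLevel.of n)) (ClassicalLevel.comul_of_ι n _)
    (ClassicalLevel.comul_of_ι n _) (ClassicalLevel.counit_of_ι n _)
    (ClassicalLevel.counit_of_ι n _)

end Reshetikhin

end QSl3

theorem mainTheorem6 (p : QSl3.FormalParameter (PowerSeries ℂ))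
    (hp : QSl3.sVar ^ 3 * QSl3.tVar ∣ p.q - (1 + QSl3.sVar ^ 2 * QSl3.tVar)) :
    -- `W` is invertible, and `F_q` is a twist that is equivalent to the Abelian twist
    IsUnit (QSl3.twistW (p.map QSl3.toLaurent)) ∧
    QSl3.UHat₂.IsTwist (QSl3.abelianTwist (p.map QSl3.toLaurent)) ∧
    QSl3.UHat₂.IsTwist (QSl3.twistFq (p.map QSl3.toLaurent)) ∧
    QSl3.UHat₂.Equivalent (QSl3.twistFq (p.map QSl3.toLaurent))
      (QSl3.abelianTwist (p.map QSl3.toLaurent)) ∧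
    -- `F_q = Ad(W ⊗ W)(q ^ (s⁻¹ h_12^⊥ ⊗ h_12)) J(s,t)`
    QSl3.twistFq (p.map QSl3.toLaurent) =
      QSl3.UHat.tmul _ (QSl3.twistW (p.map QSl3.toLaurent)) (QSl3.twistW (p.map QSl3.toLaurent)) *
        QSl3.abelianTwist (p.map QSl3.toLaurent) *
        Ring.inverse (QSl3.UHat.tmul _ (QSl3.twistW (p.map QSl3.toLaurent))
          (QSl3.twistW (p.map QSl3.toLaurent))) *
        QSl3.coboundaryJ (p.map QSl3.toLaurent) ∧
    -- `F_q ≡ exp(-2 t² h_12^⊥ ⊗ e_12) mod st`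
    QSl3.UHat₂.CongrMod (p := p) (f := QSl3.toLaurent) (QSl3.sVar * QSl3.tVar)
      (QSl3.twistFq (p.map QSl3.toLaurent))
      (QSl3.expHperpE (p.map QSl3.toLaurent) (-2 * PowerSeries.X ^ 2) (by simp)) ∧
    -- the limit `s → 0` is the Reshetikhin twist `exp(ξ H_12^⊥ ⊗ E_12)`, `ξ = -2 t²`
    QSl3.UHat₂.HasLimit (QSl3.map_atZero_eq_one p hp) (QSl3.twistFq (p.map QSl3.toLaurent))
      (QSl3.reshetikhinTwist (-2 * PowerSeries.X ^ 2) (by simp)) ∧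
    QSl3.ClassicalHat₂.IsTwist (QSl3.reshetikhinTwist (-2 * PowerSeries.X ^ 2) (by simp)) := by
  obtain ⟨v, hv, hv1⟩ := QSl3.exists_hbar_eq p hp
  have hq : PowerSeries.C X ∣ p.q ^ 2 - 1 := by
    have h1 : p.q - 1 = (p.q - (1 + QSl3.sVar ^ 2 * QSl3.tVar)) +
        QSl3.sVar ^ 2 * QSl3.tVar := by ring
    have h2 : QSl3.sVar ∣ p.q - 1 := by
      rw [h1]
      exact dvd_add (Dvd.dvd.trans ⟨QSl3.sVar ^ 2 * QSl3.tVar, by ring⟩ hp)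
        ⟨QSl3.sVar * QSl3.tVar, by ring⟩
    have h3 : p.q ^ 2 - 1 = (p.q - 1) * (p.q + 1) := by ring
    rw [h3]
    exact h2.mul_right _
  have hs : QSl3.sInv * QSl3.toLaurent X = 1 := by
    rw [QSl3.toLaurent, HahnSeries.ofPowerSeries_X, QSl3.sInv, HahnSeries.single_mul_single]
    simp
  have hbar : (p.map QSl3.toLaurent).hbar =
      PowerSeries.C (QSl3.toLaurent X) ^ 2 * X * PowerSeries.map QSl3.toLaurent v := by
    have h : (p.map QSl3.toLaurent).hbar = PowerSeries.map QSl3.toLaurent p.hbar :=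
      (QSl3.FormalParameter.map_logOf QSl3.toLaurent p.constantCoeff_q).symm
    rw [h, hv, map_mul, map_mul, map_pow, PowerSeries.map_C, PowerSeries.map_X]
  -- the twist is defined over `ℂ⟦s⟧⟦t⟧`
  have hF : QSl3.UHat₂.baseChange p QSl3.toLaurent (QSl3.UHat₂.integralTwist p X v) =
      QSl3.twistFq (p.map QSl3.toLaurent) := by
    rw [QSl3.UHat₂.baseChange_integralTwist, QSl3.twistFq_eq_integralTwist _ hs hbar]
  obtain ⟨D, hD⟩ := QSl3.UHat₂.scalar_dvd_integralTwist_sub p hv1 hq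
  refine ⟨QSl3.isUnit_twistW _, QSl3.abelianTwist_isTwist _, QSl3.twistFq_isTwist _,
    QSl3.twistFq_equivalent _, QSl3.twistFq_eq_conj_mul_coboundaryJ _, ⟨D, ?_⟩,
    ⟨_, hF, ?_⟩, QSl3.reshetikhinTwist_isTwist _ _⟩
  · rw [← hD, map_sub, hF, QSl3.UHat₂.baseChange_exp p QSl3.toLaurent
      (c' := -2 * X ^ 2) _ (by simp)
      (by rw [map_mul, map_neg, map_ofNat, map_pow, map_X]),
      QSl3.UHat₂.baseChange_tmul p QSl3.toLaurent
      (QSl3.UHat₂.map_hperp_apply p _) (QSl3.UHat₂.map_gen_apply p _ (.e 0))]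
    rfl
  · rw [sub_eq_iff_eq_add] at hD
    rw [hD, map_add, map_mul, QSl3.specialize_scalar_eq_zero p _ (by simp), zero_mul, zero_add]
    exact QSl3.specialize_exp p _ _ _ (by rw [map_mul, map_neg, map_ofNat, map_pow, map_X])
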